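/- Let $U\subset\mathbb{R}^2$ be open and let $\hat x:U\to\mathbb{S}^3\subset\mathbb{R}^4$ be a smooth conformal immersion, i.e. an isothermal parametrization, with coordinates $(u^1,u^2)$, of (a piece of) an immersed surface. Let $\mathbf n$ be a smooth unit normal of $\hat x$ in $\mathbb{S}^3$, let $g_0$ be the round metric, let $\lambda$ be a smooth positive function on $\mathbb{S}^3$, and put $\hat\lambda=\lambda\circ\hat x$. Let $I_\lambda$, $II_\lambda$, $H_\lambda=\frac12\mathrm{tr}_{I_\lambda}II_\lambda$, $\overset{\circ}{II}_\lambda=II_\lambda-H_\lambda I_\lambda$ be the fundamental forms, mean curvature and traceless second fundamental form of $\hat x$ in $(\mathbb{S}^3,\lambda^2g_0)$, with the sign for which $II=-\langle d\hat x,d\mathbf n\rangle$ when $\lambda=1$; no subscript means $\lambda=1$. Let $$\mathcal{H}_\lambda=\Delta_\lambda H_\lambda+|\overset{\circ}{II}_\lambda|^2H_\lambda+(\overset{\circ}{II}_\lambda)^{ij}(R^\lambda)_{i3j3}-(R^\lambda)_{3i,}{}^{i},$$ where $\Delta_\lambda$ is the Laplace--Beltrami operator of $I_\lambda$, $(R^\lambda)_{ijkl}$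 and $(R^\lambda)_{ij}$ are the Riemann and Ricci tensors of $\lambda^2g_0$ (with the signs for which $R_{ijij}>0$ and $\mathrm{Ric}>0$ on round spheres), the index $3$ stands for the $\lambda^2g_0$-unit normal in the direction of $\mathbf n$, and the last term is the divergence on the surface, with respect to $I_\lambda$, of the 1-form $(R^\lambda)_{3i}du^i$. Let $\mathbb{R}^{1,4}=\mathbb{R}\times\mathbb{R}^4$ carry $\langle(t,x),(s,y)\rangle=-ts+x\cdot y$. Put $y_\lambda=\hat\lambda(1,\hat x)$ and $\xi=H(1,\hat x)+(0,\mathbf n)$. Then: (1) If $\hat x$ has no umbilical point, there is exactly one map $y^*_\lambda:U\to\mathbb{R}^{1,4}$ with $$\langle y^*_\lambda,y_\lambda\rangle=-1,\qquad \langle y^*_\lambda,y^*_\lambda\rangle=\langle y^*_\lambda,\xi\rangle=\langle y^*_\lambda,\xi_{u^1}\rangle=\langle y^*_\lambda,\xi_{u^2}\rangle=0,$$ and it is smooth. The associate surface $\tilde x=\alpha y_\lambda+\alpha\rho\,y^*_\lambda$, in the coordinates $(\alpha,\rho,u^1,u^2)$ (the formula being used for all real $\rho$, so that $\rho=0$ is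 an interior value), has unit normal $\xi$, and its first fundamental form $\tilde g$ satisfies $\det\tilde g<0$ at $\rho=0$, $\alpha>0$. With $\tilde h=-\langle d\tilde x,d\xi\rangle$, $\tilde H=\tilde g^{AB}\tilde h_{AB}$ and $\tilde\Delta$ the Laplace--Beltrami operator of $\tilde g$, $$\tilde\Delta\tilde H|_{\rho=0}=2\alpha^{-3}\mathcal{H}_\lambda\qquad\text{for all }\alpha>0.$$ (2) With or without umbilical points, $\mathcal{H}_\lambda=\hat\lambda^{-3}\big(\Delta H+|\overset{\circ}{II}|^2H\big)$. (3) $\mathcal{H}_\lambda$ is a conformal invariant of order $3$: for every smooth positive function $\mu$ on $\mathbb{S}^3$, $\mathcal{H}_{\mu\lambda}=(\mu\circ\hat x)^{-3}\mathcal{H}_\lambda$; and $\mathcal{H}_\lambda$ does not depend on the isothermal coordinates, i.e. if $\psi:V\to U$ is smooth, $V\subset\mathbb{R}^2$ open, and $\hat x\circ\psi$ is again a conformal immersion, then $\mathcal{H}_\lambda$ of $(\hat x\circ\psi,\mathbf n\circ\psi)$ is $\mathcal{H}_\lambda\circ\psi$. (4) $\mathcal{H}_\lambda$ vanishes identically on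 $U$ if and only if $\hat x$ is a Willmore surface, i.e. a critical point of $\int(1+H^2)\,dA$ under all smooth variations through immersions into $\mathbb{S}^3$ that are supported in a compact subset of $U$. -/

import Mathlib

open scoped ContDiff Manifold

noncomputable section

namespace ConformalSurface

/-! ## Calculus in coordinates -/

/-- The partial derivative `∂f/∂vᵢ`. -/
def pd {k : ℕ} {V : Type*} [NormedAddCommGroup V] [NormedSpace ℝ V]
    (i : Fin k) (f : (Fin k → ℝ) → V) (v : Fin k → ℝ) : V :=
  fderiv ℝ f v (Pi.single i 1)

/-- A (pseudo-)Riemannian metric, or any 2-tensor, in coordinates: its matrix at each point. -/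
abbrev TensorField (k : ℕ) := (Fin k → ℝ) → Matrix (Fin k) (Fin k) ℝ

/-- The Christoffel symbols `Γ^c_{ab}` of the metric `g`. -/
def christoffel {k : ℕ} (g : TensorField k) (c a b : Fin k) (v : Fin k → ℝ) : ℝ :=
  (1 / 2) * ∑ d, (g v)⁻¹ c d *
    (pd a (fun w => g w b d) v + pd b (fun w => g w a d) v - pd d (fun w => g w a b) v)

/-- The Riemann tensor `R_{abcd}` of `g`, with the sign for which `R_{abab}` is positive on
round spheres, i.e. `R_{abcd} = g (∇_b ∇_a ∂_c - ∇_a ∇_b ∂_c, ∂_d)`. -/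
def riemann {k : ℕ} (g : TensorField k) (a b c d : Fin k) (v : Fin k → ℝ) : ℝ :=
  ∑ e, g v d e *
    (pd b (fun w => christoffel g e a c w) v - pd a (fun w => christoffel g e b c w) v
      + ∑ f, (christoffel g e b f v * christoffel g f a c v
        - christoffel g e a f v * christoffel g f b c v))

/-- The Ricci tensor `R_{bd} = g^{ac} R_{abcd}` (positive on round spheres). -/
def ricci {k : ℕ} (g : TensorField k) (b d : Fin k) (v : Fin k → ℝ) : ℝ :=
  ∑ a, ∑ c, (g v)⁻¹ a c * riemann g a b c d v

/-- The divergence `∇^a η_a` of a 1-form. -/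
def divergence {k : ℕ} (g : TensorField k) (η : (Fin k → ℝ) → Fin k → ℝ) (v : Fin k → ℝ) : ℝ :=
  (1 / √|(g v).det|) *
    ∑ a, pd a (fun w => √|(g w).det| * ∑ b, (g w)⁻¹ a b * η w b) v

/-- The Laplace–Beltrami operator `|g|^{-1/2} ∂_a (|g|^{1/2} g^{ab} ∂_b f)`. -/
def laplace {k : ℕ} (g : TensorField k) (f : (Fin k → ℝ) → ℝ) (v : Fin k → ℝ) : ℝ :=
  divergence g (fun w b => pd b f w) v

/-- The full trace `g^{ab} h_{ab}`. -/
def traceForm {k : ℕ} (g h : TensorField k) (v : Fin k → ℝ) : ℝ :=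
  ∑ a, ∑ b, (g v)⁻¹ a b * h v a b

/-- The pairing `g^{ac} g^{bd} A_{ab} B_{cd}` of two 2-tensors. -/
def pairing {k : ℕ} (g A B : TensorField k) (v : Fin k → ℝ) : ℝ :=
  ∑ a, ∑ b, ∑ c, ∑ d, (g v)⁻¹ a c * (g v)⁻¹ b d * A v a b * B v c d

/-- The mean curvature (half of the trace) of a surface with fundamental forms `g`, `h`. -/
def meanOf (g h : TensorField 2) (u : Fin 2 → ℝ) : ℝ := (1 / 2) * traceForm g h u

/-- The traceless part of the second fundamental form `h`. -/
def tracelessOf (g h : TensorField 2) : TensorField 2 := fun u => h u - meanOf g h u • g u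

/-! ## Surfaces in the round 3-sphere -/

/-- `ℝ⁴`. -/
abbrev E4 := EuclideanSpace ℝ (Fin 4)

/-- The dimension fact that equips the unit sphere of `ℝ⁴` with its 3-manifold structure. -/
instance factE4 : Fact (Module.finrank ℝ E4 = 3 + 1) := ⟨by simp⟩

/-- `lam` restricts to a smooth positive function on the 3-sphere. Its values elsewhere are
never used. -/
def IsConformalFactor (lam : E4 → ℝ) : Prop :=
  ContMDiff (𝓡 3) 𝓘(ℝ, ℝ) ∞ (fun p : Metric.sphere (0 : E4) 1 => lam p) ∧
    ∀ p ∈ Metric.sphere (0 : E4) 1, 0 < lam p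

/-- `X` is a smooth immersion of `U` into the unit sphere of `ℝ⁴`. -/
def IsImmersion (X : (Fin 2 → ℝ) → E4) (U : Set (Fin 2 → ℝ)) : Prop :=
  ContDiffOn ℝ ∞ X U ∧ ∀ u ∈ U, ‖X u‖ = 1 ∧ Function.Injective (fderiv ℝ X u)

/-- The first fundamental form `⟨dX, dX⟩`. -/
def firstForm (X : (Fin 2 → ℝ) → E4) : TensorField 2 :=
  fun u => Matrix.of fun i j => inner ℝ (pd i X u) (pd j X u)

/-- The coordinates are isothermal: `⟨dX, dX⟩ = E |du|²`. -/
def IsIsothermal (X : (Fin 2 → ℝ) → E4) (U : Set (Fin 2 → ℝ)) : Prop :=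
  ∀ u ∈ U, firstForm X u 0 0 = firstForm X u 1 1 ∧ firstForm X u 0 1 = 0

/-- `n` is a smooth unit normal field of `X` in the 3-sphere. -/
def IsUnitNormal (X n : (Fin 2 → ℝ) → E4) (U : Set (Fin 2 → ℝ)) : Prop :=
  ContDiffOn ℝ ∞ n U ∧ ∀ u ∈ U, ‖n u‖ = 1 ∧ inner ℝ (n u) (X u) = 0 ∧
    ∀ i, inner ℝ (n u) (pd i X u) = 0

/-- The second fundamental form `-⟨dX, dn⟩`. -/
def secondForm (X n : (Fin 2 → ℝ) → E4) : TensorField 2 :=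
  fun u => Matrix.of fun i j => -inner ℝ (pd i X u) (pd j n u)

/-- The mean curvature `H` in the round sphere. -/
def meanCurv (X n : (Fin 2 → ℝ) → E4) : (Fin 2 → ℝ) → ℝ :=
  meanOf (firstForm X) (secondForm X n)

/-- The traceless second fundamental form in the round sphere. -/
def traceless (X n : (Fin 2 → ℝ) → E4) : TensorField 2 :=
  tracelessOf (firstForm X) (secondForm X n)

/-- A point is umbilical when the traceless second fundamental form vanishes there. -/
def UmbilicFree (X n : (Fin 2 → ℝ) → E4) (U : Set (Fin 2 → ℝ)) : Prop :=
  ∀ u ∈ U, traceless X n u ≠ 0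

/-- `ΔH + |II°|² H` in the round sphere. -/
def willmoreCurv (X n : (Fin 2 → ℝ) → E4) (u : Fin 2 → ℝ) : ℝ :=
  laplace (firstForm X) (meanCurv X n) u
    + pairing (firstForm X) (traceless X n) (traceless X n) u * meanCurv X n u

/-- The Willmore energy `∫_K (1 + H²) dA` of the piece of the surface over `K`. -/
def willmoreEnergy (X n : (Fin 2 → ℝ) → E4) (K : Set (Fin 2 → ℝ)) : ℝ :=
  ∫ u in K, (1 + meanCurv X n u ^ 2) * √(firstForm X u).det

/-- `F` is a smooth variation of the immersed surface `X` through surfaces in the 3-sphere,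
for `|t| < ε` and supported in the set `K`; `N` is a smooth choice of unit normals. -/
structure IsVariation (X : (Fin 2 → ℝ) → E4) (U K : Set (Fin 2 → ℝ)) (ε : ℝ)
    (F N : ℝ → (Fin 2 → ℝ) → E4) : Prop where
  smooth : ContDiffOn ℝ ∞ (fun p : ℝ × (Fin 2 → ℝ) => F p.1 p.2) (Set.Ioo (-ε) ε ×ˢ U)
  smooth_normal : ContDiffOn ℝ ∞ (fun p : ℝ × (Fin 2 → ℝ) => N p.1 p.2) (Set.Ioo (-ε) ε ×ˢ U)
  immersion : ∀ t ∈ Set.Ioo (-ε) ε, IsImmersion (F t) U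
  normal : ∀ t ∈ Set.Ioo (-ε) ε, IsUnitNormal (F t) (N t) U
  start : ∀ u ∈ U, F 0 u = X u
  support : ∀ t ∈ Set.Ioo (-ε) ε, ∀ u ∈ U \ K, F t u = X u

/-- A Willmore surface: a critical point of the Willmore energy under all smooth compactly
supported variations. -/
def IsWillmore (X : (Fin 2 → ℝ) → E4) (U : Set (Fin 2 → ℝ)) : Prop :=
  ∀ (K : Set (Fin 2 → ℝ)) (ε : ℝ) (F N : ℝ → (Fin 2 → ℝ) → E4),
    IsCompact K → K ⊆ U → 0 < ε → IsVariation X U K ε F N →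
      HasDerivAt (fun t => willmoreEnergy (F t) (N t) K) 0 0

/-! ## The surface in the 3-sphere with the metric `λ² g₀`

All quantities are computed from the matrix of `λ² g₀` in the coordinates `(u¹, u², s)` of the
sphere given by `cos s · X(u) + sin s · n(u)`, a local diffeomorphism near `s = 0`, for which
the surface is `s = 0` and `∂_s = n` there. The coordinate field `∂_s` has length `√G_{ss}`, so
that the unit normal in `λ² g₀` is `G_{ss}^{-1/2} ∂_s`. -/

/-- The sphere coordinates adapted to the surface. -/
def adapted (X n : (Fin 2 → ℝ) → E4) (v : Fin 3 → ℝ) : E4 :=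
  Real.cos (v 2) • X ![v 0, v 1] + Real.sin (v 2) • n ![v 0, v 1]

/-- The metric `λ² g₀` in these coordinates. -/
def ambient (lam : E4 → ℝ) (X n : (Fin 2 → ℝ) → E4) : TensorField 3 :=
  fun v => Matrix.of fun a b =>
    lam (adapted X n v) ^ 2 * inner ℝ (pd a (adapted X n) v) (pd b (adapted X n) v)

/-- The point of the surface with parameter `u`, in the adapted coordinates. -/
def onSurface (u : Fin 2 → ℝ) : Fin 3 → ℝ := ![u 0, u 1, 0]

/-- The first fundamental form in `λ² g₀`. -/
def firstFormL (lam : E4 → ℝ) (X n : (Fin 2 → ℝ) → E4) : TensorField 2 :=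
  fun u => Matrix.of fun i j => ambient lam X n (onSurface u) i.castSucc j.castSucc

/-- The second fundamental form in `λ² g₀`: the inner product of `∇_i ∂_j` with the unit
normal. -/
def secondFormL (lam : E4 → ℝ) (X n : (Fin 2 → ℝ) → E4) : TensorField 2 :=
  fun u => Matrix.of fun i j =>
    (∑ c, christoffel (ambient lam X n) c i.castSucc j.castSucc (onSurface u)
      * ambient lam X n (onSurface u) c 2) / √(ambient lam X n (onSurface u) 2 2)

/-- The mean curvature `H_λ`. -/
def meanCurvL (lam : E4 → ℝ) (X n : (Fin 2 → ℝ) → E4) : (Fin 2 → ℝ) → ℝ :=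
  meanOf (firstFormL lam X n) (secondFormL lam X n)

/-- The traceless second fundamental form in `λ² g₀`. -/
def tracelessL (lam : E4 → ℝ) (X n : (Fin 2 → ℝ) → E4) : TensorField 2 :=
  tracelessOf (firstFormL lam X n) (secondFormL lam X n)

/-- The components `R_{i3j3}`, where the index 3 stands for the unit normal. -/
def normalRiemann (lam : E4 → ℝ) (X n : (Fin 2 → ℝ) → E4) : TensorField 2 :=
  fun u => Matrix.of fun i j =>
    riemann (ambient lam X n) i.castSucc 2 j.castSucc 2 (onSurface u)
      / ambient lam X n (onSurface u) 2 2

/-- The components `R_{3i}` of the Ricci tensor, a 1-form on the surface. -/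
def normalRicci (lam : E4 → ℝ) (X n : (Fin 2 → ℝ) → E4) : (Fin 2 → ℝ) → Fin 2 → ℝ :=
  fun u i => ricci (ambient lam X n) 2 i.castSucc (onSurface u)
    / √(ambient lam X n (onSurface u) 2 2)

/-- `Δ_λ H_λ + |II°_λ|² H_λ + (II°_λ)^{ij} R_{i3j3} - R_{3i,}^i`. -/
def scriptH (lam : E4 → ℝ) (X n : (Fin 2 → ℝ) → E4) (u : Fin 2 → ℝ) : ℝ :=
  laplace (firstFormL lam X n) (meanCurvL lam X n) u
    + pairing (firstFormL lam X n) (tracelessL lam X n) (tracelessL lam X n) u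
        * meanCurvL lam X n u
    + pairing (firstFormL lam X n) (tracelessL lam X n) (normalRiemann lam X n) u
    - divergence (firstFormL lam X n) (normalRicci lam X n) u

/-! ## The associate surface in Minkowski spacetime -/

/-- Minkowski spacetime `ℝ^{1,4}`. -/
abbrev Mink := ℝ × E4

/-- The Lorentz inner product. -/
def lor (p q : Mink) : ℝ := -(p.1 * q.1) + inner ℝ p.2 q.2

/-- The conformal Gauss map `ξ = H (1, X) + (0, n)`. -/
def gaussMap (X n : (Fin 2 → ℝ) → E4) (u : Fin 2 → ℝ) : Mink :=
  meanCurv X n u • ((1, X u) : Mink) + (0, n u)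

/-- The null lift `y_λ = λ (1, X)`. -/
def lift (lam : E4 → ℝ) (X : (Fin 2 → ℝ) → E4) (u : Fin 2 → ℝ) : Mink :=
  lam (X u) • ((1, X u) : Mink)

/-- The equations that determine the null vector `y*_λ`. -/
def IsDual (lam : E4 → ℝ) (X n : (Fin 2 → ℝ) → E4) (U : Set (Fin 2 → ℝ))
    (ys : (Fin 2 → ℝ) → Mink) : Prop :=
  ∀ u ∈ U, lor (ys u) (lift lam X u) = -1 ∧ lor (ys u) (ys u) = 0 ∧
    lor (ys u) (gaussMap X n u) = 0 ∧ ∀ i, lor (ys u) (pd i (gaussMap X n) u) = 0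

/-- The associate surface `α y_λ + α ρ y*_λ` in the coordinates `(α, ρ, u¹, u²)`. -/
def associate (lam : E4 → ℝ) (X : (Fin 2 → ℝ) → E4) (ys : (Fin 2 → ℝ) → Mink)
    (v : Fin 4 → ℝ) : Mink :=
  v 0 • lift lam X ![v 2, v 3] + (v 0 * v 1) • ys ![v 2, v 3]

/-- The conformal Gauss map as a vector field along the associate surface. -/
def normalField (X n : (Fin 2 → ℝ) → E4) (v : Fin 4 → ℝ) : Mink := gaussMap X n ![v 2, v 3]

/-- The first fundamental form of the associate surface. -/
def assocMetric (lam : E4 → ℝ) (X : (Fin 2 → ℝ) → E4) (ys : (Fin 2 → ℝ) → Mink) :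
    TensorField 4 :=
  fun v => Matrix.of fun a b =>
    lor (pd a (associate lam X ys) v) (pd b (associate lam X ys) v)

/-- The second fundamental form `-⟨dx̃, dξ⟩` of the associate surface. -/
def assocSecond (lam : E4 → ℝ) (X n : (Fin 2 → ℝ) → E4) (ys : (Fin 2 → ℝ) → Mink) :
    TensorField 4 :=
  fun v => Matrix.of fun a b =>
    -lor (pd a (associate lam X ys) v) (pd b (normalField X n) v)

/-- The mean curvature (full trace) of the associate surface. -/
def assocMean (lam : E4 → ℝ) (X n : (Fin 2 → ℝ) → E4) (ys : (Fin 2 → ℝ) → Mink) :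
    (Fin 4 → ℝ) → ℝ :=
  traceForm (assocMetric lam X ys) (assocSecond lam X n ys)

end ConformalSurface

end

/-! Everything is compared with the round expression `willmoreCurv`, ΔH + |II°|²H. The hub is
`scriptH_eq`, which says that 𝓗_λ is λ⁻³ times it. In the coordinates cos s · X + sin s · n the
metric λ²g₀ is λ²(cos² s I − 2 sin s cos s II + sin² s III + ds²), so its 2-jet at s = 0 is explicit
in the fundamental forms and in λ. With E = `conf X`, f = λ ∘ X and κ = λ_s/λ² one finds H_λ = H/λ −
κ and R_{3i} = −κ_i − λ⁻²(H f_i + II°(∇f)_i/E). The Laplacian of κ cancels between Δ_λ H_λ and the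
divergence of R_{3i}. The second derivatives of f cancel among Δ_λ H_λ, that divergence and the term
with R_{i3j3}. The Codazzi equations dispose of the derivatives of II°. Conformal invariance of
order 3 is then immediate, and independence of the coordinates follows from that of ΔH + |II°|²H
(`willmoreCurv_comp`): a conformal change of coordinates has harmonic components, whether or not it
preserves orientation.

For the associate surface, the decisive formula is `pd_gaussMap`: the derivative of ξ is H_i (1, X)
minus the traceless form applied to the tangent frame. Away from umbilics that form is invertible,
so the orthogonality relations fix every component of y* except one along (1, X), and nullity fixes
that one (`isDual_dualVec`, `isDual_unique`). The metric of the associate surface is a polynomial in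
α and ρ with coefficients depending on u only. At ρ = 0 both g^{ρρ} and the mean curvature vanish,
so the Laplacian sees the mean curvature only through its ρ-derivative Φ/α and equals 2Φ/α³
(`slice_pd_traceForm`, `slice_laplace`). Finally Φ = λ⁻³(ΔH + |II°|²H) by `dual_identity`: the
relations defining y* express dH through II°, and their divergence produces ΔH.

For Willmore surfaces, the derivative of the energy density is E(ΔH + |II°|²H)⟨W, n⟩ plus the
divergence of a compactly supported flux, W being the velocity (`vel_energyDensity`). One direction
is then clear. The other uses variations along normal great circles (`exists_isVariation_normalVar`)
and the fundamental lemma of the calculus of variations. -/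

open scoped Topology
open MeasureTheory

noncomputable section

namespace ConformalSurface

/-! ### Rules for partial derivatives. -/

section Calculus

variable {k : ℕ} {V : Type*} [NormedAddCommGroup V] [NormedSpace ℝ V] {v : Fin k → ℝ}

theorem pd_congr {f g : (Fin k → ℝ) → V} (i : Fin k) (h : f =ᶠ[𝓝 v] g) : pd i f v = pd i g v := by
  simp only [pd, h.fderiv_eq]

theorem pd_congr_on {f g : (Fin k → ℝ) → V} {U : Set (Fin k → ℝ)} (hU : IsOpen U)
    (h : ∀ w ∈ U, f w = g w) (i : Fin k) (hv : v ∈ U) : pd i f v = pd i g v :=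
  pd_congr i (Filter.eventually_of_mem (hU.mem_nhds hv) h)

@[simp] theorem pd_const (i : Fin k) (c : V) : pd i (fun _ => c) v = 0 := by simp [pd]

theorem pd_const_fun (i : Fin k) (c : V) :
    pd i (fun _ : Fin k → ℝ => c) = fun _ => 0 := by ext; simp

theorem pd_add {f g : (Fin k → ℝ) → V} (i : Fin k) (hf : DifferentiableAt ℝ f v)
    (hg : DifferentiableAt ℝ g v) : pd i (fun w => f w + g w) v = pd i f v + pd i g v := by
  simp [pd, fderiv_fun_add hf hg]

theorem pd_sub {f g : (Fin k → ℝ) → V} (i : Fin k) (hf : DifferentiableAt ℝ f v)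
    (hg : DifferentiableAt ℝ g v) : pd i (fun w => f w - g w) v = pd i f v - pd i g v := by
  simp [pd, fderiv_fun_sub hf hg]

theorem pd_neg (f : (Fin k → ℝ) → V) (i : Fin k) : pd i (fun w => -f w) v = -pd i f v := by
  simp [pd, fderiv_fun_neg]

theorem pd_mul {f g : (Fin k → ℝ) → ℝ} (i : Fin k) (hf : DifferentiableAt ℝ f v)
    (hg : DifferentiableAt ℝ g v) :
    pd i (fun w => f w * g w) v = pd i f v * g v + f v * pd i g v := by
  simp [pd, fderiv_fun_mul hf hg]; ring

theorem pd_smul {f : (Fin k → ℝ) → ℝ} {g : (Fin k → ℝ) → V} (i : Fin k)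
    (hf : DifferentiableAt ℝ f v) (hg : DifferentiableAt ℝ g v) :
    pd i (fun w => f w • g w) v = pd i f v • g v + f v • pd i g v := by
  simp [pd, fderiv_fun_smul hf hg, add_comm]

theorem pd_pow {f : (Fin k → ℝ) → ℝ} (i : Fin k) (m : ℕ) (hf : DifferentiableAt ℝ f v) :
    pd i (fun w => f w ^ m) v = m * f v ^ (m - 1) * pd i f v := by
  simp [pd, fderiv_fun_pow m hf]

theorem pd_inv {f : (Fin k → ℝ) → ℝ} (i : Fin k) (hf : DifferentiableAt ℝ f v) (h0 : f v ≠ 0) :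
    pd i (fun w => (f w)⁻¹) v = -pd i f v / f v ^ 2 := by
  have := ((hasDerivAt_inv h0).comp_hasFDerivAt v hf.hasFDerivAt).fderiv
  simp only [pd]
  rw [show (fun w => (f w)⁻¹) = (fun x => x⁻¹) ∘ f from rfl, this]
  simp; ring

theorem diffAt_div {f g : (Fin k → ℝ) → ℝ} (hf : DifferentiableAt ℝ f v)
    (hg : DifferentiableAt ℝ g v) (h0 : g v ≠ 0) :
    DifferentiableAt ℝ (fun w => f w / g w) v := by
  simpa only [div_eq_mul_inv] using hf.fun_mul (hg.fun_inv h0)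

theorem pd_div {f g : (Fin k → ℝ) → ℝ} (i : Fin k) (hf : DifferentiableAt ℝ f v)
    (hg : DifferentiableAt ℝ g v) (h0 : g v ≠ 0) :
    pd i (fun w => f w / g w) v = (pd i f v * g v - f v * pd i g v) / g v ^ 2 := by
  simp only [div_eq_mul_inv (f _) (g _)]
  rw [pd_mul i hf (hg.fun_inv h0), pd_inv i hg h0]
  field_simp
  ring

theorem pd_sum {ι : Type*} (s : Finset ι) {f : ι → (Fin k → ℝ) → V} (i : Fin k)
    (hf : ∀ j ∈ s, DifferentiableAt ℝ (f j) v) :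
    pd i (fun w => ∑ j ∈ s, f j w) v = ∑ j ∈ s, pd i (f j) v := by
  simp [pd, fderiv_fun_sum hf]

theorem pd_inner {f g : (Fin k → ℝ) → E4} (i : Fin k) (hf : DifferentiableAt ℝ f v)
    (hg : DifferentiableAt ℝ g v) :
    pd i (fun w => (inner ℝ (f w) (g w) : ℝ)) v
      = inner ℝ (pd i f v) (g v) + inner ℝ (f v) (pd i g v) := by
  simp [pd, fderiv_inner_apply ℝ hf hg, add_comm]

theorem pd_coord (i j : Fin k) : pd i (fun w : Fin k → ℝ => w j) v = if i = j then 1 else 0 := by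
  have : fderiv ℝ (fun w : Fin k → ℝ => w j) v = ContinuousLinearMap.proj j :=
    (ContinuousLinearMap.proj (R := ℝ) (φ := fun _ : Fin k => ℝ) j).fderiv
  simp [pd, this, Pi.single_apply, eq_comm]

theorem smooth_pd {f : (Fin k → ℝ) → V} {U : Set (Fin k → ℝ)} (hU : IsOpen U)
    (hf : ContDiffOn ℝ ∞ f U) (i : Fin k) : ContDiffOn ℝ ∞ (pd i f) U :=
  (hf.fderiv_of_isOpen hU (by simp)).clm_apply contDiffOn_const

theorem diffAt {E : Type*} [NormedAddCommGroup E] [NormedSpace ℝ E] {x : E}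
    {f : E → V} {U : Set E} (hU : IsOpen U)
    (hf : ContDiffOn ℝ ∞ f U) (hx : x ∈ U) : DifferentiableAt ℝ f x :=
  (hf.contDiffAt (hU.mem_nhds hx)).differentiableAt (by simp)

theorem pd_comm {f : (Fin k → ℝ) → V} {U : Set (Fin k → ℝ)} (hU : IsOpen U)
    (hf : ContDiffOn ℝ ∞ f U) (i j : Fin k) (hv : v ∈ U) :
    pd i (pd j f) v = pd j (pd i f) v := by
  have hd : DifferentiableAt ℝ (fderiv ℝ f) v :=
    diffAt hU (hf.fderiv_of_isOpen (m := ∞) hU (by simp)) hv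
  have key : ∀ a b : Fin k, pd a (pd b f) v
      = fderiv ℝ (fderiv ℝ f) v (Pi.single a 1) (Pi.single b 1) := by
    intro a b
    have : fderiv ℝ (fun w => fderiv ℝ f w (Pi.single b 1)) v
        = (fderiv ℝ (fderiv ℝ f) v).flip (Pi.single b 1) := by
      rw [fderiv_clm_apply hd (by fun_prop)]; simp
    change fderiv ℝ (fun w => fderiv ℝ f w (Pi.single b 1)) v (Pi.single a 1) = _
    rw [this]; rfl
  rw [key, key]
  have hs : IsSymmSndFDerivAt ℝ f v :=
    (hf.contDiffAt (hU.mem_nhds hv)).isSymmSndFDerivAt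
      (by simpa using (WithTop.coe_le_coe.2 le_top : ((2 : ℕ∞) : WithTop ℕ∞) ≤ ∞))
  exact hs _ _

end Calculus

/-- A conformal factor composed with a smooth map into the sphere is smooth. -/
theorem IsConformalFactor.smooth_comp {lam : E4 → ℝ} (hlam : IsConformalFactor lam) {k : ℕ}
    {f : (Fin k → ℝ) → E4} {W : Set (Fin k → ℝ)} (hW : IsOpen W) (hf : ContDiffOn ℝ ∞ f W)
    (hs : ∀ w ∈ W, ‖f w‖ = 1) : ContDiffOn ℝ ∞ (fun w => lam (f w)) W := by
  -- `lam` is smooth only as a function on the sphere manifold, so `f` is turned into a manifold map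
  -- from the open set `W` into the sphere before composing.
  let O : TopologicalSpace.Opens (Fin k → ℝ) := ⟨W, hW⟩
  have h1 : ContMDiff 𝓘(ℝ, Fin k → ℝ) 𝓘(ℝ, E4) ∞ (fun w : O => f w) := fun w =>
    contMDiffAt_subtype_iff.2 (hf.contDiffAt (hW.mem_nhds w.2)).contMDiffAt
  have h2 := h1.codRestrict_sphere (n := 3) (fun w => by simpa using hs w w.2)
  have h3 := hlam.1.comp h2
  intro w hw
  have h4 : ContMDiffAt 𝓘(ℝ, Fin k → ℝ) 𝓘(ℝ, ℝ) ∞ (fun w : O => lam (f w)) ⟨w, hw⟩ := h3 _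
  have h5 := (contMDiffAt_subtype_iff (f := fun w => lam (f w)) (x := (⟨w, hw⟩ : O))).1 h4
  exact h5.contDiffAt.contDiffWithinAt

theorem IsConformalFactor.mul {lam mu : E4 → ℝ} (hm : IsConformalFactor mu)
    (hl : IsConformalFactor lam) : IsConformalFactor fun p => mu p * lam p :=
  ⟨hm.1.mul hl.1, fun p hp => mul_pos (hm.2 p hp) (hl.2 p hp)⟩

/-! ### Two-dimensional conformal metrics -/

theorem pairing_conformal {g A B : TensorField 2} {r : ℝ} {u : Fin 2 → ℝ} (hr : r ≠ 0)
    (hg : g u = r • (1 : Matrix (Fin 2) (Fin 2) ℝ)) :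
    pairing g A B u = (A u 0 0 * B u 0 0 + A u 0 1 * B u 0 1 + A u 1 0 * B u 1 0
      + A u 1 1 * B u 1 1) / r ^ 2 := by
  have hi : (g u)⁻¹ = r⁻¹ • (1 : Matrix (Fin 2) (Fin 2) ℝ) := by
    rw [hg]; apply Matrix.inv_eq_right_inv; simp [hr]
  simp [pairing, hi, Matrix.one_apply]
  field_simp
  ring

theorem meanOf_conformal {g h : TensorField 2} {r : ℝ} {u : Fin 2 → ℝ} (hr : r ≠ 0)
    (hg : g u = r • (1 : Matrix (Fin 2) (Fin 2) ℝ)) :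
    meanOf g h u = (h u 0 0 + h u 1 1) / (2 * r) := by
  have hi : (g u)⁻¹ = r⁻¹ • (1 : Matrix (Fin 2) (Fin 2) ℝ) := by
    rw [hg]; apply Matrix.inv_eq_right_inv; simp [hr]
  simp [meanOf, traceForm, hi, Matrix.one_apply]
  field_simp

/-- In dimension two the factor √det g · g⁻¹ is the identity for g = r·1, so only the outer factor
1/r survives. This is the conformal covariance of the Laplacian that makes isothermal coordinates
convenient. -/
theorem divergence_conformal {g : TensorField 2} {r : (Fin 2 → ℝ) → ℝ} {U : Set (Fin 2 → ℝ)}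
    (hU : IsOpen U) (hr : ∀ u ∈ U, 0 < r u)
    (hg : ∀ u ∈ U, g u = r u • (1 : Matrix (Fin 2) (Fin 2) ℝ))
    (η : (Fin 2 → ℝ) → Fin 2 → ℝ) {u : Fin 2 → ℝ} (hu : u ∈ U) :
    divergence g η u = (pd 0 (fun w => η w 0) u + pd 1 (fun w => η w 1) u) / r u := by
  have hi : ∀ w ∈ U, (g w)⁻¹ = (r w)⁻¹ • (1 : Matrix (Fin 2) (Fin 2) ℝ) := fun w hw => by
    rw [hg w hw]; apply Matrix.inv_eq_right_inv; simp [(hr w hw).ne']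
  have hd : ∀ w ∈ U, √|(g w).det| = r w := fun w hw => by
    rw [hg w hw, Matrix.det_fin_two]
    simp [abs_mul_abs_self, Real.sqrt_mul_self (hr w hw).le]
  have hv : ∀ a : Fin 2, ∀ w ∈ U, √|(g w).det| * ∑ b, (g w)⁻¹ a b * η w b = η w a := fun a w hw => by
    have := (hr w hw).ne'
    rw [hd w hw, hi w hw]
    simp [Matrix.one_apply, this]
  rw [divergence, Fin.sum_univ_two, pd_congr_on hU (hv 0) 0 hu, pd_congr_on hU (hv 1) 1 hu, hd u hu]
  ring

theorem laplace_conformal {g : TensorField 2} {r : (Fin 2 → ℝ) → ℝ} {U : Set (Fin 2 → ℝ)}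
    (hU : IsOpen U) (hr : ∀ u ∈ U, 0 < r u)
    (hg : ∀ u ∈ U, g u = r u • (1 : Matrix (Fin 2) (Fin 2) ℝ))
    (f : (Fin 2 → ℝ) → ℝ) {u : Fin 2 → ℝ} (hu : u ∈ U) :
    laplace g f u = (pd 0 (pd 0 f) u + pd 1 (pd 1 f) u) / r u := by
  simp only [laplace]
  rw [divergence_conformal hU hr hg _ hu]

/-! ### Structure equations of an isothermal surface -/

theorem inner_pd_of_eq {k : ℕ} {U : Set (Fin k → ℝ)} (hU : IsOpen U) {f g : (Fin k → ℝ) → E4}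
    {φ : (Fin k → ℝ) → ℝ} (hf : ContDiffOn ℝ ∞ f U) (hg : ContDiffOn ℝ ∞ g U)
    (h : ∀ w ∈ U, inner ℝ (f w) (g w) = φ w) (i : Fin k) {u : Fin k → ℝ} (hu : u ∈ U) :
    (inner ℝ (pd i f u) (g u) : ℝ) + inner ℝ (f u) (pd i g u) = pd i φ u := by
  rw [← pd_inner i (diffAt hU hf hu) (diffAt hU hg hu)]
  exact pd_congr_on hU h i hu

/-- An isothermal immersed surface in the 3-sphere with a unit normal. -/
structure IsothermalSurface (X n : (Fin 2 → ℝ) → E4) (U : Set (Fin 2 → ℝ)) : Prop where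
  isOpen : IsOpen U
  immersion : IsImmersion X U
  isothermal : IsIsothermal X U
  normal : IsUnitNormal X n U

/-- The conformal factor `⟨X₀, X₀⟩` of the first fundamental form. -/
def conf (X : (Fin 2 → ℝ) → E4) (u : Fin 2 → ℝ) : ℝ := inner ℝ (pd 0 X u) (pd 0 X u)

/-- The coefficients of the second fundamental form. -/
def sff (X n : (Fin 2 → ℝ) → E4) (i j : Fin 2) (u : Fin 2 → ℝ) : ℝ :=
  -inner ℝ (pd i X u) (pd j n u)

/-- The diagonal coefficient of the traceless second fundamental form. -/
def hopfP (X n : (Fin 2 → ℝ) → E4) (u : Fin 2 → ℝ) : ℝ := (sff X n 0 0 u - sff X n 1 1 u) / 2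

/-- The off-diagonal coefficient of the traceless second fundamental form. -/
def hopfQ (X n : (Fin 2 → ℝ) → E4) (u : Fin 2 → ℝ) : ℝ := sff X n 0 1 u

namespace IsothermalSurface

variable {X n : (Fin 2 → ℝ) → E4} {U : Set (Fin 2 → ℝ)} (S : IsothermalSurface X n U)
  {u : Fin 2 → ℝ}

include S

theorem smoothX : ContDiffOn ℝ ∞ X U := S.immersion.1
theorem smoothN : ContDiffOn ℝ ∞ n U := S.normal.1
theorem smooth_pdX (i : Fin 2) : ContDiffOn ℝ ∞ (pd i X) U := smooth_pd S.isOpen S.smoothX i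
theorem smooth_pdN (i : Fin 2) : ContDiffOn ℝ ∞ (pd i n) U := smooth_pd S.isOpen S.smoothN i
theorem smooth_pdpdX (i j : Fin 2) : ContDiffOn ℝ ∞ (pd i (pd j X)) U :=
  smooth_pd S.isOpen (S.smooth_pdX j) i

theorem smooth_conf : ContDiffOn ℝ ∞ (conf X) U := (S.smooth_pdX 0).inner ℝ (S.smooth_pdX 0)

theorem smooth_sff (i j : Fin 2) : ContDiffOn ℝ ∞ (sff X n i j) U :=
  ((S.smooth_pdX i).inner ℝ (S.smooth_pdN j)).neg

theorem smooth_hopfP : ContDiffOn ℝ ∞ (hopfP X n) U :=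
  ((S.smooth_sff 0 0).sub (S.smooth_sff 1 1)).div_const 2

theorem smooth_hopfQ : ContDiffOn ℝ ∞ (hopfQ X n) U := S.smooth_sff 0 1

variable (hu : u ∈ U)
include hu

theorem inner_XX : (inner ℝ (X u) (X u) : ℝ) = 1 := by
  rw [real_inner_self_eq_norm_sq, (S.immersion.2 u hu).1]; norm_num

theorem inner_nn : (inner ℝ (n u) (n u) : ℝ) = 1 := by
  rw [real_inner_self_eq_norm_sq, (S.normal.2 u hu).1]; norm_num

theorem inner_nX : (inner ℝ (n u) (X u) : ℝ) = 0 := (S.normal.2 u hu).2.1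

theorem inner_n_pdX (i : Fin 2) : (inner ℝ (n u) (pd i X u) : ℝ) = 0 := (S.normal.2 u hu).2.2 i

theorem inner_X_pdX (i : Fin 2) : (inner ℝ (X u) (pd i X u) : ℝ) = 0 := by
  have := inner_pd_of_eq S.isOpen S.smoothX S.smoothX (φ := fun _ => 1)
    (fun w hw => S.inner_XX hw) i hu
  rw [pd_const, real_inner_comm] at this
  linarith

theorem inner_n_pdN (i : Fin 2) : (inner ℝ (n u) (pd i n u) : ℝ) = 0 := by
  have := inner_pd_of_eq S.isOpen S.smoothN S.smoothN (φ := fun _ => 1)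
    (fun w hw => S.inner_nn hw) i hu
  rw [pd_const, real_inner_comm] at this
  linarith

theorem inner_X_pdN (i : Fin 2) : (inner ℝ (X u) (pd i n u) : ℝ) = 0 := by
  have := inner_pd_of_eq S.isOpen S.smoothN S.smoothX (φ := fun _ => 0)
    (fun w hw => S.inner_nX hw) i hu
  rw [pd_const, S.inner_n_pdX hu, real_inner_comm] at this
  linarith

theorem inner_pdX (i j : Fin 2) :
    (inner ℝ (pd i X u) (pd j X u) : ℝ) = if i = j then conf X u else 0 := by
  obtain ⟨h1, h2⟩ := S.isothermal u hu
  simp only [firstForm, Matrix.of_apply] at h1 h2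
  fin_cases i <;> fin_cases j
  · rfl
  · exact h2
  · exact (real_inner_comm _ _).trans h2
  · exact h1.symm

theorem conf_pos : 0 < conf X u := by
  have h := (S.immersion.2 u hu).2
  rw [conf, real_inner_self_pos]
  intro h0
  have : (Pi.single 0 1 : Fin 2 → ℝ) = 0 := h (by simpa [pd] using h0)
  simpa using congrFun this 0

omit S hu in
theorem inner_pdX_pdN (i j : Fin 2) : (inner ℝ (pd i X u) (pd j n u) : ℝ) = -sff X n i j u := by
  simp [sff]

theorem inner_pdpdX_n (i j : Fin 2) : (inner ℝ (n u) (pd i (pd j X) u) : ℝ) = sff X n j i u := by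
  have := inner_pd_of_eq S.isOpen S.smoothN (S.smooth_pdX j) (φ := fun _ => 0)
    (fun w hw => S.inner_n_pdX hw j) i hu
  rw [pd_const, real_inner_comm, inner_pdX_pdN] at this
  linarith

/-- Both sides are the normal component of a second derivative of X, and second derivatives commute.
-/
theorem sff_symm (i j : Fin 2) : sff X n i j u = sff X n j i u := by
  rw [← S.inner_pdpdX_n hu, ← S.inner_pdpdX_n hu, pd_comm S.isOpen S.smoothX _ _ hu]

theorem sff_10 : sff X n 1 0 u = hopfQ X n u := S.sff_symm hu 1 0

omit S hu in
theorem sff_01 : sff X n 0 1 u = hopfQ X n u := rfl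

theorem firstForm_eq : firstForm X u = conf X u • (1 : Matrix (Fin 2) (Fin 2) ℝ) := by
  ext i j
  simp [firstForm, S.inner_pdX hu, Matrix.one_apply]

theorem meanCurv_eq : meanCurv X n u = (sff X n 0 0 u + sff X n 1 1 u) / (2 * conf X u) := by
  rw [meanCurv, meanOf_conformal (S.conf_pos hu).ne' (S.firstForm_eq hu)]
  rfl

theorem sff_00 : sff X n 0 0 u = conf X u * meanCurv X n u + hopfP X n u := by
  have := (S.conf_pos hu).ne'
  rw [S.meanCurv_eq hu, hopfP]; field_simp; ring

theorem sff_11 : sff X n 1 1 u = conf X u * meanCurv X n u - hopfP X n u := by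
  have := (S.conf_pos hu).ne'
  rw [S.meanCurv_eq hu, hopfP]; field_simp; ring

theorem traceless_eq :
    traceless X n u = !![hopfP X n u, hopfQ X n u; hopfQ X n u, -hopfP X n u] := by
  have h := S.firstForm_eq hu
  have hs : ∀ i j, secondForm X n u i j = sff X n i j u := fun i j => rfl
  have hm : meanOf (firstForm X) (secondForm X n) u = meanCurv X n u := rfl
  ext i j
  fin_cases i <;> fin_cases j <;>
    simp [traceless, tracelessOf, h, hm, hs, S.sff_00 hu, S.sff_11 hu, S.sff_10 hu, sff_01]
    <;> ring

omit hu in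
theorem smooth_mean : ContDiffOn ℝ ∞ (meanCurv X n) U :=
  (((S.smooth_sff 0 0).add (S.smooth_sff 1 1)).div (contDiffOn_const.mul S.smooth_conf)
    (fun _ hw => mul_ne_zero two_ne_zero (S.conf_pos hw).ne')).congr fun _ hw => S.meanCurv_eq hw

theorem willmoreCurv_eq : willmoreCurv X n u =
    (pd 0 (pd 0 (meanCurv X n)) u + pd 1 (pd 1 (meanCurv X n)) u) / conf X u
      + 2 * (hopfP X n u ^ 2 + hopfQ X n u ^ 2) / conf X u ^ 2 * meanCurv X n u := by
  rw [willmoreCurv, laplace_conformal S.isOpen (fun _ hw => S.conf_pos hw)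
    (fun _ hw => S.firstForm_eq hw) _ hu,
    pairing_conformal (S.conf_pos hu).ne' (S.firstForm_eq hu), S.traceless_eq hu]
  simp
  left; ring

omit hu in
theorem smooth_willmoreCurv : ContDiffOn ℝ ∞ (willmoreCurv X n) U := by
  have hH := fun i => smooth_pd S.isOpen (smooth_pd S.isOpen S.smooth_mean i) i
  have hc : ∀ w ∈ U, conf X w ≠ 0 := fun w hw => (S.conf_pos hw).ne'
  exact ((((hH 0).add (hH 1)).div S.smooth_conf hc).add
    (((contDiffOn_const.mul ((S.smooth_hopfP.pow 2).add (S.smooth_hopfQ.pow 2))).div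
      (S.smooth_conf.pow 2) fun w hw => pow_ne_zero 2 (hc w hw)).mul S.smooth_mean)).congr
    fun w hw => S.willmoreCurv_eq hw

/-- Parseval's identity for the adapted frame. -/
theorem parseval (v w : E4) : (inner ℝ v w : ℝ) = inner ℝ (X u) v * inner ℝ (X u) w
    + inner ℝ (n u) v * inner ℝ (n u) w
    + (inner ℝ (pd 0 X u) v * inner ℝ (pd 0 X u) w
      + inner ℝ (pd 1 X u) v * inner ℝ (pd 1 X u) w) / conf X u := by
  have hc := S.conf_pos hu
  have hs : (√(conf X u))⁻¹ * (√(conf X u))⁻¹ = (conf X u)⁻¹ := by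
    rw [← mul_inv, Real.mul_self_sqrt hc.le]
  -- Position, normal and the two rescaled coordinate fields: four orthonormal vectors in ℝ⁴, hence
  -- a basis.
  let b : Fin 4 → E4 := ![X u, n u, (√(conf X u))⁻¹ • pd 0 X u, (√(conf X u))⁻¹ • pd 1 X u]
  have hb : Orthonormal ℝ b := by
    rw [orthonormal_iff_ite]
    have e1 := S.inner_XX hu
    have e2 := S.inner_nn hu
    have e3 := S.inner_nX hu
    have e4 := S.inner_n_pdX hu
    have e5 := S.inner_X_pdX hu
    have e6 := S.inner_pdX hu
    have e3' : inner ℝ (X u) (n u) = 0 := by rw [real_inner_comm, e3]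
    have e4' : ∀ i, inner ℝ (pd i X u) (n u) = 0 := fun i => by rw [real_inner_comm, e4]
    have e5' : ∀ i, inner ℝ (pd i X u) (X u) = 0 := fun i => by rw [real_inner_comm, e5]
    have hs' : (√(conf X u))⁻¹ * ((√(conf X u))⁻¹ * conf X u) = 1 := by
      rw [← mul_assoc, hs, inv_mul_cancel₀ hc.ne']
    intro i j
    fin_cases i <;> fin_cases j <;>
      simp only [b, Fin.zero_eta, Fin.mk_one, Fin.reduceFinMk, Matrix.cons_val, inner_smul_left,
        inner_smul_right, e1, e2, e3, e4, e5, e6, e3', e4', e5', hs', mul_zero, if_true,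
        RCLike.conj_to_real, Fin.reduceEq, if_false, zero_ne_one, one_ne_zero]
  have hsp : ⊤ ≤ Submodule.span ℝ (Set.range b) := by
    rw [hb.linearIndependent.span_eq_top_of_card_eq_finrank (by simp)]
  let B := OrthonormalBasis.mk hb hsp
  have h := B.sum_inner_mul_inner v w
  rw [← h, Fin.sum_univ_four]
  simp only [B, OrthonormalBasis.coe_mk]
  simp only [b, Matrix.cons_val, inner_smul_left, inner_smul_right, RCLike.conj_to_real,
    real_inner_comm (X u) v, real_inner_comm (n u) v, real_inner_comm (pd 0 X u) v,
    real_inner_comm (pd 1 X u) v]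
  rw [div_eq_mul_inv, ← hs]
  ring

theorem ext_inner {v w : E4} (h1 : (inner ℝ (X u) v : ℝ) = inner ℝ (X u) w)
    (h2 : (inner ℝ (n u) v : ℝ) = inner ℝ (n u) w)
    (h3 : ∀ i, (inner ℝ (pd i X u) v : ℝ) = inner ℝ (pd i X u) w) : v = w := by
  refine ext_inner_right ℝ fun z => ?_
  rw [S.parseval hu v, S.parseval hu w, h1, h2, h3, h3]

theorem weingarten (i : Fin 2) :
    pd i n u = -(1 / conf X u) • (sff X n 0 i u • pd 0 X u + sff X n 1 i u • pd 1 X u) := by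
  have hc := (S.conf_pos hu).ne'
  refine S.ext_inner hu ?_ ?_ fun k => ?_
  · simp [inner_smul_right, inner_add_right, S.inner_X_pdN hu, S.inner_X_pdX hu]
  · simp [inner_smul_right, inner_add_right, S.inner_n_pdN hu, S.inner_n_pdX hu]
  · fin_cases k <;>
      simp [inner_smul_right, inner_add_right, S.inner_pdX hu, inner_pdX_pdN,
        -inner_self_eq_norm_sq_to_K] <;> field_simp

omit hu in
theorem inner_pdN_pdN (hu : u ∈ U) (i j : Fin 2) : (inner ℝ (pd i n u) (pd j n u) : ℝ) =
    (sff X n 0 i u * sff X n 0 j u + sff X n 1 i u * sff X n 1 j u) / conf X u := by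
  rw [S.parseval hu]
  simp [S.inner_X_pdN hu, S.inner_n_pdN hu, inner_pdX_pdN]

/-- Derivatives of the metric coefficients. -/
theorem pd_metric (i j k : Fin 2) : (inner ℝ (pd i X u) (pd k (pd j X) u) : ℝ)
    + inner ℝ (pd j X u) (pd k (pd i X) u) = if i = j then pd k (conf X) u else 0 := by
  have := inner_pd_of_eq S.isOpen (S.smooth_pdX i) (S.smooth_pdX j)
    (φ := fun w => if i = j then conf X w else 0) (fun w hw => S.inner_pdX hw i j) k hu
  rw [real_inner_comm, add_comm] at this
  rw [this]
  split_ifs <;> simp [pd]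

/-- The Christoffel symbols of the first kind of the isothermal metric. -/
theorem inner_pdX_pdpdX (k i j : Fin 2) : (inner ℝ (pd k X u) (pd i (pd j X) u) : ℝ) =
    ((if j = k then pd i (conf X) u else 0) + (if i = k then pd j (conf X) u else 0)
      - (if i = j then pd k (conf X) u else 0)) / 2 := by
  have h1 := S.pd_metric hu j k i
  have h2 := S.pd_metric hu i k j
  have h3 := S.pd_metric hu i j k
  rw [pd_comm S.isOpen S.smoothX j i hu] at h2
  rw [pd_comm S.isOpen S.smoothX k i hu, pd_comm S.isOpen S.smoothX k j hu] at h3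
  linarith

theorem inner_X_pdpdX (i j : Fin 2) : (inner ℝ (X u) (pd i (pd j X) u) : ℝ) =
    -if i = j then conf X u else 0 := by
  have := inner_pd_of_eq S.isOpen S.smoothX (S.smooth_pdX j) (φ := fun _ => 0)
    (fun w hw => S.inner_X_pdX hw j) i hu
  rw [pd_const, S.inner_pdX hu] at this
  linarith

theorem pd_sff (k i j : Fin 2) : pd k (sff X n i j) u =
    inner ℝ (n u) (pd k (pd j (pd i X)) u) + inner ℝ (pd k n u) (pd j (pd i X) u) := by
  have := inner_pd_of_eq S.isOpen S.smoothN (S.smooth_pdpdX j i) (φ := sff X n i j)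
    (fun w hw => S.inner_pdpdX_n hw j i) k hu
  linarith

/-- By `pd_sff` the third derivatives of X cancel in the difference. What remains pairs the
derivatives of n with second derivatives of X, and Parseval reduces these to the second fundamental
form and to Christoffel symbols. `i.rev` is the other index. -/
theorem codazzi_aux (i : Fin 2) : pd 1 (sff X n i 0) u - pd 0 (sff X n i 1) u =
    pd i.rev (conf X) u * meanCurv X n u * (if i = 0 then 1 else -1) := by
  have hc := (S.conf_pos hu).ne'
  rw [S.pd_sff hu, S.pd_sff hu, pd_comm S.isOpen (S.smooth_pdX i) 1 0 hu,
    S.parseval hu (pd 1 n u), S.parseval hu (pd 0 n u)]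
  fin_cases i <;>
    simp [S.inner_X_pdN hu, S.inner_n_pdN hu, inner_pdX_pdN, S.inner_pdX_pdpdX hu,
      S.sff_00 hu, S.sff_11 hu, S.sff_10 hu, sff_01] <;> field_simp <;> ring

theorem pd_sff_00 (k : Fin 2) : pd k (sff X n 0 0) u = pd k (conf X) u * meanCurv X n u
    + conf X u * pd k (meanCurv X n) u + pd k (hopfP X n) u := by
  have h1 := diffAt S.isOpen S.smooth_conf hu
  have h2 := diffAt S.isOpen S.smooth_mean hu
  have h3 := diffAt S.isOpen S.smooth_hopfP hu
  rw [pd_congr_on S.isOpen (fun w hw => S.sff_00 hw) k hu, pd_add k (h1.fun_mul h2) h3,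
    pd_mul k h1 h2]

theorem pd_sff_11 (k : Fin 2) : pd k (sff X n 1 1) u = pd k (conf X) u * meanCurv X n u
    + conf X u * pd k (meanCurv X n) u - pd k (hopfP X n) u := by
  have h1 := diffAt S.isOpen S.smooth_conf hu
  have h2 := diffAt S.isOpen S.smooth_mean hu
  have h3 := diffAt S.isOpen S.smooth_hopfP hu
  rw [pd_congr_on S.isOpen (fun w hw => S.sff_11 hw) k hu, pd_sub k (h1.fun_mul h2) h3,
    pd_mul k h1 h2]

/-- The Codazzi equations. -/
theorem codazzi0 : pd 0 (hopfP X n) u + pd 1 (hopfQ X n) u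
    = conf X u * pd 0 (meanCurv X n) u := by
  have h := S.codazzi_aux hu 1
  rw [pd_congr_on S.isOpen (fun w hw => S.sff_10 hw) 1 hu, S.pd_sff_11 hu] at h
  simp at h
  linarith

theorem codazzi1 : pd 0 (hopfQ X n) u - pd 1 (hopfP X n) u
    = conf X u * pd 1 (meanCurv X n) u := by
  have h := S.codazzi_aux hu 0
  rw [pd_congr_on S.isOpen (fun w _ => sff_01 (u := w)) 0 hu, S.pd_sff_00 hu] at h
  simp at h
  linarith

end IsothermalSurface

/-! ### Metrics in coordinates -/

section Metric

variable {k : ℕ}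

theorem smooth_det {W : Set (Fin k → ℝ)} {m : ℕ} {A : (Fin k → ℝ) → Matrix (Fin m) (Fin m) ℝ}
    (hA : ∀ i j, ContDiffOn ℝ ∞ (fun w => A w i j) W) :
    ContDiffOn ℝ ∞ (fun w => (A w).det) W := by
  simp only [Matrix.det_apply]
  exact ContDiffOn.sum fun σ _ => (contDiffOn_prod fun i _ => hA _ _).const_smul _

/-- Cramer's rule: the entries of the adjugate are determinants of the matrix with one row replaced
by a basis vector. -/
theorem smooth_inv {W : Set (Fin k → ℝ)} {m : ℕ} {A : (Fin k → ℝ) → Matrix (Fin m) (Fin m) ℝ}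
    (hA : ∀ i j, ContDiffOn ℝ ∞ (fun w => A w i j) W) (hd : ∀ w ∈ W, (A w).det ≠ 0)
    (i j : Fin m) : ContDiffOn ℝ ∞ (fun w => (A w)⁻¹ i j) W := by
  simp only [Matrix.inv_def, Matrix.smul_apply, Ring.inverse_eq_inv', Matrix.adjugate_apply]
  refine ((smooth_det hA).inv hd).smul (smooth_det fun a b => ?_)
  by_cases h : a = j
  · subst h; simp [contDiffOn_const]
  · simpa [h] using hA a b

/-- The derivative of the inverse matrix. -/
theorem pd_inv_matrix {g : TensorField k} {W : Set (Fin k → ℝ)} (hW : IsOpen W)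
    (hg : ∀ i j, ContDiffOn ℝ ∞ (fun w => g w i j) W) (hd : ∀ w ∈ W, (g w).det ≠ 0)
    {v : Fin k → ℝ} (hv : v ∈ W) (c a b : Fin k) :
    pd c (fun w => (g w)⁻¹ a b) v
      = -∑ d, ∑ e, (g v)⁻¹ a d * pd c (fun w => g w d e) v * (g v)⁻¹ e b := by
  let Di : Matrix (Fin k) (Fin k) ℝ := Matrix.of fun a b => pd c (fun w => (g w)⁻¹ a b) v
  let Dg : Matrix (Fin k) (Fin k) ℝ := Matrix.of fun a b => pd c (fun w => g w a b) v
  have h1 : Di * g v + (g v)⁻¹ * Dg = 0 := by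
    ext i j
    have h2 : ∀ w ∈ W, (∑ l, (g w)⁻¹ i l * g w l j) = (1 : Matrix (Fin k) (Fin k) ℝ) i j :=
      fun w hw => by
        rw [← Matrix.nonsing_inv_mul (g w) (isUnit_iff_ne_zero.2 (hd w hw)), Matrix.mul_apply]
    have h3 := pd_congr_on hW h2 c hv
    have d1 := fun i j => diffAt hW (smooth_inv hg hd i j) hv
    have d2 := fun i j => diffAt hW (hg i j) hv
    rw [pd_sum _ c (fun l _ => (d1 i l).fun_mul (d2 l j)), pd_const] at h3
    simp only [pd_mul c (d1 i _) (d2 _ j), Finset.sum_add_distrib] at h3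
    simpa [Matrix.mul_apply, Di, Dg] using h3
  have h4 : Di = -((g v)⁻¹ * Dg * (g v)⁻¹) := by
    have h5 := congrArg (· * (g v)⁻¹) h1
    simp only [Matrix.add_mul, Matrix.zero_mul] at h5
    rw [Matrix.mul_assoc Di, Matrix.mul_nonsing_inv _ (isUnit_iff_ne_zero.2 (hd v hv)),
      Matrix.mul_one] at h5
    exact eq_neg_of_add_eq_zero_left h5
  have h6 := congrFun (congrFun h4 a) b
  simp only [Di, Matrix.of_apply, Matrix.neg_apply] at h6
  rw [h6, Matrix.mul_apply]
  simp only [Matrix.mul_apply, Finset.sum_mul, Dg, Matrix.of_apply]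
  rw [Finset.sum_comm]

/-- The Christoffel symbols of the first kind. -/
def lowerChristoffel (g : TensorField k) (d a b : Fin k) (v : Fin k → ℝ) : ℝ :=
  (1 / 2) * (pd a (fun w => g w b d) v + pd b (fun w => g w a d) v - pd d (fun w => g w a b) v)

theorem christoffel_eq (g : TensorField k) (c a b : Fin k) (v : Fin k → ℝ) :
    christoffel g c a b v = ∑ d, (g v)⁻¹ c d * lowerChristoffel g d a b v := by
  simp only [christoffel, lowerChristoffel, Finset.mul_sum]
  exact Finset.sum_congr rfl fun _ _ => by ring

theorem sum_mul_christoffel {g : TensorField k} {v : Fin k → ℝ} (hd : (g v).det ≠ 0)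
    (d a b : Fin k) : ∑ e, g v d e * christoffel g e a b v = lowerChristoffel g d a b v := by
  simp only [christoffel_eq, Finset.mul_sum]
  rw [Finset.sum_comm]
  simp only [← mul_assoc, ← Finset.sum_mul]
  simp only [← Matrix.mul_apply, Matrix.mul_nonsing_inv _ (isUnit_iff_ne_zero.2 hd)]
  simp [Matrix.one_apply]

variable {g : TensorField k} {W : Set (Fin k → ℝ)} (hW : IsOpen W)
  (hg : ∀ i j, ContDiffOn ℝ ∞ (fun w => g w i j) W) (hd : ∀ w ∈ W, (g w).det ≠ 0)
  (hs : ∀ w i j, g w i j = g w j i) {v : Fin k → ℝ} (hv : v ∈ W)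

include hW hg in
theorem smooth_lowerChristoffel (d a b : Fin k) :
    ContDiffOn ℝ ∞ (lowerChristoffel g d a b) W :=
  contDiffOn_const.mul (((smooth_pd hW (hg b d) a).add (smooth_pd hW (hg a d) b)).sub
    (smooth_pd hW (hg a b) d))

include hW hg hd in
theorem smooth_christoffel (c a b : Fin k) : ContDiffOn ℝ ∞ (christoffel g c a b) W := by
  simp only [funext fun w => christoffel_eq g c a b w]
  exact ContDiffOn.sum fun d _ => (smooth_inv hg hd c d).mul (smooth_lowerChristoffel hW hg d a b)

include hs in
-- This is compatibility of the connection with the metric.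
theorem pd_eq_lowerChristoffel (b d e : Fin k) : pd b (fun w => g w d e) v
    = lowerChristoffel g d b e v + lowerChristoffel g e b d v := by
  simp only [lowerChristoffel, fun w => hs w e d, fun w => hs w b d, fun w => hs w b e]
  have h1 : pd d (fun w => g w e b) v = pd d (fun w => g w b e) v := by simp only [fun w => hs w e b]
  have h2 : pd e (fun w => g w d b) v = pd e (fun w => g w b d) v := by simp only [fun w => hs w d b]
  simp only [fun w => hs w b d, fun w => hs w b e] at h1 h2
  linarith

include hW hg hd hs hv in
-- Differentiating the identity that lowers the index of Γ gives its lowered derivative by the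
-- product rule, without differentiating the inverse metric.
theorem sum_mul_pd_christoffel (d a b c : Fin k) :
    ∑ e, g v d e * pd b (christoffel g e a c) v = pd b (lowerChristoffel g d a c) v
      - ∑ e, (lowerChristoffel g d b e v + lowerChristoffel g e b d v) * christoffel g e a c v := by
  have h := pd_congr_on hW (fun w hw => sum_mul_christoffel (hd w hw) d a c) b hv
  have d1 := fun i j => diffAt hW (hg i j) hv
  have d2 := fun e => diffAt hW (smooth_christoffel hW hg hd e a c) hv
  rw [pd_sum _ b (fun e _ => (d1 d e).fun_mul (d2 e))] at h
  simp only [pd_mul b (d1 d _) (d2 _), Finset.sum_add_distrib] at h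
  simp only [← pd_eq_lowerChristoffel hs]
  change _ = pd b (lowerChristoffel g d a c) v at h
  rw [← h]; ring

include hW hg hd hs hv in
/-- The Riemann tensor in terms of the Christoffel symbols of the first kind. -/
theorem riemann_eq (a b c d : Fin k) : riemann g a b c d v =
    pd b (lowerChristoffel g d a c) v - pd a (lowerChristoffel g d b c) v
      - ∑ e, lowerChristoffel g e b d v * christoffel g e a c v
      + ∑ e, lowerChristoffel g e a d v * christoffel g e b c v := by
  have h1 := sum_mul_pd_christoffel hW hg hd hs hv d a b c
  have h2 := sum_mul_pd_christoffel hW hg hd hs hv d b a c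
  have h3 : ∀ a b c, ∑ e, g v d e * ∑ f, christoffel g e b f v * christoffel g f a c v
      = ∑ f, lowerChristoffel g d b f v * christoffel g f a c v := by
    intro a b c
    simp only [← sum_mul_christoffel (hd v hv) d b, Finset.mul_sum, Finset.sum_mul]
    rw [Finset.sum_comm]
    simp only [mul_assoc]
  have h4 := h3 a b c
  have h5 := h3 b a c
  simp only [riemann, mul_add, mul_sub, Finset.sum_add_distrib, Finset.sum_sub_distrib, add_mul]
    at h1 h2 ⊢
  change (∑ e, g v d e * pd b (christoffel g e a c) v
    - ∑ e, g v d e * pd a (christoffel g e b c) v) + _ = _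
  rw [h1, h2, h4, h5]
  ring

include hW hg hv in
theorem pd_lowerChristoffel (d a b c : Fin k) : pd c (lowerChristoffel g d a b) v =
    (1 / 2) * (pd c (pd a (fun w => g w b d)) v + pd c (pd b (fun w => g w a d)) v
      - pd c (pd d (fun w => g w a b)) v) := by
  have h1 := diffAt hW (smooth_pd hW (hg b d) a) hv
  have h2 := diffAt hW (smooth_pd hW (hg a d) b) hv
  have h3 := diffAt hW (smooth_pd hW (hg a b) d) hv
  change pd c (fun w => (1 / 2) * (pd a (fun w => g w b d) w + pd b (fun w => g w a d) w
    - pd d (fun w => g w a b) w)) v = _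
  rw [pd_mul c (by fun_prop) (by fun_prop), pd_sub c (by fun_prop) h3, pd_add c h1 h2, pd_const]
  ring

end Metric

theorem hasFDerivAt_coord {k : ℕ} (j : Fin k) (v : Fin k → ℝ) : HasFDerivAt (fun w => w j)
    (ContinuousLinearMap.proj (R := ℝ) (φ := fun _ : Fin k => ℝ) j) v :=
  (ContinuousLinearMap.proj (R := ℝ) (φ := fun _ : Fin k => ℝ) j).hasFDerivAt

/-! ### Coordinates adapted to the surface -/

section Adapted

/-- The surface parameter of a point in adapted coordinates. -/
def base (v : Fin 3 → ℝ) : Fin 2 → ℝ := ![v 0, v 1]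

theorem base_onSurface (u : Fin 2 → ℝ) : base (onSurface u) = u := by
  ext i; fin_cases i <;> simp [base, onSurface]

theorem onSurface_two (u : Fin 2 → ℝ) : onSurface u 2 = 0 := by simp [onSurface]

theorem contDiff_base : ContDiff ℝ ∞ base := by
  rw [contDiff_pi]
  intro i
  fin_cases i <;> simp [base] <;> fun_prop

theorem hasFDerivAt_base (v : Fin 3 → ℝ) : HasFDerivAt base
    (ContinuousLinearMap.pi ![ContinuousLinearMap.proj 0, ContinuousLinearMap.proj 1] :
      (Fin 3 → ℝ) →L[ℝ] (Fin 2 → ℝ)) v := by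
  rw [hasFDerivAt_pi']
  intro i
  fin_cases i
  · exact hasFDerivAt_coord 0 v
  · exact hasFDerivAt_coord 1 v

variable {V : Type*} [NormedAddCommGroup V] [NormedSpace ℝ V]

theorem pd_base_castSucc {φ : (Fin 2 → ℝ) → V} {v : Fin 3 → ℝ}
    (h : DifferentiableAt ℝ φ (base v)) (i : Fin 2) :
    pd i.castSucc (fun w => φ (base w)) v = pd i φ (base v) := by
  have := (h.hasFDerivAt.comp v (hasFDerivAt_base v)).fderiv
  simp only [pd]
  rw [show (fun w => φ (base w)) = φ ∘ base from rfl, this, ContinuousLinearMap.comp_apply]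
  congr 1
  ext j
  fin_cases i <;> fin_cases j <;> simp

theorem pd_base_two {φ : (Fin 2 → ℝ) → V} {v : Fin 3 → ℝ}
    (h : DifferentiableAt ℝ φ (base v)) : pd 2 (fun w => φ (base w)) v = 0 := by
  have := (h.hasFDerivAt.comp v (hasFDerivAt_base v)).fderiv
  simp only [pd]
  rw [show (fun w => φ (base w)) = φ ∘ base from rfl, this, ContinuousLinearMap.comp_apply]
  convert! map_zero (fderiv ℝ φ (base v)) using 2
  ext j
  fin_cases j <;> simp

theorem contDiff_onSurface : ContDiff ℝ ∞ onSurface := by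
  rw [contDiff_pi]
  intro i
  fin_cases i <;> simp [onSurface] <;> fun_prop

theorem pd_onSurface {F : (Fin 3 → ℝ) → V} {u : Fin 2 → ℝ}
    (h : DifferentiableAt ℝ F (onSurface u)) (i : Fin 2) :
    pd i (fun w => F (onSurface w)) u = pd i.castSucc F (onSurface u) := by
  have h0 : HasFDerivAt onSurface
    (ContinuousLinearMap.pi ![ContinuousLinearMap.proj 0, ContinuousLinearMap.proj 1, 0] :
      (Fin 2 → ℝ) →L[ℝ] (Fin 3 → ℝ)) u := by
    rw [hasFDerivAt_pi']
    intro i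
    fin_cases i
    · exact hasFDerivAt_coord 0 u
    · exact hasFDerivAt_coord 1 u
    · exact hasFDerivAt_const _ _
  have := (h.hasFDerivAt.comp u h0).fderiv
  simp only [pd]
  rw [show (fun w => F (onSurface w)) = F ∘ onSurface from rfl, this,
    ContinuousLinearMap.comp_apply]
  congr 1
  ext j
  fin_cases i <;> fin_cases j <;> simp

theorem pd_cos (i : Fin 3) (v : Fin 3 → ℝ) :
    pd i (fun w => Real.cos (w 2)) v = if i = 2 then -Real.sin (v 2) else 0 := by
  have h : HasFDerivAt (fun w : Fin 3 → ℝ => w 2) (ContinuousLinearMap.proj (R := ℝ)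
    (φ := fun _ : Fin 3 => ℝ) 2) v := hasFDerivAt_coord 2 v
  have := h.cos.fderiv
  simp only [pd, this]
  fin_cases i <;> simp

theorem pd_sin (i : Fin 3) (v : Fin 3 → ℝ) :
    pd i (fun w => Real.sin (w 2)) v = if i = 2 then Real.cos (v 2) else 0 := by
  have h : HasFDerivAt (fun w : Fin 3 → ℝ => w 2) (ContinuousLinearMap.proj (R := ℝ)
    (φ := fun _ : Fin 3 => ℝ) 2) v := hasFDerivAt_coord 2 v
  have := h.sin.fderiv
  simp only [pd, this]
  fin_cases i <;> simp

/-- A coefficient of the metric of the parallel surfaces. -/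
def cyl (a b c : (Fin 2 → ℝ) → ℝ) (v : Fin 3 → ℝ) : ℝ :=
  Real.cos (v 2) ^ 2 * a (base v) - 2 * (Real.cos (v 2) * Real.sin (v 2)) * b (base v)
    + Real.sin (v 2) ^ 2 * c (base v)

variable {U : Set (Fin 2 → ℝ)}

theorem isOpen_base (hU : IsOpen U) : IsOpen (base ⁻¹' U) :=
  hU.preimage contDiff_base.continuous

theorem smooth_base {φ : (Fin 2 → ℝ) → V} (h : ContDiffOn ℝ ∞ φ U) :
    ContDiffOn ℝ ∞ (fun v => φ (base v)) (base ⁻¹' U) :=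
  h.comp contDiff_base.contDiffOn fun _ hv => hv

variable {a b c : (Fin 2 → ℝ) → ℝ}

theorem smooth_cyl (ha : ContDiffOn ℝ ∞ a U) (hb : ContDiffOn ℝ ∞ b U)
    (hc : ContDiffOn ℝ ∞ c U) : ContDiffOn ℝ ∞ (cyl a b c) (base ⁻¹' U) := by
  have h1 : ContDiffOn ℝ ∞ (fun v : Fin 3 → ℝ => Real.cos (v 2)) (base ⁻¹' U) :=
    ContDiff.contDiffOn (by fun_prop)
  have h2 : ContDiffOn ℝ ∞ (fun v : Fin 3 → ℝ => Real.sin (v 2)) (base ⁻¹' U) :=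
    ContDiff.contDiffOn (by fun_prop)
  exact (((h1.pow 2).mul (smooth_base ha)).sub ((contDiffOn_const.mul (h1.mul h2)).mul
    (smooth_base hb))).add ((h2.pow 2).mul (smooth_base hc))

theorem pd_cyl_castSucc (hU : IsOpen U) (ha : ContDiffOn ℝ ∞ a U) (hb : ContDiffOn ℝ ∞ b U)
    (hc : ContDiffOn ℝ ∞ c U) (i : Fin 2) {v : Fin 3 → ℝ} (hv : base v ∈ U) :
    pd i.castSucc (cyl a b c) v = cyl (pd i a) (pd i b) (pd i c) v := by
  have ha' := diffAt hU ha hv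
  have hb' := diffAt hU hb hv
  have hc' := diffAt hU hc hv
  have dv : DifferentiableAt ℝ base v := (hasFDerivAt_base v).differentiableAt
  have da : DifferentiableAt ℝ (fun w => a (base w)) v := ha'.fun_comp' v dv
  have db : DifferentiableAt ℝ (fun w => b (base w)) v := hb'.fun_comp' v dv
  have dc : DifferentiableAt ℝ (fun w => c (base w)) v := hc'.fun_comp' v dv
  have hi : i.castSucc ≠ 2 := (Fin.castSucc_lt_last i).ne
  unfold cyl
  simp (disch := fun_prop) only [pd_add, pd_sub, pd_mul, pd_pow, pd_const, pd_cos, pd_sin,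
    if_neg hi, pd_base_castSucc ha', pd_base_castSucc hb', pd_base_castSucc hc']
  ring

/-- The functions cos², −2 sin cos and sin² span a space closed under d/ds, so the family `cyl` is
closed under all partial derivatives. Since `cyl` at s = 0 is its first coefficient, every jet on
the surface is found by iterating this rule and its tangential analogue. -/
theorem pd_cyl_two (hU : IsOpen U) (ha : ContDiffOn ℝ ∞ a U) (hb : ContDiffOn ℝ ∞ b U)
    (hc : ContDiffOn ℝ ∞ c U) {v : Fin 3 → ℝ} (hv : base v ∈ U) :
    pd 2 (cyl a b c) v = cyl (fun u => -2 * b u) (fun u => a u - c u) (fun u => 2 * b u) v := by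
  have ha' := diffAt hU ha hv
  have hb' := diffAt hU hb hv
  have hc' := diffAt hU hc hv
  have dv : DifferentiableAt ℝ base v := (hasFDerivAt_base v).differentiableAt
  have da : DifferentiableAt ℝ (fun w => a (base w)) v := ha'.fun_comp' v dv
  have db : DifferentiableAt ℝ (fun w => b (base w)) v := hb'.fun_comp' v dv
  have dc : DifferentiableAt ℝ (fun w => c (base w)) v := hc'.fun_comp' v dv
  unfold cyl
  simp (disch := fun_prop) only [pd_add, pd_sub, pd_mul, pd_pow, pd_const, pd_cos, pd_sin,
    if_true, pd_base_two ha', pd_base_two hb', pd_base_two hc']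
  ring

theorem cyl_onSurface (u : Fin 2 → ℝ) : cyl a b c (onSurface u) = a u := by
  simp [cyl, onSurface_two, base_onSurface]

end Adapted

/-! ### Jets of the factors of the ambient metric. -/

section Jets

variable {k : ℕ} {W : Set (Fin k → ℝ)} {v : Fin k → ℝ} {f m : (Fin k → ℝ) → ℝ}

/-- Used with f = λ in adapted coordinates and m a coefficient of the round metric. -/
theorem pd_sq_mul (hW : IsOpen W) (hf : ContDiffOn ℝ ∞ f W) (hm : ContDiffOn ℝ ∞ m W)
    (hv : v ∈ W) (c : Fin k) : pd c (fun w => f w ^ 2 * m w) v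
      = 2 * f v * pd c f v * m v + f v ^ 2 * pd c m v := by
  have h1 := diffAt hW hf hv
  have h2 := diffAt hW hm hv
  simp (disch := fun_prop) only [pd_mul, pd_pow]
  norm_num

theorem pd_pd_sq_mul (hW : IsOpen W) (hf : ContDiffOn ℝ ∞ f W) (hm : ContDiffOn ℝ ∞ m W)
    (hv : v ∈ W) (c d : Fin k) : pd d (pd c (fun w => f w ^ 2 * m w)) v
      = 2 * pd d f v * pd c f v * m v + 2 * f v * pd d (pd c f) v * m v
        + 2 * f v * pd c f v * pd d m v + 2 * f v * pd d f v * pd c m v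
        + f v ^ 2 * pd d (pd c m) v := by
  rw [pd_congr_on hW (fun w hw => pd_sq_mul hW hf hm hw c) d hv]
  have h1 := diffAt hW hf hv
  have h2 := diffAt hW hm hv
  have h3 := diffAt hW (smooth_pd hW hf c) hv
  have h4 := diffAt hW (smooth_pd hW hm c) hv
  simp (disch := fun_prop) only [pd_mul, pd_pow, pd_add, pd_const]
  norm_num
  ring

end Jets

section CylJets

variable {U : Set (Fin 2 → ℝ)} {a b c : (Fin 2 → ℝ) → ℝ} (hU : IsOpen U)
  (ha : ContDiffOn ℝ ∞ a U) (hb : ContDiffOn ℝ ∞ b U) (hc : ContDiffOn ℝ ∞ c U)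
  {u : Fin 2 → ℝ} (hu : u ∈ U)
include hU ha hb hc hu

omit hU ha hb hc in
theorem base_onSurface_mem : onSurface u ∈ base ⁻¹' U := by
  simpa [Set.mem_preimage, base_onSurface] using hu

theorem jet_cyl (i : Fin 2) : pd i.castSucc (cyl a b c) (onSurface u) = pd i a u := by
  rw [pd_cyl_castSucc hU ha hb hc i (base_onSurface_mem hu), cyl_onSurface]

theorem jet_cyl_two : pd 2 (cyl a b c) (onSurface u) = -2 * b u := by
  rw [pd_cyl_two hU ha hb hc (base_onSurface_mem hu), cyl_onSurface]

theorem jet_cyl_cast_cast (i j : Fin 2) :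
    pd i.castSucc (pd j.castSucc (cyl a b c)) (onSurface u) = pd i (pd j a) u := by
  rw [pd_congr_on (isOpen_base hU) (fun w hw => pd_cyl_castSucc hU ha hb hc j hw) _
    (base_onSurface_mem hu),
    jet_cyl hU (smooth_pd hU ha j) (smooth_pd hU hb j) (smooth_pd hU hc j) hu]

theorem jet_cyl_two_cast (i : Fin 2) :
    pd 2 (pd i.castSucc (cyl a b c)) (onSurface u) = -2 * pd i b u := by
  rw [pd_congr_on (isOpen_base hU) (fun w hw => pd_cyl_castSucc hU ha hb hc i hw) _
    (base_onSurface_mem hu),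
    jet_cyl_two hU (smooth_pd hU ha i) (smooth_pd hU hb i) (smooth_pd hU hc i) hu]

theorem jet_cyl_two_two :
    pd 2 (pd 2 (cyl a b c)) (onSurface u) = -2 * (a u - c u) := by
  rw [pd_congr_on (isOpen_base hU) (fun w hw => pd_cyl_two hU ha hb hc hw) _
    (base_onSurface_mem hu),
    jet_cyl_two hU (contDiffOn_const.mul hb) (ha.sub hc) (contDiffOn_const.mul hb) hu]

end CylJets

/-! ### The metric λ²g₀ in adapted coordinates and its 2-jet on the surface. -/

/-- The products `⟨nᵢ, nⱼ⟩`. -/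
def thirdForm (n : (Fin 2 → ℝ) → E4) (i j : Fin 2) (u : Fin 2 → ℝ) : ℝ :=
  inner ℝ (pd i n u) (pd j n u)

/-- The coefficients of `cos²` in the metric of the parallel surfaces. -/
def coeffI (X : (Fin 2 → ℝ) → E4) : Fin 3 → Fin 3 → (Fin 2 → ℝ) → ℝ :=
  ![![conf X, fun _ => 0, fun _ => 0], ![fun _ => 0, conf X, fun _ => 0],
    ![fun _ => 0, fun _ => 0, fun _ => 1]]

/-- The coefficients of `-2 sin cos` in the metric of the parallel surfaces. -/
def coeffII (X n : (Fin 2 → ℝ) → E4) : Fin 3 → Fin 3 → (Fin 2 → ℝ) → ℝ :=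
  ![![sff X n 0 0, hopfQ X n, fun _ => 0], ![hopfQ X n, sff X n 1 1, fun _ => 0],
    ![fun _ => 0, fun _ => 0, fun _ => 0]]

/-- The coefficients of `sin²` in the metric of the parallel surfaces. -/
def coeffIII (n : (Fin 2 → ℝ) → E4) : Fin 3 → Fin 3 → (Fin 2 → ℝ) → ℝ :=
  ![![thirdForm n 0 0, thirdForm n 0 1, fun _ => 0],
    ![thirdForm n 0 1, thirdForm n 1 1, fun _ => 0],
    ![fun _ => 0, fun _ => 0, fun _ => 1]]

namespace IsothermalSurface

variable {X n : (Fin 2 → ℝ) → E4} {U : Set (Fin 2 → ℝ)} (S : IsothermalSurface X n U)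
  {u : Fin 2 → ℝ}

include S

theorem smooth_thirdForm (i j : Fin 2) : ContDiffOn ℝ ∞ (thirdForm n i j) U :=
  (S.smooth_pdN i).inner ℝ (S.smooth_pdN j)

theorem smooth_coeffI (a b : Fin 3) : ContDiffOn ℝ ∞ (coeffI X a b) U := by
  fin_cases a <;> fin_cases b <;> first | exact S.smooth_conf | exact contDiffOn_const

theorem smooth_coeffII (a b : Fin 3) : ContDiffOn ℝ ∞ (coeffII X n a b) U := by
  fin_cases a <;> fin_cases b <;> first | exact S.smooth_sff _ _ | exact contDiffOn_const

theorem smooth_coeffIII (a b : Fin 3) : ContDiffOn ℝ ∞ (coeffIII n a b) U := by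
  fin_cases a <;> fin_cases b <;> first | exact S.smooth_thirdForm _ _ | exact contDiffOn_const

theorem smooth_adapted : ContDiffOn ℝ ∞ (adapted X n) (base ⁻¹' U) := by
  have h1 : ContDiffOn ℝ ∞ (fun v : Fin 3 → ℝ => Real.cos (v 2)) (base ⁻¹' U) :=
    ContDiff.contDiffOn (by fun_prop)
  have h2 : ContDiffOn ℝ ∞ (fun v : Fin 3 → ℝ => Real.sin (v 2)) (base ⁻¹' U) :=
    ContDiff.contDiffOn (by fun_prop)
  exact (h1.smul (smooth_base S.smoothX)).add (h2.smul (smooth_base S.smoothN))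

theorem norm_adapted {v : Fin 3 → ℝ} (hv : base v ∈ U) : ‖adapted X n v‖ = 1 := by
  have h : ‖adapted X n v‖ ^ 2 = 1 := by
    rw [← real_inner_self_eq_norm_sq]
    change inner ℝ (Real.cos (v 2) • X (base v) + Real.sin (v 2) • n (base v))
      (Real.cos (v 2) • X (base v) + Real.sin (v 2) • n (base v)) = 1
    simp only [inner_add_left, inner_add_right, inner_smul_left, inner_smul_right, S.inner_XX hv,
      S.inner_nn hv, S.inner_nX hv, real_inner_comm (n (base v)) (X (base v)),
      RCLike.conj_to_real]
    nlinarith [Real.sin_sq_add_cos_sq (v 2)]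
  nlinarith [norm_nonneg (adapted X n v)]

theorem pd_adapted {v : Fin 3 → ℝ} (hv : base v ∈ U) (i : Fin 2) : pd i.castSucc (adapted X n) v =
    Real.cos (v 2) • pd i X (base v) + Real.sin (v 2) • pd i n (base v) := by
  have ha' := diffAt S.isOpen S.smoothX hv
  have hb' := diffAt S.isOpen S.smoothN hv
  have dv : DifferentiableAt ℝ base v := (hasFDerivAt_base v).differentiableAt
  have da : DifferentiableAt ℝ (fun w => X (base w)) v := ha'.fun_comp' v dv
  have db : DifferentiableAt ℝ (fun w => n (base w)) v := hb'.fun_comp' v dv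
  have hi : i.castSucc ≠ 2 := (Fin.castSucc_lt_last i).ne
  change pd i.castSucc (fun v => Real.cos (v 2) • X (base v) + Real.sin (v 2) • n (base v)) v = _
  simp (disch := fun_prop) only [pd_add, pd_smul, pd_cos, pd_sin,
    if_neg hi, pd_base_castSucc ha', pd_base_castSucc hb', zero_smul, zero_add]

theorem pd_adapted_two {v : Fin 3 → ℝ} (hv : base v ∈ U) : pd 2 (adapted X n) v =
    -Real.sin (v 2) • X (base v) + Real.cos (v 2) • n (base v) := by
  have ha' := diffAt S.isOpen S.smoothX hv
  have hb' := diffAt S.isOpen S.smoothN hv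
  have dv : DifferentiableAt ℝ base v := (hasFDerivAt_base v).differentiableAt
  have da : DifferentiableAt ℝ (fun w => X (base w)) v := ha'.fun_comp' v dv
  have db : DifferentiableAt ℝ (fun w => n (base w)) v := hb'.fun_comp' v dv
  change pd 2 (fun v => Real.cos (v 2) • X (base v) + Real.sin (v 2) • n (base v)) v = _
  simp (disch := fun_prop) only [pd_add, pd_smul, pd_cos, pd_sin,
    if_true, pd_base_two ha', pd_base_two hb', smul_zero, add_zero]

/-- The derivative of the adapted map in direction i is cos s · X_i + sin s · n_i, which is
orthogonal to the unit s-derivative; expanding the inner products gives the three fundamental forms.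
The entry with both indices normal is 1 = cos² s + sin² s. -/
theorem ambient_eq (lam : E4 → ℝ) {v : Fin 3 → ℝ} (hv : base v ∈ U) (a b : Fin 3) :
    ambient lam X n v a b =
      lam (adapted X n v) ^ 2 * cyl (coeffI X a b) (coeffII X n a b) (coeffIII n a b) v := by
  have h0 := S.pd_adapted hv 0
  have h1 := S.pd_adapted hv 1
  have h2 := S.pd_adapted_two hv
  simp only [Fin.castSucc_zero, Fin.castSucc_one] at h0 h1
  have sc := Real.sin_sq_add_cos_sq (v 2)
  have e3' : inner ℝ (X (base v)) (n (base v)) = 0 := by rw [real_inner_comm, S.inner_nX hv]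
  have e4' : ∀ i, inner ℝ (pd i X (base v)) (n (base v)) = 0 :=
    fun i => by rw [real_inner_comm, S.inner_n_pdX hv]
  have e5' : ∀ i, inner ℝ (pd i X (base v)) (X (base v)) = 0 :=
    fun i => by rw [real_inner_comm, S.inner_X_pdX hv]
  have e6' : ∀ i, inner ℝ (pd i n (base v)) (n (base v)) = 0 :=
    fun i => by rw [real_inner_comm, S.inner_n_pdN hv]
  have e7' : ∀ i, inner ℝ (pd i n (base v)) (X (base v)) = 0 :=
    fun i => by rw [real_inner_comm, S.inner_X_pdN hv]
  have e8' : ∀ i j, inner ℝ (pd i n (base v)) (pd j X (base v)) = -sff X n j i (base v) :=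
    fun i j => by rw [real_inner_comm, inner_pdX_pdN]
  have e9 : ∀ i j, inner ℝ (pd i n (base v)) (pd j n (base v)) = thirdForm n i j (base v) :=
    fun i j => rfl
  have e10 : thirdForm n 1 0 (base v) = thirdForm n 0 1 (base v) := real_inner_comm _ _
  simp only [ambient, Matrix.of_apply]
  congr 1
  fin_cases a <;> fin_cases b <;>
    simp [h0, h1, h2, inner_add_left, inner_add_right, inner_smul_left, inner_smul_right,
      S.inner_XX hv, S.inner_nn hv, S.inner_nX hv, S.inner_n_pdX hv, S.inner_X_pdX hv,
      S.inner_n_pdN hv, S.inner_X_pdN hv, S.inner_pdX hv, inner_pdX_pdN, e3', e4', e5', e6', e7',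
      e8', e9, e10, coeffI, coeffII, coeffIII, cyl, S.sff_10 hv, sff_01,
      -inner_self_eq_norm_sq_to_K] <;> linarith

end IsothermalSurface

/-- The normal derivative of the conformal factor along the surface. -/
def normalDeriv (lam : E4 → ℝ) (X n : (Fin 2 → ℝ) → E4) (u : Fin 2 → ℝ) : ℝ :=
  pd 2 (fun v => lam (adapted X n v)) (onSurface u)

theorem adapted_onSurface (X n : (Fin 2 → ℝ) → E4) (u : Fin 2 → ℝ) :
    adapted X n (onSurface u) = X u := by
  change Real.cos (onSurface u 2) • X (base (onSurface u))
    + Real.sin (onSurface u 2) • n (base (onSurface u)) = X u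
  simp [onSurface_two, base_onSurface]

theorem ambient_symm (lam : E4 → ℝ) (X n : (Fin 2 → ℝ) → E4) (v : Fin 3 → ℝ) (a b : Fin 3) :
    ambient lam X n v a b = ambient lam X n v b a := by
  simp only [ambient, Matrix.of_apply, real_inner_comm]

namespace IsothermalSurface

variable {X n : (Fin 2 → ℝ) → E4} {U : Set (Fin 2 → ℝ)} (S : IsothermalSurface X n U)
  {lam : E4 → ℝ} (hlam : IsConformalFactor lam)

include S hlam

theorem smooth_factor : ContDiffOn ℝ ∞ (fun v => lam (adapted X n v)) (base ⁻¹' U) :=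
  hlam.smooth_comp (isOpen_base S.isOpen) S.smooth_adapted fun _ hv => S.norm_adapted hv

theorem smooth_lam : ContDiffOn ℝ ∞ (fun u => lam (X u)) U :=
  hlam.smooth_comp S.isOpen S.smoothX fun u hu => (S.immersion.2 u hu).1

theorem lam_pos {u : Fin 2 → ℝ} (hu : u ∈ U) : 0 < lam (X u) :=
  hlam.2 _ (by simpa using (S.immersion.2 u hu).1)

theorem smooth_normalDeriv : ContDiffOn ℝ ∞ (normalDeriv lam X n) U :=
  (smooth_pd (isOpen_base S.isOpen) (S.smooth_factor hlam) 2).comp contDiff_onSurface.contDiffOn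
    fun _ hu => base_onSurface_mem hu

theorem smooth_ambient (a b : Fin 3) :
    ContDiffOn ℝ ∞ (fun v => ambient lam X n v a b) (base ⁻¹' U) :=
  (((S.smooth_factor hlam).pow 2).mul (smooth_cyl (S.smooth_coeffI a b) (S.smooth_coeffII a b)
    (S.smooth_coeffIII a b))).congr fun _ hv => S.ambient_eq lam hv a b

variable {u : Fin 2 → ℝ} (hu : u ∈ U)
include hu

omit hlam in
theorem ambient_onSurface (a b : Fin 3) :
    ambient lam X n (onSurface u) a b = lam (X u) ^ 2 * coeffI X a b u := by
  rw [S.ambient_eq lam (base_onSurface_mem hu), cyl_onSurface, adapted_onSurface]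

omit hlam in
theorem ambient_onSurface_eq : ambient lam X n (onSurface u) =
    Matrix.diagonal ![lam (X u) ^ 2 * conf X u, lam (X u) ^ 2 * conf X u, lam (X u) ^ 2] := by
  ext a b
  rw [S.ambient_onSurface hu]
  fin_cases a <;> fin_cases b <;> simp [coeffI]

theorem ambient_inv : (ambient lam X n (onSurface u))⁻¹ =
    Matrix.diagonal ![(lam (X u) ^ 2 * conf X u)⁻¹, (lam (X u) ^ 2 * conf X u)⁻¹,
      (lam (X u) ^ 2)⁻¹] := by
  have h1 := (S.conf_pos hu).ne'
  have h2 := (S.lam_pos hlam hu).ne'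
  apply Matrix.inv_eq_right_inv
  rw [S.ambient_onSurface_eq hu, Matrix.diagonal_mul_diagonal, ← Matrix.diagonal_one]
  congr 1
  ext i
  fin_cases i <;> simp [h2] <;> field_simp

theorem pd_factor (i : Fin 2) : pd i.castSucc (fun v => lam (adapted X n v)) (onSurface u)
    = pd i (fun u => lam (X u)) u := by
  rw [← pd_onSurface (diffAt (isOpen_base S.isOpen) (S.smooth_factor hlam)
    (base_onSurface_mem hu)) i]
  simp only [adapted_onSurface]

theorem pd_pd_two_factor (i : Fin 2) :
    pd 2 (pd i.castSucc (fun v => lam (adapted X n v))) (onSurface u)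
      = pd i (normalDeriv lam X n) u := by
  have hW := isOpen_base S.isOpen
  have hf := S.smooth_factor hlam
  rw [pd_comm hW hf _ _ (base_onSurface_mem hu),
    ← pd_onSurface (diffAt hW (smooth_pd hW hf 2) (base_onSurface_mem hu)) i]
  rfl

theorem pd_pd_factor (i j : Fin 2) :
    pd i.castSucc (pd j.castSucc (fun v => lam (adapted X n v))) (onSurface u)
      = pd i (pd j (fun u => lam (X u))) u := by
  have hW := isOpen_base S.isOpen
  have hf := S.smooth_factor hlam
  rw [← pd_onSurface (diffAt hW (smooth_pd hW hf j.castSucc) (base_onSurface_mem hu)) i]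
  exact pd_congr_on S.isOpen (fun w hw => S.pd_factor hlam hw j) i hu

theorem jet_ambient (i : Fin 2) (a b : Fin 3) :
    pd i.castSucc (fun w => ambient lam X n w a b) (onSurface u) =
      2 * lam (X u) * pd i (fun u => lam (X u)) u * coeffI X a b u
        + lam (X u) ^ 2 * pd i (coeffI X a b) u := by
  rw [pd_congr_on (isOpen_base S.isOpen) (fun w hw => S.ambient_eq lam hw a b) _
    (base_onSurface_mem hu), pd_sq_mul (isOpen_base S.isOpen) (S.smooth_factor hlam)
    (smooth_cyl (S.smooth_coeffI a b) (S.smooth_coeffII a b) (S.smooth_coeffIII a b))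
    (base_onSurface_mem hu), S.pd_factor hlam hu, adapted_onSurface, cyl_onSurface,
    jet_cyl S.isOpen (S.smooth_coeffI a b) (S.smooth_coeffII a b) (S.smooth_coeffIII a b) hu]

theorem jet_ambient_two (a b : Fin 3) :
    pd 2 (fun w => ambient lam X n w a b) (onSurface u) =
      2 * lam (X u) * normalDeriv lam X n u * coeffI X a b u
        - 2 * lam (X u) ^ 2 * coeffII X n a b u := by
  rw [pd_congr_on (isOpen_base S.isOpen) (fun w hw => S.ambient_eq lam hw a b) _
    (base_onSurface_mem hu), pd_sq_mul (isOpen_base S.isOpen) (S.smooth_factor hlam)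
    (smooth_cyl (S.smooth_coeffI a b) (S.smooth_coeffII a b) (S.smooth_coeffIII a b))
    (base_onSurface_mem hu), adapted_onSurface, cyl_onSurface,
    jet_cyl_two S.isOpen (S.smooth_coeffI a b) (S.smooth_coeffII a b) (S.smooth_coeffIII a b) hu,
    ← normalDeriv]
  ring

theorem jet_ambient_two_cast (i : Fin 2) (a b : Fin 3) :
    pd 2 (pd i.castSucc (fun w => ambient lam X n w a b)) (onSurface u) =
      2 * normalDeriv lam X n u * pd i (fun u => lam (X u)) u * coeffI X a b u
        + 2 * lam (X u) * pd i (normalDeriv lam X n) u * coeffI X a b u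
        - 4 * lam (X u) * pd i (fun u => lam (X u)) u * coeffII X n a b u
        + 2 * lam (X u) * normalDeriv lam X n u * pd i (coeffI X a b) u
        - 2 * lam (X u) ^ 2 * pd i (coeffII X n a b) u := by
  have hW := isOpen_base S.isOpen
  have hm := smooth_cyl (S.smooth_coeffI a b) (S.smooth_coeffII a b) (S.smooth_coeffIII a b)
  rw [pd_congr_on hW (fun w hw => pd_congr_on hW (fun w hw => S.ambient_eq lam hw a b) _ hw) _
    (base_onSurface_mem hu), pd_pd_sq_mul hW (S.smooth_factor hlam) hm
    (base_onSurface_mem hu), adapted_onSurface, cyl_onSurface, S.pd_factor hlam hu,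
    S.pd_pd_two_factor hlam hu,
    jet_cyl S.isOpen (S.smooth_coeffI a b) (S.smooth_coeffII a b) (S.smooth_coeffIII a b) hu,
    jet_cyl_two S.isOpen (S.smooth_coeffI a b) (S.smooth_coeffII a b) (S.smooth_coeffIII a b) hu,
    jet_cyl_two_cast S.isOpen (S.smooth_coeffI a b) (S.smooth_coeffII a b)
      (S.smooth_coeffIII a b) hu, ← normalDeriv]
  ring

theorem jet_ambient_cast_cast (i j : Fin 2) (a b : Fin 3) :
    pd i.castSucc (pd j.castSucc (fun w => ambient lam X n w a b)) (onSurface u) =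
      2 * pd i (fun u => lam (X u)) u * pd j (fun u => lam (X u)) u * coeffI X a b u
        + 2 * lam (X u) * pd i (pd j (fun u => lam (X u))) u * coeffI X a b u
        + 2 * lam (X u) * pd j (fun u => lam (X u)) u * pd i (coeffI X a b) u
        + 2 * lam (X u) * pd i (fun u => lam (X u)) u * pd j (coeffI X a b) u
        + lam (X u) ^ 2 * pd i (pd j (coeffI X a b)) u := by
  have hW := isOpen_base S.isOpen
  have hm := smooth_cyl (S.smooth_coeffI a b) (S.smooth_coeffII a b) (S.smooth_coeffIII a b)
  rw [pd_congr_on hW (fun w hw => pd_congr_on hW (fun w hw => S.ambient_eq lam hw a b) _ hw) _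
    (base_onSurface_mem hu), pd_pd_sq_mul hW (S.smooth_factor hlam) hm
    (base_onSurface_mem hu), adapted_onSurface, cyl_onSurface, S.pd_factor hlam hu,
    S.pd_factor hlam hu, S.pd_pd_factor hlam hu,
    jet_cyl S.isOpen (S.smooth_coeffI a b) (S.smooth_coeffII a b) (S.smooth_coeffIII a b) hu,
    jet_cyl S.isOpen (S.smooth_coeffI a b) (S.smooth_coeffII a b) (S.smooth_coeffIII a b) hu,
    jet_cyl_cast_cast S.isOpen (S.smooth_coeffI a b) (S.smooth_coeffII a b)
      (S.smooth_coeffIII a b) hu]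

theorem jet_ambient_two_two (a b : Fin 3) :
    pd 2 (pd 2 (fun w => ambient lam X n w a b)) (onSurface u) =
      2 * (normalDeriv lam X n u ^ 2
          + lam (X u) * pd 2 (pd 2 (fun v => lam (adapted X n v))) (onSurface u)) * coeffI X a b u
        - 8 * lam (X u) * normalDeriv lam X n u * coeffII X n a b u
        - 2 * lam (X u) ^ 2 * (coeffI X a b u - coeffIII n a b u) := by
  have hW := isOpen_base S.isOpen
  have hm := smooth_cyl (S.smooth_coeffI a b) (S.smooth_coeffII a b) (S.smooth_coeffIII a b)
  rw [pd_congr_on hW (fun w hw => pd_congr_on hW (fun w hw => S.ambient_eq lam hw a b) _ hw) _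
    (base_onSurface_mem hu), pd_pd_sq_mul hW (S.smooth_factor hlam) hm
    (base_onSurface_mem hu), adapted_onSurface, cyl_onSurface,
    jet_cyl_two S.isOpen (S.smooth_coeffI a b) (S.smooth_coeffII a b) (S.smooth_coeffIII a b) hu,
    jet_cyl_two_two S.isOpen (S.smooth_coeffI a b) (S.smooth_coeffII a b)
      (S.smooth_coeffIII a b) hu, ← normalDeriv]
  ring

/-- The region of the adapted coordinates where the metric is nondegenerate. -/
theorem exists_nondegenerate : ∃ W : Set (Fin 3 → ℝ), IsOpen W ∧ onSurface u ∈ W ∧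
    W ⊆ base ⁻¹' U ∧ ∀ w ∈ W, (ambient lam X n w).det ≠ 0 := by
  refine ⟨base ⁻¹' U ∩ (fun w => (ambient lam X n w).det) ⁻¹' {0}ᶜ,
    (smooth_det (S.smooth_ambient hlam)).continuousOn.isOpen_inter_preimage
      (isOpen_base S.isOpen) isOpen_compl_singleton, ⟨base_onSurface_mem hu, ?_⟩,
    Set.inter_subset_left, fun w hw => hw.2⟩
  have h1 := S.conf_pos hu
  have h2 := S.lam_pos hlam hu
  simp only [Set.mem_preimage, S.ambient_onSurface_eq hu, Matrix.det_diagonal, Fin.prod_univ_three,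
    Matrix.cons_val, Set.mem_compl_iff, Set.mem_singleton_iff]
  positivity

theorem riemann_ambient (a b c d : Fin 3) : riemann (ambient lam X n) a b c d (onSurface u) =
    pd b (lowerChristoffel (ambient lam X n) d a c) (onSurface u)
      - pd a (lowerChristoffel (ambient lam X n) d b c) (onSurface u)
      - ∑ e, lowerChristoffel (ambient lam X n) e b d (onSurface u)
        * christoffel (ambient lam X n) e a c (onSurface u)
      + ∑ e, lowerChristoffel (ambient lam X n) e a d (onSurface u)
        * christoffel (ambient lam X n) e b c (onSurface u) := by
  obtain ⟨W, hW, hm, hs, hd⟩ := S.exists_nondegenerate hlam hu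
  exact riemann_eq hW (fun i j => (S.smooth_ambient hlam i j).mono hs) hd
    (ambient_symm lam X n) hm a b c d

theorem pd_lowerChristoffel_ambient (a b c d : Fin 3) :
    pd c (lowerChristoffel (ambient lam X n) d a b) (onSurface u) =
    (1 / 2) * (pd c (pd a (fun w => ambient lam X n w b d)) (onSurface u)
      + pd c (pd b (fun w => ambient lam X n w a d)) (onSurface u)
      - pd c (pd d (fun w => ambient lam X n w a b)) (onSurface u)) :=
  pd_lowerChristoffel (isOpen_base S.isOpen) (S.smooth_ambient hlam) (base_onSurface_mem hu) d a b c

end IsothermalSurface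

/-! ### Second fundamental form and curvature of λ²g₀ along the surface. -/

namespace IsothermalSurface

variable {X n : (Fin 2 → ℝ) → E4} {U : Set (Fin 2 → ℝ)} (S : IsothermalSurface X n U)
  {lam : E4 → ℝ} (hlam : IsConformalFactor lam) {u : Fin 2 → ℝ} (hu : u ∈ U)

include S hlam hu

theorem christoffel_ambient (c a b : Fin 3) :
    christoffel (ambient lam X n) c a b (onSurface u)
      = lowerChristoffel (ambient lam X n) c a b (onSurface u) /
        ![lam (X u) ^ 2 * conf X u, lam (X u) ^ 2 * conf X u, lam (X u) ^ 2] c := by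
  rw [christoffel_eq, S.ambient_inv hlam hu]
  fin_cases c <;> simp [Matrix.diagonal_apply, div_eq_inv_mul]

omit hlam in
theorem firstFormL_eq :
    firstFormL lam X n u = (lam (X u) ^ 2 * conf X u) • (1 : Matrix (Fin 2) (Fin 2) ℝ) := by
  ext i j
  simp only [firstFormL, Matrix.of_apply, S.ambient_onSurface hu]
  fin_cases i <;> fin_cases j <;> simp [coeffI]

/-- Contracting with the metric lowers the index of Γ. As the mixed metric entries vanish along the
surface, this leaves −½ ∂_s of the tangential metric, divided by λ. -/
theorem secondFormL_eq (i j : Fin 2) : secondFormL lam X n u i j = lam (X u) * sff X n i j u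
    - (if i = j then normalDeriv lam X n u * conf X u else 0) := by
  have h1 := S.lam_pos hlam hu
  have h2 := S.jet_ambient hlam hu 0
  have h3 := S.jet_ambient hlam hu 1
  have h4 := S.jet_ambient_two hlam hu
  simp only [Fin.castSucc_zero, Fin.castSucc_one] at h2 h3
  have hd : (ambient lam X n (onSurface u)).det ≠ 0 := by
    obtain ⟨W, _, hm, _, hd⟩ := S.exists_nondegenerate hlam hu
    exact hd _ hm
  have h5 : ∑ c, christoffel (ambient lam X n) c i.castSucc j.castSucc (onSurface u)
      * ambient lam X n (onSurface u) c 2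
      = lowerChristoffel (ambient lam X n) 2 i.castSucc j.castSucc (onSurface u) := by
    rw [← sum_mul_christoffel hd]
    exact Finset.sum_congr rfl fun c _ => by rw [ambient_symm, mul_comm]
  simp only [secondFormL, Matrix.of_apply]
  rw [h5, S.ambient_onSurface hu]
  have h6 : √(lam (X u) ^ 2 * coeffI X 2 2 u) = lam (X u) := by
    simp [coeffI, Real.sqrt_sq h1.le]
  rw [h6]
  fin_cases i <;> fin_cases j <;>
    simp [lowerChristoffel, h2, h3, h4, coeffI, coeffII, S.sff_10 hu, sff_01] <;>
    field_simp

/-- The first bracket is the derivative of κ = λ_s/λ². The derivatives of the second fundamental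
form that enter the trace form the Codazzi combination, which cancels the derivatives of the metric;
for λ = 1 nothing is left. -/
theorem normalRicci_eq (i : Fin 2) : normalRicci lam X n u i =
    -(pd i (normalDeriv lam X n) u / lam (X u) ^ 2
      - 2 * normalDeriv lam X n u * pd i (fun u => lam (X u)) u / lam (X u) ^ 3)
    - (sff X n i 0 u * pd 0 (fun u => lam (X u)) u + sff X n i 1 u * pd 1 (fun u => lam (X u)) u)
      / (conf X u * lam (X u) ^ 2) := by
  have h1 := S.lam_pos hlam hu
  have h0 := S.conf_pos hu
  have h2 := S.jet_ambient hlam hu 0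
  have h3 := S.jet_ambient hlam hu 1
  have h4 := S.jet_ambient_two hlam hu
  have k2 := S.jet_ambient_two_cast hlam hu 0
  have k3 := S.jet_ambient_two_cast hlam hu 1
  have k4 := S.jet_ambient_two_two hlam hu
  have k00 := S.jet_ambient_cast_cast hlam hu 0 0
  have k01 := S.jet_ambient_cast_cast hlam hu 0 1
  have k10 := S.jet_ambient_cast_cast hlam hu 1 0
  have k11 := S.jet_ambient_cast_cast hlam hu 1 1
  have sm : ∀ a b, ContDiffOn ℝ ∞ (fun v => ambient lam X n v a b) (base ⁻¹' U) :=
    S.smooth_ambient hlam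
  have kc0 : ∀ a b, pd 0 (pd 2 (fun w => ambient lam X n w a b)) (onSurface u)
      = pd 2 (pd 0 (fun w => ambient lam X n w a b)) (onSurface u) := fun a b =>
    pd_comm (isOpen_base S.isOpen) (sm a b) _ _ (base_onSurface_mem hu)
  have kc1 : ∀ a b, pd 1 (pd 2 (fun w => ambient lam X n w a b)) (onSurface u)
      = pd 2 (pd 1 (fun w => ambient lam X n w a b)) (onSurface u) := fun a b =>
    pd_comm (isOpen_base S.isOpen) (sm a b) _ _ (base_onSurface_mem hu)
  simp only [Fin.castSucc_zero, Fin.castSucc_one] at h2 h3 k2 k3 k00 k01 k10 k11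
  simp only [normalRicci, ricci, S.ambient_inv hlam hu]
  rw [S.ambient_onSurface hu]
  have h6 : √(lam (X u) ^ 2 * coeffI X 2 2 u) = lam (X u) := by
    simp [coeffI, Real.sqrt_sq h1.le]
  rw [h6]
  have h7 := S.codazzi_aux hu
  fin_cases i
  all_goals
    simp only [Fin.sum_univ_three, S.riemann_ambient hlam hu, S.pd_lowerChristoffel_ambient hlam hu,
      S.christoffel_ambient hlam hu, Matrix.diagonal_apply]
    simp [lowerChristoffel, h2, h3, h4, k2, k3, k4, kc0, kc1, k00, k01, k10, k11,
      coeffI, coeffII, coeffIII, S.sff_10 hu, sff_01, pd_const_fun]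
    have h9 := h7 0
    have h10 := h7 1
    -- The two off-diagonal coefficients have to be the same function `hopfQ` before the Codazzi
    -- equations can be matched with the goal.
    rw [pd_congr_on S.isOpen (fun w _ => sff_01 (u := w)) 0 hu] at h9
    rw [pd_congr_on S.isOpen (fun w hw => S.sff_10 hw) 1 hu] at h10
    simp [S.meanCurv_eq hu] at h9 h10
    field_simp at h9 h10 ⊢
    first
      | linear_combination lam (X u) ^ 2 * h9
      | linear_combination lam (X u) ^ 2 * h10
      | linear_combination -lam (X u) ^ 2 * h9
      | linear_combination -lam (X u) ^ 2 * h10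

/-- Only these two combinations pair nontrivially with a symmetric traceless form. The second normal
derivative of λ is multiplied by the metric, so it drops out of both. -/
theorem normalRiemann_eq :
    normalRiemann lam X n u 0 1 + normalRiemann lam X n u 1 0 =
      -2 * (pd 0 (pd 1 fun u => lam (X u)) u / lam (X u)
        - 2 * pd 0 (fun u => lam (X u)) u * pd 1 (fun u => lam (X u)) u / lam (X u) ^ 2
        - (pd 1 (conf X) u * pd 0 (fun u => lam (X u)) u
          + pd 0 (conf X) u * pd 1 (fun u => lam (X u)) u) / (2 * conf X u * lam (X u))
        - hopfQ X n u * normalDeriv lam X n u / lam (X u)) ∧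
    normalRiemann lam X n u 0 0 - normalRiemann lam X n u 1 1 =
      -((pd 0 (pd 0 fun u => lam (X u)) u - pd 1 (pd 1 fun u => lam (X u)) u) / lam (X u)
        - 2 * (pd 0 (fun u => lam (X u)) u ^ 2 - pd 1 (fun u => lam (X u)) u ^ 2) / lam (X u) ^ 2
        - (pd 0 (conf X) u * pd 0 (fun u => lam (X u)) u
          - pd 1 (conf X) u * pd 1 (fun u => lam (X u)) u) / (conf X u * lam (X u))
        - 2 * hopfP X n u * normalDeriv lam X n u / lam (X u)) := by
  have h1 := S.lam_pos hlam hu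
  have h0 := S.conf_pos hu
  have h2 := S.jet_ambient hlam hu 0
  have h3 := S.jet_ambient hlam hu 1
  have h4 := S.jet_ambient_two hlam hu
  have k2 := S.jet_ambient_two_cast hlam hu 0
  have k3 := S.jet_ambient_two_cast hlam hu 1
  have k4 := S.jet_ambient_two_two hlam hu
  have k00 := S.jet_ambient_cast_cast hlam hu 0 0
  have k01 := S.jet_ambient_cast_cast hlam hu 0 1
  have k10 := S.jet_ambient_cast_cast hlam hu 1 0
  have k11 := S.jet_ambient_cast_cast hlam hu 1 1
  have sm : ∀ a b, ContDiffOn ℝ ∞ (fun v => ambient lam X n v a b) (base ⁻¹' U) :=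
    S.smooth_ambient hlam
  have kc0 : ∀ a b, pd 0 (pd 2 (fun w => ambient lam X n w a b)) (onSurface u)
      = pd 2 (pd 0 (fun w => ambient lam X n w a b)) (onSurface u) := fun a b =>
    pd_comm (isOpen_base S.isOpen) (sm a b) _ _ (base_onSurface_mem hu)
  have kc1 : ∀ a b, pd 1 (pd 2 (fun w => ambient lam X n w a b)) (onSurface u)
      = pd 2 (pd 1 (fun w => ambient lam X n w a b)) (onSurface u) := fun a b =>
    pd_comm (isOpen_base S.isOpen) (sm a b) _ _ (base_onSurface_mem hu)
  simp only [Fin.castSucc_zero, Fin.castSucc_one] at h2 h3 k2 k3 k00 k01 k10 k11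
  have kl := pd_comm S.isOpen (S.smooth_lam hlam) 1 0 hu
  simp only [normalRiemann, Matrix.of_apply, S.ambient_onSurface hu]
  constructor
  all_goals
    simp only [Fin.sum_univ_three, S.riemann_ambient hlam hu, S.pd_lowerChristoffel_ambient hlam hu,
      S.christoffel_ambient hlam hu]
    simp [lowerChristoffel, h2, h3, h4, k2, k3, k4, kc0, kc1, k00, k01, k10, k11,
      coeffI, coeffII, coeffIII, S.sff_10 hu, sff_01, thirdForm, S.inner_pdN_pdN hu, pd_const_fun, kl, hopfP,
      -inner_self_eq_norm_sq_to_K]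
    field_simp
    ring

end IsothermalSurface

/-! ### 𝓗_λ in terms of the round metric. -/

namespace IsothermalSurface

variable {X n : (Fin 2 → ℝ) → E4} {U : Set (Fin 2 → ℝ)} (S : IsothermalSurface X n U)
  {lam : E4 → ℝ} (hlam : IsConformalFactor lam) {u : Fin 2 → ℝ} (hu : u ∈ U)

include S hlam hu

theorem meanCurvL_eq : meanCurvL lam X n u = meanCurv X n u / lam (X u)
    - normalDeriv lam X n u / lam (X u) ^ 2 := by
  have h0 := S.conf_pos hu
  have h1 := S.lam_pos hlam hu
  rw [meanCurvL, meanOf_conformal (by positivity) (S.firstFormL_eq hu),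
    S.secondFormL_eq hlam hu, S.secondFormL_eq hlam hu, S.sff_00 hu, S.sff_11 hu]
  simp only [if_true]
  field_simp
  ring

/-- A conformal change alters the second fundamental form by the factor λ and by a multiple of the
metric, and the multiple of the metric has no traceless part. -/
theorem tracelessL_eq : tracelessL lam X n u =
    lam (X u) • !![hopfP X n u, hopfQ X n u; hopfQ X n u, -hopfP X n u] := by
  have h0 := S.conf_pos hu
  have h1 := S.lam_pos hlam hu
  have hm : meanOf (firstFormL lam X n) (secondFormL lam X n) u
    = meanCurv X n u / lam (X u) - normalDeriv lam X n u / lam (X u) ^ 2 := S.meanCurvL_eq hlam hu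
  ext i j
  rw [tracelessL, tracelessOf, Matrix.sub_apply, Matrix.smul_apply, hm, S.firstFormL_eq hu,
    S.secondFormL_eq hlam hu]
  fin_cases i <;> fin_cases j <;>
    simp [S.sff_00 hu, S.sff_11 hu, S.sff_10 hu, sff_01] <;> field_simp <;> ring

/-- The comparison of `𝓗_λ` with the Willmore expression of the round metric. -/
theorem scriptH_eq : scriptH lam X n u = (lam (X u) ^ 3)⁻¹ * willmoreCurv X n u := by
  have h0 := S.conf_pos hu
  have h1 := S.lam_pos hlam hu
  have h1' : lam (X u) ≠ 0 := h1.ne'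
  have hU := S.isOpen
  set f : (Fin 2 → ℝ) → ℝ := fun u => lam (X u) with hf
  set H := meanCurv X n with hH
  set p := hopfP X n with hp
  set q := hopfQ X n with hq
  set e := conf X with he
  set κ : (Fin 2 → ℝ) → ℝ := fun u => normalDeriv lam X n u / f u ^ 2 with hκ
  have f0 : ∀ w ∈ U, f w ≠ 0 := fun w hw => (S.lam_pos hlam hw).ne'
  have e0 : ∀ w ∈ U, e w ≠ 0 := fun w hw => (S.conf_pos hw).ne'
  have sf : ContDiffOn ℝ ∞ f U := S.smooth_lam hlam
  have sH : ContDiffOn ℝ ∞ H U := S.smooth_mean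
  have sκ : ContDiffOn ℝ ∞ κ U :=
    (S.smooth_normalDeriv hlam).div (sf.pow 2) fun w hw => pow_ne_zero 2 (f0 w hw)
  have hκ' : ∀ i, ∀ w ∈ U, pd i κ w = pd i (normalDeriv lam X n) w / f w ^ 2
      - 2 * normalDeriv lam X n w * pd i f w / f w ^ 3 := fun i w hw => by
    have d1 := diffAt hU sf hw
    have d2 := diffAt hU (S.smooth_normalDeriv hlam) hw
    have := f0 w hw
    rw [hκ, pd_div i d2 (by fun_prop) (pow_ne_zero 2 this), pd_pow i 2 d1]
    field_simp
    norm_num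
    ring
  -- the two parts with second derivatives
  have hL : ∀ i, pd i (pd i (meanCurvL lam X n)) u = pd i (pd i H) u / f u
      - 2 * pd i H u * pd i f u / f u ^ 2 - H u * pd i (pd i f) u / f u ^ 2
      + 2 * H u * pd i f u ^ 2 / f u ^ 3 - pd i (pd i κ) u := fun i => by
    have hfirst : ∀ w ∈ U, pd i (meanCurvL lam X n) w =
        (pd i H w * f w - H w * pd i f w) / f w ^ 2 - pd i κ w := fun w hw => by
      have d1 := diffAt hU sf hw
      have d2 := diffAt hU sH hw
      have d3 := diffAt hU sκ hw
      rw [pd_congr_on hU (fun w hw => S.meanCurvL_eq hlam hw) i hw]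
      change pd i (fun w => H w / f w - κ w) w = _
      rw [pd_sub i (diffAt_div d2 d1 (f0 w hw)) d3, pd_div i d2 d1 (f0 w hw)]
    have d1 := diffAt hU sf hu
    have d2 := diffAt hU sH hu
    have d3 := diffAt hU (smooth_pd hU sκ i) hu
    have d4 := diffAt hU (smooth_pd hU sf i) hu
    have d5 := diffAt hU (smooth_pd hU sH i) hu
    have n0 := f0 u hu
    have n1 := pow_ne_zero 2 n0
    have d6 : DifferentiableAt ℝ (fun w => pd i H w * f w - H w * pd i f w) u := by fun_prop
    rw [pd_congr_on hU hfirst i hu, pd_sub i (diffAt_div d6 (by fun_prop) n1) d3,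
      pd_div i d6 (by fun_prop) n1]
    simp (disch := fun_prop) only [pd_sub, pd_mul, pd_pow]
    field_simp
    norm_num
    ring
  have hR : ∀ i, ∀ w ∈ U, normalRicci lam X n w i = -pd i κ w
      - (H w * pd i f w + (![p w * pd 0 f w + q w * pd 1 f w, q w * pd 0 f w - p w * pd 1 f w] i)
        / e w) / f w ^ 2 := fun i w hw => by
    have := f0 w hw
    have := e0 w hw
    rw [S.normalRicci_eq hlam hw, hκ' i w hw]
    change -(pd i (normalDeriv lam X n) w / f w ^ 2
      - 2 * normalDeriv lam X n w * pd i f w / f w ^ 3)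
      - (sff X n i 0 w * pd 0 f w + sff X n i 1 w * pd 1 f w) / (e w * f w ^ 2) = _
    fin_cases i <;>
      simp [S.sff_00 hw, S.sff_11 hw, S.sff_10 hw, sff_01, ← hH, ← hp, ← hq, ← he] <;>
      field_simp <;> ring
  have c0 := S.codazzi0 hu
  have c1 := S.codazzi1 hu
  rw [← hH, ← hp, ← hq, ← he] at c0 c1
  have d1 := diffAt hU sf hu
  have d2 := diffAt hU sH hu
  have d3 := fun i => diffAt hU (smooth_pd hU sκ i) hu
  have d4 := fun i => diffAt hU (smooth_pd hU sf i) hu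
  have d7 : DifferentiableAt ℝ p u := diffAt hU S.smooth_hopfP hu
  have d8 : DifferentiableAt ℝ q u := diffAt hU S.smooth_hopfQ hu
  have d9 : DifferentiableAt ℝ e u := diffAt hU S.smooth_conf hu
  have d30 := d3 0
  have d31 := d3 1
  have d40 := d4 0
  have d41 := d4 1
  have n0 := f0 u hu
  have n1 := pow_ne_zero 2 n0
  have n2 := e0 u hu
  have kl := pd_comm hU sf 1 0 hu
  have q0 := pd_congr_on hU (hR 0) 0 hu
  have q1 := pd_congr_on hU (hR 1) 1 hu
  have g0 : DifferentiableAt ℝ (fun w => p w * pd 0 f w + q w * pd 1 f w) u := by fun_prop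
  have g1 : DifferentiableAt ℝ (fun w => q w * pd 0 f w - p w * pd 1 f w) u := by fun_prop
  have g2 := diffAt_div g0 d9 n2
  have g3 := diffAt_div g1 d9 n2
  have g4 : DifferentiableAt ℝ (fun w => H w * pd 0 f w
    + (p w * pd 0 f w + q w * pd 1 f w) / e w) u := (d2.fun_mul d40).fun_add g2
  have g5 : DifferentiableAt ℝ (fun w => H w * pd 1 f w
    + (q w * pd 0 f w - p w * pd 1 f w) / e w) u := (d2.fun_mul d41).fun_add g3
  have g6 : DifferentiableAt ℝ (fun w => f w ^ 2) u := by fun_prop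
  simp only [Matrix.cons_val_zero, Matrix.cons_val_one] at q0 q1
  rw [pd_sub 0 (by fun_prop) (diffAt_div g4 g6 n1), pd_div 0 g4 g6 n1, pd_neg,
    pd_add 0 (by fun_prop) g2, pd_div 0 g0 d9 n2] at q0
  rw [pd_sub 1 (by fun_prop) (diffAt_div g5 g6 n1), pd_div 1 g5 g6 n1, pd_neg,
    pd_add 1 (by fun_prop) g3, pd_div 1 g1 d9 n2] at q1
  simp (disch := fun_prop) only [pd_add, pd_sub, pd_mul, pd_pow] at q0 q1
  obtain ⟨r1, r2⟩ := S.normalRiemann_eq hlam hu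
  rw [← hp, ← hq, ← he, ← hf] at *
  have hpos : ∀ w ∈ U, 0 < lam (X w) ^ 2 * conf X w := fun w hw => by
    have := S.conf_pos hw
    have := S.lam_pos hlam hw
    positivity
  -- The components left unknown, `1 0` here and `1 1` below, disappear from the pairing because the
  -- traceless form is symmetric with opposite diagonal entries.
  have r3 : normalRiemann lam X n u 0 1 = -normalRiemann lam X n u 1 0
      + (normalRiemann lam X n u 0 1 + normalRiemann lam X n u 1 0) := by ring
  have r4 : normalRiemann lam X n u 0 0 = normalRiemann lam X n u 1 1
      + (normalRiemann lam X n u 0 0 - normalRiemann lam X n u 1 1) := by ring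
  rw [r1] at r3
  rw [r2] at r4
  rw [scriptH, laplace_conformal hU hpos (fun w hw => S.firstFormL_eq hw) _ hu,
    divergence_conformal hU hpos (fun w hw => S.firstFormL_eq hw) _ hu,
    pairing_conformal (hpos u hu).ne' (S.firstFormL_eq hu),
    pairing_conformal (hpos u hu).ne' (S.firstFormL_eq hu), S.tracelessL_eq hlam hu,
    S.meanCurvL_eq hlam hu, S.willmoreCurv_eq hu, hL, hL, q0, q1]
  simp only [Matrix.smul_apply, Matrix.of_apply, Matrix.cons_val', Matrix.cons_val_zero,
    Matrix.cons_val_one, Matrix.cons_val_fin_one, smul_eq_mul, r3, r4]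
  rw [← hp, ← hq, ← he, ← hH, kl]
  change _ = (f u ^ 3)⁻¹ * _
  simp only [show lam (X u) = f u from rfl]
  -- Codazzi trades the derivatives of p for those of q and H; the claim is then a rational
  -- identity.
  have c0' : pd 0 p u = e u * pd 0 H u - pd 1 q u := by linarith
  have c1' : pd 1 p u = pd 0 q u - e u * pd 1 H u := by linarith
  rw [c0', c1']
  field_simp
  norm_num
  ring

end IsothermalSurface

/-! ### Change of isothermal coordinates. -/

theorem pd_comp {k : ℕ} {V : Type*} [NormedAddCommGroup V] [NormedSpace ℝ V]
    {F : (Fin 2 → ℝ) → V} {ψ : (Fin k → ℝ) → (Fin 2 → ℝ)} {v : Fin k → ℝ}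
    (hF : DifferentiableAt ℝ F (ψ v)) (hψ : DifferentiableAt ℝ ψ v) (i : Fin k) :
    pd i (fun w => F (ψ w)) v = pd i (fun w => ψ w 0) v • pd 0 F (ψ v)
      + pd i (fun w => ψ w 1) v • pd 1 F (ψ v) := by
  have h1 := (hF.hasFDerivAt.comp v hψ.hasFDerivAt).fderiv
  have h2 : ∀ j, pd i (fun w => ψ w j) v = fderiv ℝ ψ v (Pi.single i 1) j := fun j => by
    have := (hasFDerivAt_pi'.1 hψ.hasFDerivAt j).fderiv
    simp [pd, this]
  rw [h2, h2]
  simp only [pd]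
  rw [show (fun w => F (ψ w)) = F ∘ ψ from rfl, h1, ContinuousLinearMap.comp_apply,
    ← map_smul, ← map_smul, ← map_add]
  congr 1
  ext j
  fin_cases j <;> simp

namespace IsothermalSurface

variable {X n : (Fin 2 → ℝ) → E4} {U : Set (Fin 2 → ℝ)} (S : IsothermalSurface X n U)
  {V : Set (Fin 2 → ℝ)} {ψ : (Fin 2 → ℝ) → (Fin 2 → ℝ)} (hV : IsOpen V)
  (hψ : ContDiffOn ℝ ∞ ψ V) (hm : Set.MapsTo ψ V U)

include S hV hψ hm

theorem comp (hi : IsImmersion (X ∘ ψ) V) (hc : IsIsothermal (X ∘ ψ) V) :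
    IsothermalSurface (X ∘ ψ) (n ∘ ψ) V where
  isOpen := hV
  immersion := hi
  isothermal := hc
  normal := by
    refine ⟨S.smoothN.comp hψ hm, fun v hv => ?_⟩
    obtain ⟨h1, h2, h3⟩ := S.normal.2 _ (hm hv)
    refine ⟨h1, h2, fun i => ?_⟩
    rw [show X ∘ ψ = fun w => X (ψ w) from rfl,
      pd_comp (diffAt S.isOpen S.smoothX (hm hv)) (diffAt hV hψ hv)]
    simp [inner_add_right, inner_smul_right, h3]

/-- The Willmore expression does not depend on the isothermal coordinates. -/
theorem willmoreCurv_comp (hi : IsImmersion (X ∘ ψ) V) (hc : IsIsothermal (X ∘ ψ) V)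
    {v : Fin 2 → ℝ} (hv : v ∈ V) :
    willmoreCurv (X ∘ ψ) (n ∘ ψ) v = willmoreCurv X n (ψ v) := by
  have S' := S.comp hV hψ hm hi hc
  have sψ : ∀ k, ContDiffOn ℝ ∞ (fun w => ψ w k) V := fun k => contDiffOn_pi.1 hψ k
  have sJ : ∀ i k, ContDiffOn ℝ ∞ (pd i (fun w => ψ w k)) V := fun i k => smooth_pd hV (sψ k) i
  set J : Fin 2 → Fin 2 → (Fin 2 → ℝ) → ℝ := fun i k => pd i (fun w => ψ w k) with hJ
  have dψ : ∀ w ∈ V, DifferentiableAt ℝ ψ w := fun w hw => diffAt hV hψ hw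
  have hX : ∀ i, ∀ w ∈ V, pd i (X ∘ ψ) w = J i 0 w • pd 0 X (ψ w) + J i 1 w • pd 1 X (ψ w) :=
    fun i w hw => pd_comp (diffAt S.isOpen S.smoothX (hm hw)) (dψ w hw) i
  have hN : ∀ i, ∀ w ∈ V, pd i (n ∘ ψ) w = J i 0 w • pd 0 n (ψ w) + J i 1 w • pd 1 n (ψ w) :=
    fun i w hw => pd_comp (diffAt S.isOpen S.smoothN (hm hw)) (dψ w hw) i
  have hg : ∀ i j, ∀ w ∈ V, (inner ℝ (pd i (X ∘ ψ) w) (pd j (X ∘ ψ) w) : ℝ)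
      = conf X (ψ w) * (J i 0 w * J j 0 w + J i 1 w * J j 1 w) := fun i j w hw => by
    rw [hX i w hw, hX j w hw]
    simp [inner_add_left, inner_add_right, inner_smul_left, inner_smul_right,
      S.inner_pdX (hm hw), -inner_self_eq_norm_sq_to_K]
    ring
  have hh : ∀ i j, ∀ w ∈ V, sff (X ∘ ψ) (n ∘ ψ) i j w
      = J i 0 w * J j 0 w * sff X n 0 0 (ψ w) + (J i 0 w * J j 1 w + J i 1 w * J j 0 w)
        * hopfQ X n (ψ w) + J i 1 w * J j 1 w * sff X n 1 1 (ψ w) := fun i j w hw => by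
    rw [sff, hX i w hw, hN j w hw]
    simp [inner_add_left, inner_add_right, inner_smul_left, inner_smul_right, inner_pdX_pdN,
      S.sff_10 (hm hw), sff_01]
    ring
  have r1 : ∀ w ∈ V, J 0 0 w * J 0 0 w + J 0 1 w * J 0 1 w
      - (J 1 0 w * J 1 0 w + J 1 1 w * J 1 1 w) = 0 := fun w hw => by
    have h0 := S.conf_pos (hm hw)
    have h1 := hg 0 0 w hw
    have h2 := hg 1 1 w hw
    rw [S'.inner_pdX hw, if_pos rfl] at h1 h2
    have h3 := mul_left_cancel₀ h0.ne' (h1.symm.trans h2)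
    linarith
  have r2 : ∀ w ∈ V, J 0 0 w * J 1 0 w + J 0 1 w * J 1 1 w = 0 := fun w hw => by
    have h0 := S.conf_pos (hm hw)
    have h1 := hg 0 1 w hw
    rw [S'.inner_pdX hw, if_neg (by decide)] at h1
    simpa [h0.ne'] using h1.symm
  have he : ∀ w ∈ V, conf (X ∘ ψ) w = conf X (ψ w) * (J 0 0 w ^ 2 + J 0 1 w ^ 2) :=
    fun w hw => by
      have := hg 0 0 w hw
      rw [← conf] at this
      rw [this]; ring
  have hcpos : ∀ w ∈ V, 0 < J 0 0 w ^ 2 + J 0 1 w ^ 2 := fun w hw =>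
    pos_of_mul_pos_right (he w hw ▸ S'.conf_pos hw) (S.conf_pos (hm hw)).le
  -- The second row of the Jacobian is the first one rotated by a right angle, up to the sign s. The
  -- sign is chosen pointwise and never differentiated: the derivatives below are taken of `r1` and
  -- `r2`.
  have hs : ∀ w ∈ V, ∃ s : ℝ, s ^ 2 = 1 ∧ J 1 0 w = -s * J 0 1 w ∧ J 1 1 w = s * J 0 0 w := by
    intro w hw
    have h0 := hcpos w hw
    have h1 := r1 w hw
    have h2 := r2 w hw
    refine ⟨(J 0 0 w * J 1 1 w - J 0 1 w * J 1 0 w) / (J 0 0 w ^ 2 + J 0 1 w ^ 2), ?_, ?_, ?_⟩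
    · rw [div_pow, div_eq_one_iff_eq (by positivity)]
      linear_combination (-(J 0 0 w ^ 2 + J 0 1 w ^ 2)) * h1
        - (J 0 0 w * J 1 0 w + J 0 1 w * J 1 1 w) * h2
    · field_simp
      linear_combination J 0 0 w * h2
    · field_simp
      linear_combination J 0 1 w * h2
  have hH : ∀ w ∈ V, meanCurv (X ∘ ψ) (n ∘ ψ) w = meanCurv X n (ψ w) := fun w hw => by
    obtain ⟨s, s1, s2, s3⟩ := hs w hw
    have h0 := hcpos w hw
    have h1 := S.conf_pos (hm hw)
    rw [S'.meanCurv_eq hw, S.meanCurv_eq (hm hw), hh 0 0 w hw, hh 1 1 w hw, he w hw, s2, s3]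
    rw [div_eq_div_iff (by positivity) (by positivity)]
    linear_combination (2 * conf X (ψ w)) * (J 0 1 w ^ 2 * sff X n 0 0 (ψ w)
      - 2 * J 0 0 w * J 0 1 w * hopfQ X n (ψ w) + J 0 0 w ^ 2 * sff X n 1 1 (ψ w)) * s1
  -- the components of `ψ` are harmonic
  have dJ := fun i k => diffAt hV (sJ i k) hv
  have e1 := fun i => pd_congr_on hV r1 i hv
  have e2 := fun i => pd_congr_on hV r2 i hv
  have d00 : DifferentiableAt ℝ (J 0 0) v := dJ 0 0
  have d01 : DifferentiableAt ℝ (J 0 1) v := dJ 0 1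
  have d10 : DifferentiableAt ℝ (J 1 0) v := dJ 1 0
  have d11 : DifferentiableAt ℝ (J 1 1) v := dJ 1 1
  simp (disch := fun_prop) only [pd_add, pd_sub, pd_mul, pd_const] at e1 e2
  have k0 : pd 0 (J 1 0) v = pd 1 (J 0 0) v := pd_comm hV (sψ 0) 0 1 hv
  have k1 : pd 0 (J 1 1) v = pd 1 (J 0 1) v := pd_comm hV (sψ 1) 0 1 hv
  have e10 := e1 0
  have e11 := e1 1
  have e20 := e2 0
  have e21 := e2 1
  rw [k0, k1] at e10 e20
  have hc0 := hcpos v hv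
  obtain ⟨s, s1, s2, s3⟩ := hs v hv
  rw [s2, s3] at e10 e11 e20 e21
  -- This says that Δψ is orthogonal to ∂₀ψ: add half the first derivative of |∂₀ψ|² = |∂₁ψ|² to the
  -- second derivative of ⟨∂₀ψ, ∂₁ψ⟩ = 0. In the same way `w2` gives orthogonality to ∂₁ψ, so Δψ =
  -- 0.
  have w1 : J 0 0 v * (pd 0 (J 0 0) v + pd 1 (J 1 0) v)
      + J 0 1 v * (pd 0 (J 0 1) v + pd 1 (J 1 1) v) = 0 := by
    linear_combination e10 / 2 + e21
  have w2 : -J 0 1 v * (pd 0 (J 0 0) v + pd 1 (J 1 0) v)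
      + J 0 0 v * (pd 0 (J 0 1) v + pd 1 (J 1 1) v) = 0 := by
    have : s * (-J 0 1 v * (pd 0 (J 0 0) v + pd 1 (J 1 0) v)
      + J 0 0 v * (pd 0 (J 0 1) v + pd 1 (J 1 1) v)) = 0 := by
      linear_combination e20 - e11 / 2
    refine (mul_eq_zero.1 this).resolve_left fun h => ?_
    simp [h] at s1
  have L0 : pd 0 (J 0 0) v + pd 1 (J 1 0) v = 0 := by
    have : (J 0 0 v ^ 2 + J 0 1 v ^ 2) * (pd 0 (J 0 0) v + pd 1 (J 1 0) v) = 0 := by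
      linear_combination J 0 0 v * w1 - J 0 1 v * w2
    exact (mul_eq_zero.1 this).resolve_left hc0.ne'
  have L1 : pd 0 (J 0 1) v + pd 1 (J 1 1) v = 0 := by
    have : (J 0 0 v ^ 2 + J 0 1 v ^ 2) * (pd 0 (J 0 1) v + pd 1 (J 1 1) v) = 0 := by
      linear_combination J 0 1 v * w1 + J 0 0 v * w2
    exact (mul_eq_zero.1 this).resolve_left hc0.ne'
  -- second derivatives of the mean curvature
  have hD1 : ∀ i, ∀ w ∈ V, pd i (meanCurv (X ∘ ψ) (n ∘ ψ)) w
      = J i 0 w * pd 0 (meanCurv X n) (ψ w) + J i 1 w * pd 1 (meanCurv X n) (ψ w) :=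
    fun i w hw => by
      rw [pd_congr_on hV hH i hw,
        pd_comp (diffAt S.isOpen S.smooth_mean (hm hw)) (dψ w hw) i]
      rfl
  have sH := fun i => smooth_pd S.isOpen S.smooth_mean i
  have dH : ∀ i, DifferentiableAt ℝ (fun w => pd i (meanCurv X n) (ψ w)) v := fun i =>
    (diffAt S.isOpen (sH i) (hm hv)).fun_comp' v (dψ v hv)
  have hD2 : ∀ i, pd i (pd i (meanCurv (X ∘ ψ) (n ∘ ψ))) v
      = pd i (J i 0) v * pd 0 (meanCurv X n) (ψ v) + pd i (J i 1) v * pd 1 (meanCurv X n) (ψ v)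
        + J i 0 v * (J i 0 v * pd 0 (pd 0 (meanCurv X n)) (ψ v)
            + J i 1 v * pd 1 (pd 0 (meanCurv X n)) (ψ v))
        + J i 1 v * (J i 0 v * pd 0 (pd 1 (meanCurv X n)) (ψ v)
            + J i 1 v * pd 1 (pd 1 (meanCurv X n)) (ψ v)) := fun i => by
    rw [pd_congr_on hV (hD1 i) i hv, pd_add i ((dJ i 0).fun_mul (dH 0)) ((dJ i 1).fun_mul (dH 1)),
      pd_mul i (dJ i 0) (dH 0), pd_mul i (dJ i 1) (dH 1),
      pd_comp (diffAt S.isOpen (sH 0) (hm hv)) (dψ v hv) i,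
      pd_comp (diffAt S.isOpen (sH 1) (hm hv)) (dψ v hv) i]
    simp only [smul_eq_mul, hJ]
    ring
  have h1 := S.conf_pos (hm hv)
  rw [S'.willmoreCurv_eq hv, S.willmoreCurv_eq (hm hv), hD2, hD2, he v hv, hH v hv, hopfP, hopfQ,
    hh 0 0 v hv, hh 1 1 v hv, hh 0 1 v hv, hopfP, pd_comm S.isOpen S.smooth_mean 1 0 (hm hv),
    s2, s3]
  have L0' : pd 1 (J 1 0) v = -pd 0 (J 0 0) v := by linarith
  have L1' : pd 1 (J 1 1) v = -pd 0 (J 0 1) v := by linarith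
  rw [L0', L1']
  have s2' : s * s = 1 := by rw [← sq, s1]
  -- The two cases are the orientation-preserving and the orientation-reversing one.
  rcases mul_self_eq_one_iff.1 s2' with rfl | rfl <;> field_simp <;> ring

end IsothermalSurface

/-! ### The Laplacian at `ρ = 0` in the coordinates `(α, ρ, u¹, u²)` -/

/-- The surface parameter of a point in the coordinates `(α, ρ, u¹, u²)`. -/
def param (w : Fin 4 → ℝ) : Fin 2 → ℝ := ![w 2, w 3]

theorem contDiff_param : ContDiff ℝ ∞ param := by
  rw [contDiff_pi]
  intro i
  fin_cases i <;> simp [param] <;> fun_prop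

theorem pd_param {V : Type*} [NormedAddCommGroup V] [NormedSpace ℝ V] {F : (Fin 2 → ℝ) → V}
    {v : Fin 4 → ℝ} (hF : DifferentiableAt ℝ F (param v)) (i : Fin 4) :
    pd i (fun w => F (param w)) v
      = ![(0 : V), 0, pd 0 F (param v), pd 1 F (param v)] i := by
  rw [pd_comp hF (contDiff_param.differentiable (by simp) v) i]
  have h0 : pd i (fun w => param w 0) v = if i = 2 then 1 else 0 := pd_coord i 2
  have h1 : pd i (fun w => param w 1) v = if i = 3 then 1 else 0 := pd_coord i 3
  rw [h0, h1]
  fin_cases i <;> simp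

theorem param_vec (a r : ℝ) (u : Fin 2 → ℝ) : param ![a, r, u 0, u 1] = u := by
  ext i; fin_cases i <;> simp [param]

/-- Derivatives along the slice `ρ = 0` depend only on the values there. -/
theorem pd_eq_of_slice {W : Set (Fin 4 → ℝ)} (hW : IsOpen W) {F φ : (Fin 4 → ℝ) → ℝ}
    (h : ∀ w ∈ W, 0 < w 0 → w 1 = 0 → F w = φ w) {v : Fin 4 → ℝ} (hv : v ∈ W) (h0 : 0 < v 0)
    (h1 : v 1 = 0) (hF : DifferentiableAt ℝ F v)
    (hφ : DifferentiableAt ℝ φ v) {c : Fin 4} (hc : c ≠ 1) : pd c F v = pd c φ v := by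
  rw [pd, pd, ← hF.lineDeriv_eq_fderiv, ← hφ.lineDeriv_eq_fderiv]
  have hcont : Continuous fun t : ℝ => v + t • (Pi.single c 1 : Fin 4 → ℝ) := by fun_prop
  have hz : v + (0 : ℝ) • (Pi.single c 1 : Fin 4 → ℝ) = v := by simp
  apply Filter.EventuallyEq.deriv_eq
  have e1 : ∀ᶠ t in 𝓝 (0 : ℝ), v + t • (Pi.single c 1 : Fin 4 → ℝ) ∈ W ∩ {w | 0 < w 0} :=
    hcont.continuousAt.preimage_mem_nhds ((hW.inter (isOpen_lt continuous_const
      (continuous_apply 0))).mem_nhds (by simpa [hz] using ⟨hv, h0⟩))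
  filter_upwards [e1] with t t1
  exact h _ t1.1 t1.2 (by simp [h1, hc.symm])

/-- A smooth function on `W` that depends on `(u¹, u²)` only. -/
structure IsLift (W : Set (Fin 4 → ℝ)) (φ : (Fin 4 → ℝ) → ℝ) : Prop where
  smooth : ContDiffOn ℝ ∞ φ W
  pd_zero : ∀ v ∈ W, pd 0 φ v = 0
  pd_one : ∀ v ∈ W, pd 1 φ v = 0

theorem isOpen_param {U : Set (Fin 2 → ℝ)} (hU : IsOpen U) : IsOpen (param ⁻¹' U) :=
  hU.preimage contDiff_param.continuous

theorem isLift_param {U : Set (Fin 2 → ℝ)} (hU : IsOpen U) {φ : (Fin 2 → ℝ) → ℝ}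
    (hφ : ContDiffOn ℝ ∞ φ U) : IsLift (param ⁻¹' U) fun w => φ (param w) where
  smooth := hφ.comp contDiff_param.contDiffOn fun _ hv => hv
  pd_zero v hv := by simpa using pd_param (diffAt hU hφ hv) 0
  pd_one v hv := by simpa using pd_param (diffAt hU hφ hv) 1

section Slice

variable {W : Set (Fin 4 → ℝ)} (hW : IsOpen W) {G h : TensorField 4}
  {θ₀ θ₁ Λ P Q σ₀₀ σ₀₁ σ₁₁ τ₀₀ τ₀₁ τ₁₁ k₀₀ k₀₁ k₁₀ k₁₁ : (Fin 4 → ℝ) → ℝ}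
  (hΛ : ∀ v ∈ W, 0 < Λ v)
  (sθ₀ : IsLift W θ₀) (sθ₁ : IsLift W θ₁) (sΛ : IsLift W Λ)
  (sP : IsLift W P) (sQ : IsLift W Q)
  (sσ₀₀ : IsLift W σ₀₀) (sσ₀₁ : IsLift W σ₀₁) (sσ₁₁ : IsLift W σ₁₁)
  (sτ₀₀ : IsLift W τ₀₀) (sτ₀₁ : IsLift W τ₀₁) (sτ₁₁ : IsLift W τ₁₁)
  (sk₀₀ : IsLift W k₀₀) (sk₀₁ : IsLift W k₀₁) (sk₁₀ : IsLift W k₁₀)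
  (sk₁₁ : IsLift W k₁₁)
  (hG : ∀ w, w ∈ W → G w =
    !![-2 * w 1, -w 0, 0, 0;
      -w 0, 0, w 0 ^ 2 * θ₀ w, w 0 ^ 2 * θ₁ w;
      0, w 0 ^ 2 * θ₀ w,
        w 0 ^ 2 * (Λ w + w 1 * σ₀₀ w + w 1 ^ 2 * τ₀₀ w),
        w 0 ^ 2 * (w 1 * σ₀₁ w + w 1 ^ 2 * τ₀₁ w);
      0, w 0 ^ 2 * θ₁ w, w 0 ^ 2 * (w 1 * σ₀₁ w + w 1 ^ 2 * τ₀₁ w),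
        w 0 ^ 2 * (Λ w + w 1 * σ₁₁ w + w 1 ^ 2 * τ₁₁ w)])
  (hh : ∀ w, w ∈ W → h w =
    !![0, 0, 0, 0; 0, 0, 0, 0;
      0, 0, w 0 * (P w + w 1 * k₀₀ w), w 0 * (Q w + w 1 * k₀₁ w);
      0, 0, w 0 * (Q w + w 1 * k₁₀ w),
        w 0 * (-P w + w 1 * k₁₁ w)])

include hG in
theorem slice_det {v : Fin 4 → ℝ} (h1 : v 1 = 0) (hv : v ∈ W) :
    (G v).det = -(v 0 ^ 3 * Λ v) ^ 2 := by
  rw [hG v hv, h1]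
  simp [Matrix.det_succ_row_zero, Fin.sum_univ_succ, Fin.succAbove]
  ring

include hΛ hG in
-- The row of ρ has a single nonzero entry, so at ρ = 0 the ρ-component of a gradient involves the
-- α-derivative only; in particular g^{ρρ} = 0.
theorem slice_inv {v : Fin 4 → ℝ} (h0 : 0 < v 0) (h1 : v 1 = 0) (hv : v ∈ W) :
    (G v)⁻¹ = !![(θ₀ v ^ 2 + θ₁ v ^ 2) / Λ v, -1 / v 0,
        θ₀ v / (v 0 * Λ v), θ₁ v / (v 0 * Λ v);
      -1 / v 0, 0, 0, 0;
      θ₀ v / (v 0 * Λ v), 0, 1 / (v 0 ^ 2 * Λ v), 0;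
      θ₁ v / (v 0 * Λ v), 0, 0, 1 / (v 0 ^ 2 * Λ v)] := by
  have h2 := (hΛ _ hv).ne'
  have h3 := h0.ne'
  apply Matrix.inv_eq_right_inv
  rw [hG v hv, h1]
  ext i j
  fin_cases i <;> fin_cases j <;>
    simp [Matrix.mul_apply, Fin.sum_univ_four] <;> field_simp <;> ring

include sθ₀ sθ₁ sΛ sσ₀₀ sσ₀₁ sσ₁₁ sτ₀₀ sτ₀₁ sτ₁₁ hG in
theorem slice_smooth_metric (a b : Fin 4) :
    ContDiffOn ℝ ∞ (fun w => G w a b) W := by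
  have c : ∀ i, ContDiffOn ℝ ∞ (fun w : Fin 4 → ℝ => w i) W :=
    fun i => ContDiff.contDiffOn (by fun_prop)
  have c0 := c 0
  have c1 := c 1
  have t0 := sθ₀.smooth
  have t1 := sθ₁.smooth
  have l := sΛ.smooth
  have s0 := sσ₀₀.smooth
  have s1 := sσ₀₁.smooth
  have s2 := sσ₁₁.smooth
  have r0 := sτ₀₀.smooth
  have r1 := sτ₀₁.smooth
  have r2 := sτ₁₁.smooth
  refine ContDiffOn.congr (f := fun w => (!![-2 * w 1, -w 0, 0, 0;
      -w 0, 0, w 0 ^ 2 * θ₀ w, w 0 ^ 2 * θ₁ w;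
      0, w 0 ^ 2 * θ₀ w,
        w 0 ^ 2 * (Λ w + w 1 * σ₀₀ w + w 1 ^ 2 * τ₀₀ w),
        w 0 ^ 2 * (w 1 * σ₀₁ w + w 1 ^ 2 * τ₀₁ w);
      0, w 0 ^ 2 * θ₁ w, w 0 ^ 2 * (w 1 * σ₀₁ w + w 1 ^ 2 * τ₀₁ w),
        w 0 ^ 2 * (Λ w + w 1 * σ₁₁ w + w 1 ^ 2 * τ₁₁ w)] :
          Matrix (Fin 4) (Fin 4) ℝ) a b) ?_
    (fun w hw => congrFun (congrFun (hG w hw) a) b)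
  fin_cases a <;> fin_cases b <;> simp <;> fun_prop

include sP sQ sk₀₀ sk₀₁ sk₁₀ sk₁₁ hh in
theorem slice_smooth_second (a b : Fin 4) :
    ContDiffOn ℝ ∞ (fun w => h w a b) W := by
  have c : ∀ i, ContDiffOn ℝ ∞ (fun w : Fin 4 → ℝ => w i) W :=
    fun i => ContDiff.contDiffOn (by fun_prop)
  have c0 := c 0
  have c1 := c 1
  have t0 := sP.smooth
  have t1 := sQ.smooth
  have s0 := sk₀₀.smooth
  have s1 := sk₀₁.smooth
  have s2 := sk₁₀.smooth
  have s3 := sk₁₁.smooth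
  refine ContDiffOn.congr (f := fun w => (!![0, 0, 0, 0; 0, 0, 0, 0;
      0, 0, w 0 * (P w + w 1 * k₀₀ w), w 0 * (Q w + w 1 * k₀₁ w);
      0, 0, w 0 * (Q w + w 1 * k₁₀ w),
        w 0 * (-P w + w 1 * k₁₁ w)] : Matrix (Fin 4) (Fin 4) ℝ) a b) ?_
    (fun w hw => congrFun (congrFun (hh w hw) a) b)
  fin_cases a <;> fin_cases b <;> simp <;> fun_prop

include hW sθ₀ sθ₁ sΛ sσ₀₀ sσ₀₁ sσ₁₁ sτ₀₀ sτ₀₁ sτ₁₁ hG in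
theorem slice_pd_metric {v : Fin 4 → ℝ} (h1 : v 1 = 0) (hv : v ∈ W) (a b : Fin 4) :
    pd 1 (fun w => G w a b) v = (!![-2, 0, 0, 0; 0, 0, 0, 0;
      0, 0, v 0 ^ 2 * σ₀₀ v, v 0 ^ 2 * σ₀₁ v;
      0, 0, v 0 ^ 2 * σ₀₁ v, v 0 ^ 2 * σ₁₁ v] : Matrix (Fin 4) (Fin 4) ℝ) a b := by
  have t0 := diffAt hW sθ₀.smooth hv
  have t1 := diffAt hW (sθ₁.smooth) hv
  have l := diffAt hW (sΛ.smooth) hv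
  have s0 := diffAt hW (sσ₀₀.smooth) hv
  have s1 := diffAt hW (sσ₀₁.smooth) hv
  have s2 := diffAt hW (sσ₁₁.smooth) hv
  have r0 := diffAt hW (sτ₀₀.smooth) hv
  have r1 := diffAt hW (sτ₀₁.smooth) hv
  have r2 := diffAt hW (sτ₁₁.smooth) hv
  have z0 := sθ₀.pd_one v hv
  have z1 := sθ₁.pd_one v hv
  have z2 := sΛ.pd_one v hv
  have z3 := sσ₀₀.pd_one v hv
  have z4 := sσ₀₁.pd_one v hv
  have z5 := sσ₁₁.pd_one v hv
  have z6 := sτ₀₀.pd_one v hv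
  have z7 := sτ₀₁.pd_one v hv
  have z8 := sτ₁₁.pd_one v hv
  rw [pd_congr_on hW (fun w hw => congrFun (congrFun (hG w hw) a) b) 1 hv]
  fin_cases a <;> fin_cases b <;>
    simp (disch := fun_prop) [pd_mul, pd_add, pd_pow, pd_neg, pd_coord, z0, z1, z2, z3, z4, z5,
      z6, z7, z8, h1]

include hW sP sQ sk₀₀ sk₀₁ sk₁₀ sk₁₁ hh in
theorem slice_pd_second {v : Fin 4 → ℝ} (h1 : v 1 = 0) (hv : v ∈ W) (a b : Fin 4) :
    pd 1 (fun w => h w a b) v = (!![0, 0, 0, 0; 0, 0, 0, 0;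
      0, 0, v 0 * k₀₀ v, v 0 * k₀₁ v;
      0, 0, v 0 * k₁₀ v, v 0 * k₁₁ v] : Matrix (Fin 4) (Fin 4) ℝ) a b := by
  have t0 := diffAt hW (sP.smooth) hv
  have t1 := diffAt hW (sQ.smooth) hv
  have s0 := diffAt hW (sk₀₀.smooth) hv
  have s1 := diffAt hW (sk₀₁.smooth) hv
  have s2 := diffAt hW (sk₁₀.smooth) hv
  have s3 := diffAt hW (sk₁₁.smooth) hv
  have z0 := sP.pd_one v hv
  have z1 := sQ.pd_one v hv
  have z2 := sk₀₀.pd_one v hv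
  have z3 := sk₀₁.pd_one v hv
  have z4 := sk₁₀.pd_one v hv
  have z5 := sk₁₁.pd_one v hv
  rw [pd_congr_on hW (fun w hw => congrFun (congrFun (hh w hw) a) b) 1 hv]
  fin_cases a <;> fin_cases b <;>
    simp (disch := fun_prop) [pd_mul, pd_add, pd_neg, pd_coord, z0, z1, z2, z3, z4, z5, h1]

end Slice

namespace IsLift

variable {W : Set (Fin 4 → ℝ)} {f g : (Fin 4 → ℝ) → ℝ}

theorem const (c : ℝ) : IsLift W fun _ => c := ⟨contDiffOn_const, by simp, by simp⟩

variable (hW : IsOpen W) (hf : IsLift W f) (hg : IsLift W g)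
include hW hf hg

theorem add : IsLift W fun w => f w + g w where
  smooth := hf.smooth.add hg.smooth
  pd_zero v hv := by
    rw [pd_add _ (diffAt hW hf.smooth hv) (diffAt hW hg.smooth hv), hf.pd_zero v hv,
      hg.pd_zero v hv, add_zero]
  pd_one v hv := by
    rw [pd_add _ (diffAt hW hf.smooth hv) (diffAt hW hg.smooth hv), hf.pd_one v hv,
      hg.pd_one v hv, add_zero]

theorem mul : IsLift W fun w => f w * g w where
  smooth := hf.smooth.mul hg.smooth
  pd_zero v hv := by
    rw [pd_mul _ (diffAt hW hf.smooth hv) (diffAt hW hg.smooth hv), hf.pd_zero v hv,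
      hg.pd_zero v hv]; simp
  pd_one v hv := by
    rw [pd_mul _ (diffAt hW hf.smooth hv) (diffAt hW hg.smooth hv), hf.pd_one v hv,
      hg.pd_one v hv]; simp

end IsLift

/-! ### Mean curvature and Laplacian on the slice ρ = 0. -/

section SliceLaplace

variable {W : Set (Fin 4 → ℝ)} (hW : IsOpen W) {G h : TensorField 4}
  {θ₀ θ₁ Λ P Q σ₀₀ σ₀₁ σ₁₁ k₀₀ k₀₁ k₁₀ k₁₁ : (Fin 4 → ℝ) → ℝ}
  (hΛ : ∀ v ∈ W, 0 < Λ v)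
  (hpos : ∀ v ∈ W, 0 < v 0)
  (sG : ∀ a b, ContDiffOn ℝ ∞ (fun w => G w a b) W)
  (sh : ∀ a b, ContDiffOn ℝ ∞ (fun w => h w a b) W)
  (hd : ∀ w ∈ W, (G w).det ≠ 0)
  (hdet : ∀ v ∈ W, v 1 = 0 → (G v).det = -(v 0 ^ 3 * Λ v) ^ 2)
  (hinv : ∀ v ∈ W, v 1 = 0 → (G v)⁻¹ = !![(θ₀ v ^ 2 + θ₁ v ^ 2) / Λ v, -1 / v 0,
        θ₀ v / (v 0 * Λ v), θ₁ v / (v 0 * Λ v);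
      -1 / v 0, 0, 0, 0;
      θ₀ v / (v 0 * Λ v), 0, 1 / (v 0 ^ 2 * Λ v), 0;
      θ₁ v / (v 0 * Λ v), 0, 0, 1 / (v 0 ^ 2 * Λ v)])
  (hh : ∀ v ∈ W, v 1 = 0 → h v = !![0, 0, 0, 0; 0, 0, 0, 0;
      0, 0, v 0 * P v, v 0 * Q v; 0, 0, v 0 * Q v, -(v 0 * P v)])
  (dG : ∀ v ∈ W, v 1 = 0 → ∀ a b, pd 1 (fun w => G w a b) v =
      (!![-2, 0, 0, 0; 0, 0, 0, 0;
      0, 0, v 0 ^ 2 * σ₀₀ v, v 0 ^ 2 * σ₀₁ v;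
      0, 0, v 0 ^ 2 * σ₀₁ v, v 0 ^ 2 * σ₁₁ v] : Matrix (Fin 4) (Fin 4) ℝ) a b)
  (dh : ∀ v ∈ W, v 1 = 0 → ∀ a b, pd 1 (fun w => h w a b) v =
      (!![0, 0, 0, 0; 0, 0, 0, 0; 0, 0, v 0 * k₀₀ v, v 0 * k₀₁ v;
      0, 0, v 0 * k₁₀ v, v 0 * k₁₁ v] : Matrix (Fin 4) (Fin 4) ℝ) a b)

include sG sh hd in
theorem smooth_traceForm : ContDiffOn ℝ ∞ (traceForm G h) W :=
  ContDiffOn.sum fun a _ => ContDiffOn.sum fun b _ => (smooth_inv sG hd a b).mul (sh a b)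

include hinv hh in
-- At ρ = 0 the second fundamental form is traceless in the u-block, where the inverse metric is a
-- multiple of the identity.
theorem slice_traceForm {v : Fin 4 → ℝ} (hv : v ∈ W) (h1 : v 1 = 0) : traceForm G h v = 0 := by
  simp [traceForm, hinv v hv h1, hh v hv h1, Fin.sum_univ_four]

include hW hΛ hpos sG sh hd hinv hh dG dh in
-- The derivative of the inverse metric is −g⁻¹ (∂g) g⁻¹. The entry −2 of ∂_ρ g in the α-direction,
-- met through g^{iα} = θ_i/(αΛ), is what corrects σ_ij to σ_ij − 2θ_iθ_j.
theorem slice_pd_traceForm {v : Fin 4 → ℝ} (hv : v ∈ W) (h1 : v 1 = 0) :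
    pd 1 (traceForm G h) v = ((k₀₀ v + k₁₁ v) / Λ v - ((σ₀₀ v - 2 * θ₀ v ^ 2) * P v
      + 2 * (σ₀₁ v - 2 * θ₀ v * θ₁ v) * Q v - (σ₁₁ v - 2 * θ₁ v ^ 2) * P v) / Λ v ^ 2) / v 0 := by
  have d1 := fun a b => diffAt hW (smooth_inv sG hd a b) hv
  have d2 := fun a b => diffAt hW (sh a b) hv
  have h2 := (hΛ v hv).ne'
  have h3 := (hpos v hv).ne'
  change pd 1 (fun w => ∑ a, ∑ b, (G w)⁻¹ a b * h w a b) v = _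
  rw [pd_sum _ 1 fun a _ => DifferentiableAt.fun_sum fun b _ => (d1 a b).fun_mul (d2 a b)]
  simp only [fun a => pd_sum Finset.univ 1 fun b _ => (d1 a b).fun_mul (d2 a b),
    fun a b => pd_mul 1 (d1 a b) (d2 a b), pd_inv_matrix hW sG hd hv, dG v hv h1, dh v hv h1,
    hh v hv h1, hinv v hv h1]
  simp [Fin.sum_univ_four]
  field_simp
  ring

include hW hΛ hpos sG hd hdet hinv dG in
-- With √|det| = α³Λ, the α-term of the divergence is ∂_α(−αΛΦ) = −ΛΦ. The ρ-term is 3ΛΦ: one part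
-- comes from g^{ρα} ∂_ρ∂_αK with ∂_αK_ρ = −Φ/α², two parts from ∂_ρ g^{ρρ} = 2/α². The u-terms
-- vanish, and (3 − 1)ΛΦ/(α³Λ) remains.
theorem slice_laplace {K Φ : (Fin 4 → ℝ) → ℝ} (sK : ContDiffOn ℝ ∞ K W) (lΦ : IsLift W Φ)
    (lΛ : IsLift W Λ) (hK : ∀ v ∈ W, v 1 = 0 → K v = 0)
    (dK : ∀ v ∈ W, v 1 = 0 → pd 1 K v = Φ v / v 0) {v : Fin 4 → ℝ} (hv : v ∈ W) (h1 : v 1 = 0) :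
    laplace G K v = 2 * (v 0 ^ 3)⁻¹ * Φ v := by
  have h2 := (hΛ v hv).ne'
  have h3 := (hpos v hv).ne'
  have sinv := smooth_inv sG hd
  have spd := fun c => smooth_pd hW sK c
  have dinv := fun a b => diffAt hW (sinv a b) hv
  have dpd := fun c => diffAt hW (spd c) hv
  have hK' : ∀ c, c ≠ 1 → ∀ w ∈ W, w 1 = 0 → pd c K w = 0 := fun c hc w hw hw1 => by
    rw [pd_eq_of_slice hW (φ := fun _ => 0) (fun w hw _ h => hK w hw h) hw (hpos w hw) hw1
      (diffAt hW sK hw) (by fun_prop) hc, pd_const]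
  have sdet : ContDiffOn ℝ ∞ (fun w => √|(G w).det|) W := by
    have : ContDiffOn ℝ ∞ (fun w => |(G w).det|) W := (smooth_det sG).abs hd
    exact this.sqrt fun w hw => abs_ne_zero.2 (hd w hw)
  have vdet : ∀ w ∈ W, w 1 = 0 → √|(G w).det| = w 0 ^ 3 * Λ w := fun w hw hw1 => by
    have := hΛ w hw
    have := hpos w hw
    rw [hdet w hw hw1, abs_neg, abs_of_nonneg (by positivity), Real.sqrt_sq (by positivity)]
  have sR : ∀ a, ContDiffOn ℝ ∞ (fun w => ∑ b, (G w)⁻¹ a b * pd b K w) W := fun a =>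
    ContDiffOn.sum fun b _ => (sinv a b).mul (spd b)
  have vR : ∀ a, ∀ w ∈ W, w 1 = 0 →
      ∑ b, (G w)⁻¹ a b * pd b K w = (G w)⁻¹ a 1 * (Φ w / w 0) := fun a w hw hw1 => by
    rw [Fin.sum_univ_four, hK' 0 (by decide) w hw hw1, hK' 2 (by decide) w hw hw1,
      hK' 3 (by decide) w hw hw1, dK w hw hw1]
    ring
  have dΦ := diffAt hW lΦ.smooth hv
  have dΛ := diffAt hW lΛ.smooth hv
  have dJ := fun a => diffAt hW (sdet.mul (sR a)) hv
  have j0 : pd 0 (fun w => √|(G w).det| * ∑ b, (G w)⁻¹ 0 b * pd b K w) v = -Λ v * Φ v := by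
    rw [pd_eq_of_slice hW (φ := fun w => -(w 0 * (Λ w * Φ w))) (fun w hw _ hw1 => ?_) hv
      (hpos v hv) h1 (dJ 0) (by fun_prop) (by decide), pd_neg, pd_mul 0 (by fun_prop)
      (by fun_prop), pd_mul 0 dΛ dΦ, lΦ.pd_zero v hv, lΛ.pd_zero v hv, pd_coord]
    · simp
    · have := (hpos w hw).ne'
      rw [vR 0 w hw hw1, vdet w hw hw1, hinv w hw hw1]
      simp
      field_simp
  have j2 : ∀ a, a ≠ 0 → a ≠ 1 →
      pd a (fun w => √|(G w).det| * ∑ b, (G w)⁻¹ a b * pd b K w) v = 0 := fun a ha ha1 => by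
    rw [pd_eq_of_slice hW (φ := fun w => 0) (fun w hw _ hw1 => ?_) hv
      (hpos v hv) h1 (dJ a) (by fun_prop) ha1, pd_const]
    rw [vR a w hw hw1, hinv w hw hw1]
    fin_cases a <;> simp at ha ha1 ⊢
  have hmix : pd 1 (pd 0 K) v = -Φ v / v 0 ^ 2 := by
    rw [pd_comm hW sK 1 0 hv, pd_eq_of_slice hW (φ := fun w => Φ w / w 0)
      (fun w hw _ hw1 => dK w hw hw1) hv (hpos v hv) h1 (dpd 1)
      (diffAt_div dΦ (by fun_prop) h3) (by decide),
      pd_div 0 dΦ (by fun_prop) h3, lΦ.pd_zero v hv, pd_coord]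
    simp
  have dii : pd 1 (fun w => (G w)⁻¹ 1 1) v = 2 / v 0 ^ 2 := by
    rw [pd_inv_matrix hW sG hd hv]
    simp only [dG v hv h1, hinv v hv h1]
    simp [Fin.sum_univ_four]
    field_simp
  have j1 : pd 1 (fun w => √|(G w).det| * ∑ b, (G w)⁻¹ 1 b * pd b K w) v = 3 * Λ v * Φ v := by
    have dsum : DifferentiableAt ℝ (fun w => ∑ b, (G w)⁻¹ 1 b * pd b K w) v :=
      diffAt hW (sR 1) hv
    -- The ρ-derivative of the volume factor is not needed, since the sum that it multiplies
    -- vanishes on the slice.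
    rw [pd_mul 1 (diffAt hW sdet hv) dsum, vR 1 v hv h1,
      pd_sum _ 1 fun b _ => (dinv 1 b).fun_mul (dpd b)]
    simp only [fun b => pd_mul 1 (dinv 1 b) (dpd b), Fin.sum_univ_four, hmix, dii,
      hK' 0 (by decide) v hv h1, hK' 2 (by decide) v hv h1, hK' 3 (by decide) v hv h1,
      dK v hv h1, hinv v hv h1, vdet v hv h1]
    simp
    field_simp
    ring
  rw [laplace, divergence, Fin.sum_univ_four, j0, j1, j2 2 (by decide) (by decide),
    j2 3 (by decide) (by decide), vdet v hv h1]
  field_simp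
  ring

end SliceLaplace

/-! ### Minkowski spacetime -/

theorem lor_comm (p q : Mink) : lor p q = lor q p := by
  simp only [lor, real_inner_comm, mul_comm]

theorem lor_add_left (p q r : Mink) : lor (p + q) r = lor p r + lor q r := by
  simp only [lor, Prod.fst_add, Prod.snd_add, inner_add_left]; ring

theorem lor_add_right (p q r : Mink) : lor p (q + r) = lor p q + lor p r := by
  simp only [lor, Prod.fst_add, Prod.snd_add, inner_add_right]; ring

theorem lor_smul_left (c : ℝ) (p q : Mink) : lor (c • p) q = c * lor p q := by
  simp only [lor, Prod.smul_fst, Prod.smul_snd, inner_smul_left, smul_eq_mul, RCLike.conj_to_real]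
  ring

theorem lor_smul_right (c : ℝ) (p q : Mink) : lor p (c • q) = c * lor p q := by
  rw [lor_comm, lor_smul_left, lor_comm]

theorem lor_zero_right (p : Mink) : lor p 0 = 0 := by simp [lor]

section

variable {k : ℕ} {v : Fin k → ℝ}

theorem pd_prod {f : (Fin k → ℝ) → ℝ} {g : (Fin k → ℝ) → E4} (i : Fin k)
    (hf : DifferentiableAt ℝ f v) (hg : DifferentiableAt ℝ g v) :
    pd i (fun w => ((f w, g w) : Mink)) v = (pd i f v, pd i g v) := by
  simp [pd, hf.fderiv_prodMk hg]

theorem pd_fst {F : (Fin k → ℝ) → Mink} (i : Fin k) (hF : DifferentiableAt ℝ F v) :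
    pd i (fun w => (F w).1) v = (pd i F v).1 := by
  simp [pd, fderiv.fst hF]

theorem pd_snd {F : (Fin k → ℝ) → Mink} (i : Fin k) (hF : DifferentiableAt ℝ F v) :
    pd i (fun w => (F w).2) v = (pd i F v).2 := by
  simp [pd, fderiv.snd hF]

theorem pd_lor {F K : (Fin k → ℝ) → Mink} (i : Fin k) (hF : DifferentiableAt ℝ F v)
    (hK : DifferentiableAt ℝ K v) :
    pd i (fun w => lor (F w) (K w)) v = lor (pd i F v) (K v) + lor (F v) (pd i K v) := by
  have h1 : DifferentiableAt ℝ (fun w => (inner ℝ (F w).2 (K w).2 : ℝ)) v := hF.snd.inner ℝ hK.snd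
  simp only [lor]
  rw [pd_add i (by fun_prop) h1, pd_neg, pd_mul i (by fun_prop) (by fun_prop),
    pd_inner i (by fun_prop) (by fun_prop), pd_fst i hF, pd_fst i hK, pd_snd i hF, pd_snd i hK]
  ring

theorem smooth_lor {W : Set (Fin k → ℝ)} {F K : (Fin k → ℝ) → Mink} (hF : ContDiffOn ℝ ∞ F W)
    (hK : ContDiffOn ℝ ∞ K W) : ContDiffOn ℝ ∞ (fun w => lor (F w) (K w)) W :=
  (hF.fst.mul hK.fst).neg.add (hF.snd.inner ℝ hK.snd)

theorem pd_lor_of_eq {W : Set (Fin k → ℝ)} (hW : IsOpen W) {F K : (Fin k → ℝ) → Mink}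
    {φ : (Fin k → ℝ) → ℝ} (hF : ContDiffOn ℝ ∞ F W) (hK : ContDiffOn ℝ ∞ K W)
    (h : ∀ w ∈ W, lor (F w) (K w) = φ w) (i : Fin k) (hv : v ∈ W) :
    lor (pd i F v) (K v) + lor (F v) (pd i K v) = pd i φ v := by
  rw [← pd_lor i (diffAt hW hF hv) (diffAt hW hK hv)]
  exact pd_congr_on hW h i hv

end

/-! ### The conformal Gauss map and the null lift. -/

/-- The matrix of the traceless second fundamental form. -/
def hopf (X n : (Fin 2 → ℝ) → E4) (i k : Fin 2) (u : Fin 2 → ℝ) : ℝ :=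
  ![![hopfP X n u, hopfQ X n u], ![hopfQ X n u, -hopfP X n u]] i k

namespace IsothermalSurface

variable {X n : (Fin 2 → ℝ) → E4} {U : Set (Fin 2 → ℝ)} (S : IsothermalSurface X n U)
  {u : Fin 2 → ℝ}

include S

theorem smooth_gaussMap : ContDiffOn ℝ ∞ (gaussMap X n) U :=
  (S.smooth_mean.smul (contDiffOn_const.prodMk S.smoothX)).add
    (contDiffOn_const.prodMk S.smoothN)

section

variable (hu : u ∈ U)
include hu

/-- In Weingarten's formula the trace part of the second fundamental form contributes −H X_i, which
cancels the derivative of X in H (1, X). Only the traceless part is left. -/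
theorem pd_gaussMap (i : Fin 2) : pd i (gaussMap X n) u = (pd i (meanCurv X n) u,
    pd i (meanCurv X n) u • X u - (1 / conf X u) •
      (hopf X n i 0 u • pd 0 X u + hopf X n i 1 u • pd 1 X u)) := by
  have h1 := diffAt S.isOpen S.smooth_mean hu
  have h2 := diffAt S.isOpen S.smoothX hu
  have h3 := diffAt S.isOpen S.smoothN hu
  have hc := (S.conf_pos hu).ne'
  have h4 : gaussMap X n = fun w =>
      ((meanCurv X n w, meanCurv X n w • X w + n w) : Mink) := by
    ext w <;> simp [gaussMap]
  rw [h4, pd_prod i h1 (by fun_prop), pd_add i (by fun_prop) h3, pd_smul i h1 h2,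
    S.weingarten hu]
  congr 1
  rw [add_assoc, sub_eq_add_neg]
  congr 1
  fin_cases i <;> simp [hopf, S.sff_00 hu, S.sff_11 hu, S.sff_10 hu, sff_01] <;>
    match_scalars <;> field_simp <;> ring

theorem lor_pd_gaussMap (p : Mink) (i : Fin 2) : lor p (pd i (gaussMap X n) u) =
    pd i (meanCurv X n) u * lor p (1, X u) - (hopf X n i 0 u * inner ℝ p.2 (pd 0 X u)
      + hopf X n i 1 u * inner ℝ p.2 (pd 1 X u)) / conf X u := by
  rw [S.pd_gaussMap hu]
  simp only [lor, inner_sub_right, inner_smul_right, inner_add_right]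
  ring

omit S hu in
theorem lor_gaussMap (p : Mink) : lor p (gaussMap X n u) =
    meanCurv X n u * lor p (1, X u) + inner ℝ p.2 (n u) := by
  simp only [gaussMap, lor_add_right, lor_smul_right]
  simp [lor]

theorem lor_gaussMap_self : lor (gaussMap X n u) (gaussMap X n u) = 1 := by
  rw [lor_gaussMap]
  simp [gaussMap, lor, inner_add_left, inner_smul_left, S.inner_XX hu, S.inner_nn hu,
    S.inner_nX hu, real_inner_comm (n u) (X u), -inner_self_eq_norm_sq_to_K]

end

variable {lam : E4 → ℝ} (hlam : IsConformalFactor lam)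
include hlam

theorem smooth_lift : ContDiffOn ℝ ∞ (lift lam X) U :=
  (S.smooth_lam hlam).smul (contDiffOn_const.prodMk S.smoothX)

variable (hu : u ∈ U)
include hu

theorem pd_lift (i : Fin 2) : pd i (lift lam X) u =
    pd i (fun u => lam (X u)) u • ((1, X u) : Mink) + lam (X u) • ((0, pd i X u) : Mink) := by
  have h1 := diffAt S.isOpen (S.smooth_lam hlam) hu
  have h2 := diffAt S.isOpen S.smoothX hu
  change pd i (fun w => lam (X w) • ((1, X w) : Mink)) u = _
  rw [pd_smul i h1 (by fun_prop), pd_prod i (by fun_prop) h2, pd_const]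

theorem lor_pd_lift (p : Mink) (i : Fin 2) : lor p (pd i (lift lam X) u) =
    pd i (fun u => lam (X u)) u * lor p (1, X u) + lam (X u) * inner ℝ p.2 (pd i X u) := by
  rw [S.pd_lift hlam hu, lor_add_right, lor_smul_right, lor_smul_right]
  simp [lor]

omit S hlam hu in
theorem lor_lift (p : Mink) : lor p (lift lam X u) = lam (X u) * lor p (1, X u) := by
  rw [lift, lor_smul_right]

omit hlam in
theorem lor_one_self : lor (1, X u) (1, X u) = 0 := by
  simp [lor, S.inner_XX hu, -inner_self_eq_norm_sq_to_K]

omit hlam in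
theorem lor_pd_gaussMap_one (i : Fin 2) : lor (pd i (gaussMap X n) u) (1, X u) = 0 := by
  rw [lor_comm, S.lor_pd_gaussMap hu, S.lor_one_self hu]
  simp [S.inner_X_pdX hu]

omit hlam in
theorem lor_gaussMap_one : lor (gaussMap X n u) (1, X u) = 0 := by
  rw [lor_comm, lor_gaussMap, S.lor_one_self hu]
  simp [real_inner_comm (n u) (X u), S.inner_nX hu]

omit hlam in
theorem lor_lift_lift : lor (lift lam X u) (lift lam X u) = 0 := by
  rw [lor_lift, lift, lor_smul_left, S.lor_one_self hu]; simp

theorem lor_lift_pd_lift (i : Fin 2) : lor (lift lam X u) (pd i (lift lam X) u) = 0 := by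
  rw [S.lor_pd_lift hlam hu, lift, lor_smul_left, S.lor_one_self hu]
  simp [inner_smul_left, S.inner_X_pdX hu]

theorem lor_pd_lift_pd_lift (i j : Fin 2) : lor (pd i (lift lam X) u) (pd j (lift lam X) u) =
    if i = j then lam (X u) ^ 2 * conf X u else 0 := by
  rw [S.lor_pd_lift hlam hu, lor_comm, S.lor_pd_lift hlam hu, S.lor_one_self hu,
    S.pd_lift hlam hu]
  simp [inner_smul_left, inner_add_left, S.inner_X_pdX hu, S.inner_pdX hu,
    -inner_self_eq_norm_sq_to_K]
  split_ifs <;> ring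

theorem lor_pd_lift_pd_gaussMap (i j : Fin 2) :
    lor (pd i (lift lam X) u) (pd j (gaussMap X n) u) = -(lam (X u) * hopf X n j i u) := by
  have := (S.conf_pos hu).ne'
  rw [lor_comm, S.lor_pd_lift hlam hu, S.lor_pd_gaussMap_one hu, S.pd_gaussMap hu]
  simp [inner_sub_left, inner_smul_left, inner_add_left, S.inner_X_pdX hu, S.inner_pdX hu,
    -inner_self_eq_norm_sq_to_K]
  fin_cases i <;> simp <;> field_simp <;> simp

end IsothermalSurface

/-! ### The dual null vector: existence, smoothness, uniqueness. -/

/-- The coefficients of the dual vector along the coordinate fields. -/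
def dualCoeff (X n : (Fin 2 → ℝ) → E4) (k : Fin 2) (u : Fin 2 → ℝ) : ℝ :=
  -(hopf X n k 0 u * pd 0 (meanCurv X n) u + hopf X n k 1 u * pd 1 (meanCurv X n) u)
    / (hopfP X n u ^ 2 + hopfQ X n u ^ 2)

/-- The coefficient of the dual vector along the null lift. -/
def dualNull (X n : (Fin 2 → ℝ) → E4) (u : Fin 2 → ℝ) : ℝ :=
  (meanCurv X n u ^ 2 + conf X u * (dualCoeff X n 0 u ^ 2 + dualCoeff X n 1 u ^ 2)) / 2

/-- The dual null vector. -/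
def dualVec (lam : E4 → ℝ) (X n : (Fin 2 → ℝ) → E4) (u : Fin 2 → ℝ) : Mink :=
  (lam (X u))⁻¹ • ((1 / 2 + dualNull X n u, (dualNull X n u - 1 / 2) • X u
    + meanCurv X n u • n u + dualCoeff X n 0 u • pd 0 X u + dualCoeff X n 1 u • pd 1 X u) : Mink)

namespace IsothermalSurface

variable {X n : (Fin 2 → ℝ) → E4} {U : Set (Fin 2 → ℝ)} (S : IsothermalSurface X n U)
  {u : Fin 2 → ℝ} {lam : E4 → ℝ} (hlam : IsConformalFactor lam)

include S

theorem hopf_ne_zero (hf : UmbilicFree X n U) (hu : u ∈ U) :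
    hopfP X n u ^ 2 + hopfQ X n u ^ 2 ≠ 0 := by
  intro h0
  have hp : hopfP X n u = 0 := by nlinarith [sq_nonneg (hopfP X n u), sq_nonneg (hopfQ X n u)]
  have hq : hopfQ X n u = 0 := by nlinarith [sq_nonneg (hopfP X n u), sq_nonneg (hopfQ X n u)]
  apply hf u hu
  rw [S.traceless_eq hu, hp, hq]
  ext i j
  fin_cases i <;> fin_cases j <;> simp

theorem smooth_hopf (i k : Fin 2) : ContDiffOn ℝ ∞ (hopf X n i k) U := by
  fin_cases i <;> fin_cases k
  · exact S.smooth_hopfP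
  · exact S.smooth_hopfQ
  · exact S.smooth_hopfQ
  · exact S.smooth_hopfP.neg

theorem smooth_dualCoeff (hf : UmbilicFree X n U) (k : Fin 2) :
    ContDiffOn ℝ ∞ (dualCoeff X n k) U :=
  (((S.smooth_hopf k 0).mul (smooth_pd S.isOpen S.smooth_mean 0)).add
    ((S.smooth_hopf k 1).mul (smooth_pd S.isOpen S.smooth_mean 1))).neg.div
    ((S.smooth_hopfP.pow 2).add (S.smooth_hopfQ.pow 2)) fun _ hu => S.hopf_ne_zero hf hu

theorem smooth_dualNull (hf : UmbilicFree X n U) : ContDiffOn ℝ ∞ (dualNull X n) U :=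
  ((S.smooth_mean.pow 2).add (S.smooth_conf.mul (((S.smooth_dualCoeff hf 0).pow 2).add
    ((S.smooth_dualCoeff hf 1).pow 2)))).div_const 2

include hlam in
theorem smooth_dualVec (hf : UmbilicFree X n U) : ContDiffOn ℝ ∞ (dualVec lam X n) U :=
  ((S.smooth_lam hlam).inv fun _ hu => (S.lam_pos hlam hu).ne').smul
    ((contDiffOn_const.add (S.smooth_dualNull hf)).prodMk
      ((((((S.smooth_dualNull hf).sub contDiffOn_const).smul S.smoothX).add
        (S.smooth_mean.smul S.smoothN)).add ((S.smooth_dualCoeff hf 0).smul (S.smooth_pdX 0))).add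
        ((S.smooth_dualCoeff hf 1).smul (S.smooth_pdX 1))))

include hlam in
-- In the adapted frame the normalization against y_λ ties the time component to the X-component,
-- and ⟨y*, ξ⟩ = 0 gives the n-component H/λ. The conditions on ξ_i read II°c = −dH for the
-- tangential coefficients c of λy*. They are solved by `dualCoeff` because the square of the matrix
-- of II° is (p² + q²)·1. The value `dualNull` is what nullity demands.
theorem isDual_dualVec (hf : UmbilicFree X n U) : IsDual lam X n U (dualVec lam X n) := by
  intro u hu
  have hl := (S.lam_pos hlam hu).ne'
  have hc := (S.conf_pos hu).ne'
  have hd := S.hopf_ne_zero hf hu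
  have e3 : inner ℝ (X u) (n u) = 0 := by rw [real_inner_comm, S.inner_nX hu]
  have e4 : ∀ i, inner ℝ (pd i X u) (n u) = 0 := fun i => by rw [real_inner_comm, S.inner_n_pdX hu]
  have e5 : ∀ i, inner ℝ (pd i X u) (X u) = 0 := fun i => by rw [real_inner_comm, S.inner_X_pdX hu]
  have h1 : lor (dualVec lam X n u) (1, X u) = -(lam (X u))⁻¹ := by
    simp [dualVec, lor, inner_smul_left, inner_add_left, S.inner_XX hu, S.inner_nX hu, e5,
      -inner_self_eq_norm_sq_to_K]
    ring
  have hi : ∀ i, inner ℝ (dualVec lam X n u).2 (pd i X u)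
      = (lam (X u))⁻¹ * (dualCoeff X n i u * conf X u) := fun i => by
    fin_cases i <;>
      simp [dualVec, inner_smul_left, inner_add_left, S.inner_X_pdX hu, S.inner_n_pdX hu,
        S.inner_pdX hu, -inner_self_eq_norm_sq_to_K]
  refine ⟨?_, ?_, ?_, fun i => ?_⟩
  · rw [lor_lift, h1]; field_simp
  · simp [dualVec, lor, inner_smul_left, inner_add_left, inner_smul_right, inner_add_right,
      S.inner_XX hu, S.inner_nX hu, S.inner_nn hu, S.inner_X_pdX hu, S.inner_n_pdX hu,
      S.inner_pdX hu, e3, e4, e5, -inner_self_eq_norm_sq_to_K]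
    rw [dualNull]
    field_simp
    ring
  · rw [lor_gaussMap, h1]
    simp [dualVec, inner_smul_left, inner_add_left, e3, S.inner_nn hu, e4,
      -inner_self_eq_norm_sq_to_K]
    ring
  · rw [S.lor_pd_gaussMap hu, h1, hi, hi, dualCoeff, dualCoeff]
    fin_cases i <;> simp [hopf] <;> field_simp <;> ring

include hlam in
-- The linear conditions make the difference d of two solutions orthogonal to (1, X), to n and, II°
-- being invertible, to the tangent plane; so d is a multiple of (1, X). Nullity of both solutions
-- then gives ⟨y*, d⟩ = 0, while ⟨y*, (1, X)⟩ ≠ 0.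
theorem isDual_unique (hf : UmbilicFree X n U) {ys ys' : (Fin 2 → ℝ) → Mink}
    (h : IsDual lam X n U ys) (h' : IsDual lam X n U ys') : Set.EqOn ys' ys U := by
  intro u hu
  have hl := (S.lam_pos hlam hu).ne'
  have hc := (S.conf_pos hu).ne'
  have hd := S.hopf_ne_zero hf hu
  obtain ⟨a1, a2, a3, a4⟩ := h u hu
  obtain ⟨b1, b2, b3, b4⟩ := h' u hu
  set d : Mink := ys' u + (-1 : ℝ) • ys u with hdd
  clear_value d
  have c1 : lor d (1, X u) = 0 := by
    have : lam (X u) * lor d (1, X u) = 0 := by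
      rw [← lor_lift, hdd, lor_add_left, lor_smul_left, a1, b1]; ring
    exact (mul_eq_zero.1 this).resolve_left hl
  have c3 : inner ℝ d.2 (n u) = 0 := by
    have : lor d (gaussMap X n u) = 0 := by
      rw [hdd, lor_add_left, lor_smul_left, a3, b3]; ring
    rwa [lor_gaussMap, c1, mul_zero, zero_add] at this
  have c4 : ∀ i, hopf X n i 0 u * inner ℝ d.2 (pd 0 X u)
      + hopf X n i 1 u * inner ℝ d.2 (pd 1 X u) = 0 := fun i => by
    have : lor d (pd i (gaussMap X n) u) = 0 := by
      rw [hdd, lor_add_left, lor_smul_left, a4, b4]; ring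
    rw [S.lor_pd_gaussMap hu, c1, mul_zero, zero_sub, neg_eq_zero, div_eq_zero_iff] at this
    exact this.resolve_right hc
  have c40 := c4 0
  have c41 := c4 1
  simp only [hopf, Matrix.cons_val_zero, Matrix.cons_val_one] at c40 c41
  have c5 : ∀ i, inner ℝ d.2 (pd i X u) = 0 := by
    have z0 : inner ℝ d.2 (pd 0 X u) = 0 := by
      have : (hopfP X n u ^ 2 + hopfQ X n u ^ 2) * inner ℝ d.2 (pd 0 X u) = 0 := by
        linear_combination hopfP X n u * c40 + hopfQ X n u * c41
      exact (mul_eq_zero.1 this).resolve_left hd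
    have z1 : inner ℝ d.2 (pd 1 X u) = 0 := by
      have : (hopfP X n u ^ 2 + hopfQ X n u ^ 2) * inner ℝ d.2 (pd 1 X u) = 0 := by
        linear_combination hopfQ X n u * c40 - hopfP X n u * c41
      exact (mul_eq_zero.1 this).resolve_left hd
    intro i
    fin_cases i
    · exact z0
    · exact z1
  have c6 : d.2 = d.1 • X u := by
    refine S.ext_inner hu ?_ ?_ fun i => ?_
    · rw [inner_smul_right, S.inner_XX hu]
      simp only [lor] at c1
      rw [real_inner_comm]
      linarith
    · rw [inner_smul_right, S.inner_nX hu, real_inner_comm, c3, mul_zero]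
    · rw [inner_smul_right, real_inner_comm (X u), S.inner_X_pdX hu, real_inner_comm, c5, mul_zero]
  have c7 : d = d.1 • ((1, X u) : Mink) := by
    ext1
    · simp
    · simpa using c6
  have c8 : ys' u = ys u + d := by rw [hdd]; module
  have c9 : d.1 = 0 := by
    rw [c8, lor_add_left, lor_add_right, lor_add_right, a2] at b2
    have e1 : lor (ys u) d * lam (X u) = -d.1 := by
      rw [c7, lor_smul_right, mul_assoc, mul_comm _ (lam (X u)), ← lor_lift, a1]; simp
    have e2 : lor d d = 0 := by
      rw [c7, lor_smul_left, lor_smul_right, S.lor_one_self hu]; simp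
    rw [e2, lor_comm d] at b2
    have e3 : lor (ys u) d = 0 := by linarith
    rw [e3] at e1
    linarith
  rw [c8, c7, c9]
  simp

end IsothermalSurface

/-! ### Derivatives of the dual vector and the Willmore expression. -/

namespace IsothermalSurface

variable {X n : (Fin 2 → ℝ) → E4} {U : Set (Fin 2 → ℝ)} (S : IsothermalSurface X n U)
  {u : Fin 2 → ℝ} {lam : E4 → ℝ} (hlam : IsConformalFactor lam)
  {ys : (Fin 2 → ℝ) → Mink} (hy : IsDual lam X n U ys) (sy : ContDiffOn ℝ ∞ ys U)

include S hlam hy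

theorem lor_dual_one (hu : u ∈ U) : lor (ys u) (1, X u) = -(lam (X u))⁻¹ := by
  have h := (hy u hu).1
  have hl := (S.lam_pos hlam hu).ne'
  rw [lor_lift] at h
  field_simp
  linarith

theorem inner_dual_normal (hu : u ∈ U) :
    inner ℝ (ys u).2 (n u) = meanCurv X n u / lam (X u) := by
  have h := (hy u hu).2.2.1
  rw [lor_gaussMap, S.lor_dual_one hlam hy hu] at h
  rw [div_eq_mul_inv]
  linarith

/-- This is ⟨y*, ξ_i⟩ = 0 in coordinates. It expresses dH through II° and the tangential part of y*,
and its derivative is the source of ΔH. -/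
theorem hopf_mul_dual (hu : u ∈ U) (i : Fin 2) : hopf X n i 0 u * inner ℝ (ys u).2 (pd 0 X u)
    + hopf X n i 1 u * inner ℝ (ys u).2 (pd 1 X u)
    = -(conf X u * pd i (meanCurv X n) u / lam (X u)) := by
  have h := (hy u hu).2.2.2 i
  have hc := (S.conf_pos hu).ne'
  have hl := (S.lam_pos hlam hu).ne'
  rw [S.lor_pd_gaussMap hu, S.lor_dual_one hlam hy hu] at h
  field_simp at h ⊢
  linarith

include sy

theorem lor_pd_dual_one (hu : u ∈ U) (i : Fin 2) : lor (pd i ys u) (1, X u)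
    = pd i (fun u => lam (X u)) u / lam (X u) ^ 2 - inner ℝ (ys u).2 (pd i X u) := by
  have hl := (S.lam_pos hlam hu).ne'
  have h := pd_lor_of_eq S.isOpen sy (contDiffOn_const.prodMk S.smoothX)
    (fun w hw => S.lor_dual_one hlam hy hw) i hu
  rw [pd_prod i (by fun_prop) (diffAt S.isOpen S.smoothX hu), pd_const, pd_neg,
    pd_inv i (diffAt S.isOpen (S.smooth_lam hlam) hu) hl] at h
  have h2 : lor (ys u) (0, pd i X u) = inner ℝ (ys u).2 (pd i X u) := by simp [lor]
  rw [h2] at h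
  rw [eq_sub_iff_add_eq, h]
  ring

/-- Differentiate ⟨y*, X_j⟩ and expand the second derivative of X in the adapted frame. -/
theorem inner_pd_dual_pdX (hu : u ∈ U) (i j : Fin 2) : inner ℝ (pd i ys u).2 (pd j X u)
    = pd i (fun w => (inner ℝ (ys w).2 (pd j X w) : ℝ)) u
      - (inner ℝ (X u) (ys u).2 * -(if i = j then conf X u else 0)
        + meanCurv X n u / lam (X u) * sff X n j i u
        + (inner ℝ (ys u).2 (pd 0 X u) * inner ℝ (pd 0 X u) (pd i (pd j X) u)
          + inner ℝ (ys u).2 (pd 1 X u) * inner ℝ (pd 1 X u) (pd i (pd j X) u)) / conf X u) := by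
  have h := inner_pd_of_eq S.isOpen sy.snd (S.smooth_pdX j)
    (φ := fun w => inner ℝ (ys w).2 (pd j X w)) (fun _ _ => rfl) i hu
  rw [pd_snd i (diffAt S.isOpen sy hu)] at h
  rw [← h, S.parseval hu (ys u).2 (pd i (pd j X) u), S.inner_X_pdpdX hu, S.inner_pdpdX_n hu,
    real_inner_comm (ys u).2 (n u), S.inner_dual_normal hlam hy hu,
    real_inner_comm (ys u).2 (pd 0 X u), real_inner_comm (ys u).2 (pd 1 X u)]
  ring

/-- The Willmore expression in terms of the dual vector. -/
theorem dual_identity (hu : u ∈ U) :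
    ((-lor (pd 0 ys u) (pd 0 (gaussMap X n) u)) + -lor (pd 1 ys u) (pd 1 (gaussMap X n) u))
        / (lam (X u) ^ 2 * conf X u)
      - ((2 * lor (pd 0 ys u) (pd 0 (lift lam X) u)
            - 2 * lor (ys u) (pd 0 (lift lam X) u) ^ 2) * (lam (X u) * hopfP X n u)
        + 2 * ((lor (pd 0 ys u) (pd 1 (lift lam X) u) + lor (pd 1 ys u) (pd 0 (lift lam X) u))
            - 2 * lor (ys u) (pd 0 (lift lam X) u) * lor (ys u) (pd 1 (lift lam X) u))
          * (lam (X u) * hopfQ X n u)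
        - (2 * lor (pd 1 ys u) (pd 1 (lift lam X) u)
            - 2 * lor (ys u) (pd 1 (lift lam X) u) ^ 2) * (lam (X u) * hopfP X n u))
        / (lam (X u) ^ 2 * conf X u) ^ 2
      = (lam (X u) ^ 3)⁻¹ * willmoreCurv X n u := by
  have hU := S.isOpen
  have hl := (S.lam_pos hlam hu).ne'
  have hc := (S.conf_pos hu).ne'
  have c0 := S.codazzi0 hu
  have c1 := S.codazzi1 hu
  have sZ : ∀ j, ContDiffOn ℝ ∞ (fun w => (inner ℝ (ys w).2 (pd j X w) : ℝ)) U :=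
    fun j => sy.snd.inner ℝ (S.smooth_pdX j)
  have R := fun (i : Fin 2) w (hw : w ∈ U) => S.hopf_mul_dual hlam hy hw i
  have hD := fun i j => S.inner_pd_dual_pdX hlam hy sy hu i j
  simp only [S.lor_pd_gaussMap hu, S.lor_pd_lift hlam hu, S.lor_dual_one hlam hy hu,
    S.lor_pd_dual_one hlam hy sy hu, S.willmoreCurv_eq hu, hD, S.inner_pdX_pdpdX hu]
  have dp := diffAt hU S.smooth_hopfP hu
  have dq := diffAt hU S.smooth_hopfQ hu
  have de := diffAt hU S.smooth_conf hu
  have df := diffAt hU (S.smooth_lam hlam) hu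
  have dH0 := diffAt hU (smooth_pd hU S.smooth_mean 0) hu
  have dH1 := diffAt hU (smooth_pd hU S.smooth_mean 1) hu
  have dZ0 := diffAt hU (sZ 0) hu
  have dZ1 := diffAt hU (sZ 1) hu
  have R0 := R 0
  have R1 := R 1
  simp only [hopf, Matrix.cons_val_zero, Matrix.cons_val_one] at R0 R1 ⊢
  have r0 := R0 u hu
  have r1 := R1 u hu
  have D0 := pd_congr_on hU R0 0 hu
  have D1 := pd_congr_on hU R1 1 hu
  have deH0 : DifferentiableAt ℝ (fun w => conf X w * pd 0 (meanCurv X n) w) u := de.fun_mul dH0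
  have deH1 : DifferentiableAt ℝ (fun w => conf X w * pd 1 (meanCurv X n) w) u := de.fun_mul dH1
  rw [pd_add 0 (dp.fun_mul dZ0) (dq.fun_mul dZ1), pd_mul 0 dp dZ0, pd_mul 0 dq dZ1, pd_neg,
    pd_div 0 deH0 df hl, pd_mul 0 de dH0] at D0
  have dnp : DifferentiableAt ℝ (fun w => -hopfP X n w) u := dp.fun_neg
  rw [pd_add 1 (dq.fun_mul dZ0) (dnp.fun_mul dZ1), pd_mul 1 dq dZ0, pd_mul 1 dnp dZ1, pd_neg,
    pd_neg, pd_div 1 deH1 df hl, pd_mul 1 de dH1] at D1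
  simp only [S.sff_00 hu, S.sff_11 hu, S.sff_10 hu, sff_01, if_true, Fin.isValue, zero_ne_one,
    one_ne_zero, if_false]
  generalize pd 0 (fun w => (inner ℝ (ys w).2 (pd 0 X w) : ℝ)) u = Z00 at *
  generalize pd 1 (fun w => (inner ℝ (ys w).2 (pd 0 X w) : ℝ)) u = Z01 at *
  generalize pd 0 (fun w => (inner ℝ (ys w).2 (pd 1 X w) : ℝ)) u = Z10 at *
  generalize pd 1 (fun w => (inner ℝ (ys w).2 (pd 1 X w) : ℝ)) u = Z11 at *
  generalize (inner ℝ (ys u).2 (pd 0 X u) : ℝ) = Z0 at *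
  generalize (inner ℝ (ys u).2 (pd 1 X u) : ℝ) = Z1 at *
  generalize (inner ℝ (X u) (ys u).2 : ℝ) = b at *
  generalize pd 0 (pd 0 (meanCurv X n)) u = H00 at *
  generalize pd 1 (pd 1 (meanCurv X n)) u = H11 at *
  generalize pd 0 (meanCurv X n) u = H0 at *
  generalize pd 1 (meanCurv X n) u = H1 at *
  generalize pd 0 (hopfP X n) u = p0 at *
  generalize pd 1 (hopfP X n) u = p1 at *
  generalize pd 0 (hopfQ X n) u = q0 at *
  generalize pd 1 (hopfQ X n) u = q1 at *
  generalize pd 0 (fun u => lam (X u)) u = f0 at *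
  generalize pd 1 (fun u => lam (X u)) u = f1 at *
  generalize pd 0 (conf X) u = e0 at *
  generalize pd 1 (conf X) u = e1 at *
  generalize lam (X u) = f at *
  generalize conf X u = e at *
  generalize hopfP X n u = p at *
  generalize hopfQ X n u = q at *
  generalize meanCurv X n u = H at *
  -- The duality relations eliminate dH and the Codazzi equations eliminate dp; the remaining
  -- quantities are treated as independent variables.
  obtain rfl : H0 = -(p * Z0 + q * Z1) * f / e := by field_simp at r0 ⊢; linarith
  obtain rfl : H1 = -(q * Z0 - p * Z1) * f / e := by field_simp at r1 ⊢; linarith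
  obtain rfl : p0 = e * (-(p * Z0 + q * Z1) * f / e) - q1 := by linarith
  obtain rfl : p1 = q0 - e * (-(q * Z0 - p * Z1) * f / e) := by linarith
  field_simp at D0 D1 ⊢
  -- `D0 + D1` is the divergence of the duality relation, the only place where the second
  -- derivatives of H occur.
  linear_combination (-2 * f ^ 2) * (D0 + D1)

end IsothermalSurface

/-! ### The fundamental forms of the associate surface. -/

namespace IsothermalSurface

variable {X n : (Fin 2 → ℝ) → E4} {U : Set (Fin 2 → ℝ)} (S : IsothermalSurface X n U)
  {u : Fin 2 → ℝ} {lam : E4 → ℝ} (hlam : IsConformalFactor lam)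
  {ys : (Fin 2 → ℝ) → Mink} (hy : IsDual lam X n U ys) (sy : ContDiffOn ℝ ∞ ys U)

include S

theorem pd_normalField {w : Fin 4 → ℝ} (hw : param w ∈ U) (a : Fin 4) :
    pd a (normalField X n) w
      = ![0, 0, pd 0 (gaussMap X n) (param w), pd 1 (gaussMap X n) (param w)] a :=
  pd_param (diffAt S.isOpen S.smooth_gaussMap hw) a

include hlam sy

theorem pd_associate {w : Fin 4 → ℝ} (hw : param w ∈ U) (a : Fin 4) :
    pd a (associate lam X ys) w = ![lift lam X (param w) + w 1 • ys (param w), w 0 • ys (param w),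
      w 0 • pd 0 (lift lam X) (param w) + (w 0 * w 1) • pd 0 ys (param w),
      w 0 • pd 1 (lift lam X) (param w) + (w 0 * w 1) • pd 1 ys (param w)] a := by
  have d1 := diffAt S.isOpen (S.smooth_lift hlam) hw
  have d2 := diffAt S.isOpen sy hw
  have dp := contDiff_param.differentiable (by simp) w
  have e1 : DifferentiableAt ℝ (fun w => lift lam X (param w)) w := d1.fun_comp' w dp
  have e2 : DifferentiableAt ℝ (fun w => ys (param w)) w := d2.fun_comp' w dp
  have c0 : DifferentiableAt ℝ (fun w : Fin 4 → ℝ => w 0) w := by fun_prop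
  have c1 : DifferentiableAt ℝ (fun w : Fin 4 → ℝ => w 1) w := by fun_prop
  change pd a (fun w => w 0 • lift lam X (param w) + (w 0 * w 1) • ys (param w)) w = _
  rw [pd_add a (c0.fun_smul e1) ((c0.fun_mul c1).fun_smul e2), pd_smul a c0 e1,
    pd_smul a (c0.fun_mul c1) e2, pd_mul a c0 c1, pd_coord, pd_coord, pd_param d1, pd_param d2]
  fin_cases a <;> simp

include hy

omit hlam in
theorem lor_dual_pd (hu : u ∈ U) (i : Fin 2) : lor (ys u) (pd i ys u) = 0 := by
  have h := pd_lor_of_eq S.isOpen sy sy (fun w hw => (hy w hw).2.1) i hu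
  rw [pd_const, lor_comm] at h
  linarith

theorem lor_lift_pd_dual (hu : u ∈ U) (i : Fin 2) :
    lor (lift lam X u) (pd i ys u) = -lor (ys u) (pd i (lift lam X) u) := by
  have h := pd_lor_of_eq S.isOpen sy (S.smooth_lift hlam) (fun w hw => (hy w hw).1) i hu
  rw [pd_const, lor_comm] at h
  linarith

omit hlam in
theorem lor_pd_dual_gaussMap (hu : u ∈ U) (i : Fin 2) :
    lor (pd i ys u) (gaussMap X n u) = 0 := by
  have h := pd_lor_of_eq S.isOpen sy S.smooth_gaussMap (fun w hw => (hy w hw).2.2.1) i hu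
  rw [pd_const, (hy u hu).2.2.2 i] at h
  linarith

omit hlam hy sy in
theorem lor_lift_gaussMap (hu : u ∈ U) : lor (lift lam X u) (gaussMap X n u) = 0 := by
  rw [lor_comm, lor_lift, S.lor_gaussMap_one hu, mul_zero]

omit hlam hy sy in
theorem lor_lift_pd_gaussMap (hu : u ∈ U) (i : Fin 2) :
    lor (lift lam X u) (pd i (gaussMap X n) u) = 0 := by
  rw [lor_comm, lor_lift, S.lor_pd_gaussMap_one hu, mul_zero]

omit hy sy in
theorem lor_pd_lift_gaussMap (hu : u ∈ U) (i : Fin 2) :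
    lor (pd i (lift lam X) u) (gaussMap X n u) = 0 := by
  have h := pd_lor_of_eq S.isOpen (S.smooth_lift hlam) S.smooth_gaussMap
    (fun w hw => S.lor_lift_gaussMap (lam := lam) hw) i hu
  rw [pd_const, S.lor_lift_pd_gaussMap (lam := lam) hu] at h
  linarith

theorem lor_associate_normalField {w : Fin 4 → ℝ} (hw : param w ∈ U) (a : Fin 4) :
    lor (pd a (associate lam X ys) w) (normalField X n w) = 0 := by
  change lor _ (gaussMap X n (param w)) = 0
  rw [S.pd_associate hlam sy hw]
  fin_cases a <;>
    simp [lor_add_left, lor_smul_left, S.lor_lift_gaussMap (lam := lam) hw, (hy _ hw).2.2.1,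
      S.lor_pd_lift_gaussMap hlam hw, S.lor_pd_dual_gaussMap hy sy hw]

/-- The entries that vanish do so because y_λ and y* are null and ⟨y_λ, y*⟩ is constant;
differentiating these relations kills the products of α- and u-directions. -/
theorem assocMetric_eq {w : Fin 4 → ℝ} (hw : param w ∈ U) : assocMetric lam X ys w =
    !![-2 * w 1, -w 0, 0, 0;
      -w 0, 0, w 0 ^ 2 * lor (ys (param w)) (pd 0 (lift lam X) (param w)),
        w 0 ^ 2 * lor (ys (param w)) (pd 1 (lift lam X) (param w));
      0, w 0 ^ 2 * lor (ys (param w)) (pd 0 (lift lam X) (param w)),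
        w 0 ^ 2 * (lam (X (param w)) ^ 2 * conf X (param w)
          + w 1 * (2 * lor (pd 0 ys (param w)) (pd 0 (lift lam X) (param w)))
          + w 1 ^ 2 * lor (pd 0 ys (param w)) (pd 0 ys (param w))),
        w 0 ^ 2 * (w 1 * (lor (pd 0 ys (param w)) (pd 1 (lift lam X) (param w))
            + lor (pd 1 ys (param w)) (pd 0 (lift lam X) (param w)))
          + w 1 ^ 2 * lor (pd 0 ys (param w)) (pd 1 ys (param w)));
      0, w 0 ^ 2 * lor (ys (param w)) (pd 1 (lift lam X) (param w)),
        w 0 ^ 2 * (w 1 * (lor (pd 0 ys (param w)) (pd 1 (lift lam X) (param w))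
            + lor (pd 1 ys (param w)) (pd 0 (lift lam X) (param w)))
          + w 1 ^ 2 * lor (pd 0 ys (param w)) (pd 1 ys (param w))),
        w 0 ^ 2 * (lam (X (param w)) ^ 2 * conf X (param w)
          + w 1 * (2 * lor (pd 1 ys (param w)) (pd 1 (lift lam X) (param w)))
          + w 1 ^ 2 * lor (pd 1 ys (param w)) (pd 1 ys (param w)))] := by
  have a1 := (hy _ hw).1
  have a1' := a1
  rw [lor_comm] at a1'
  have a2 := (hy _ hw).2.1
  have a3 := S.lor_dual_pd hy sy hw
  have a3' := fun i => (lor_comm _ _).trans (a3 i)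
  have a4 := S.lor_lift_pd_dual hlam hy sy hw
  have a4' := fun i => (lor_comm _ _).trans (a4 i)
  have a5 := S.lor_lift_lift (lam := lam) hw
  have a6 := S.lor_lift_pd_lift hlam hw
  have a6' := fun i => (lor_comm _ _).trans (a6 i)
  have a7 := S.lor_pd_lift_pd_lift hlam hw
  have a8 := fun i => lor_comm (pd i (lift lam X) (param w)) (ys (param w))
  have a9 := fun i j => lor_comm (pd i (lift lam X) (param w)) (pd j ys (param w))
  have a10 := lor_comm (pd 1 ys (param w)) (pd 0 ys (param w))
  ext i j
  simp only [assocMetric, Matrix.of_apply, S.pd_associate hlam sy hw]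
  fin_cases i <;> fin_cases j <;>
    simp [lor_add_left, lor_add_right, lor_smul_left, lor_smul_right, a1, a1', a2, a3, a3', a4,
      a4', a5, a6, a6', a7, a8, a9, a10] <;> ring

theorem assocSecond_eq {w : Fin 4 → ℝ} (hw : param w ∈ U) : assocSecond lam X n ys w =
    !![0, 0, 0, 0; 0, 0, 0, 0;
      0, 0, w 0 * (lam (X (param w)) * hopfP X n (param w)
          + w 1 * -lor (pd 0 ys (param w)) (pd 0 (gaussMap X n) (param w))),
        w 0 * (lam (X (param w)) * hopfQ X n (param w)
          + w 1 * -lor (pd 0 ys (param w)) (pd 1 (gaussMap X n) (param w)));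
      0, 0, w 0 * (lam (X (param w)) * hopfQ X n (param w)
          + w 1 * -lor (pd 1 ys (param w)) (pd 0 (gaussMap X n) (param w))),
        w 0 * (-(lam (X (param w)) * hopfP X n (param w))
          + w 1 * -lor (pd 1 ys (param w)) (pd 1 (gaussMap X n) (param w)))] := by
  have a1 := (hy _ hw).2.2.2
  have a2 := S.lor_lift_pd_gaussMap (lam := lam) hw
  have a3 := S.lor_pd_lift_pd_gaussMap hlam hw
  ext i j
  simp only [assocSecond, Matrix.of_apply, S.pd_associate hlam sy hw, S.pd_normalField hw]
  fin_cases i <;> fin_cases j <;>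
    simp [lor_add_left, lor_smul_left, lor_zero_right, a1, a2, a3, hopf] <;> ring

theorem det_assocMetric (hu : u ∈ U) {α : ℝ} (hα : 0 < α) :
    (assocMetric lam X ys ![α, 0, u 0, u 1]).det < 0 := by
  have hp : param ![α, 0, u 0, u 1] ∈ U := by rwa [param_vec]
  rw [S.assocMetric_eq hlam hy sy hp]
  have h1 := S.conf_pos hu
  have h2 := S.lam_pos hlam hu
  simp only [param_vec]
  have : 0 < (α ^ 3 * (lam (X u) ^ 2 * conf X u)) ^ 2 := by positivity
  simp [Matrix.det_succ_row_zero, Fin.sum_univ_succ, Fin.succAbove]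
  nlinarith

/-- The Laplacian of the mean curvature of the associate surface at `ρ = 0`. -/
theorem laplace_assocMean (hu : u ∈ U) {α : ℝ} (hα : 0 < α) :
    laplace (assocMetric lam X ys) (assocMean lam X n ys) ![α, 0, u 0, u 1]
      = 2 * (α ^ 3)⁻¹ * scriptH lam X n u := by
  have hU := S.isOpen
  have sl := S.smooth_lam hlam
  have sL := fun i => smooth_pd hU (S.smooth_lift hlam) i
  have sY := fun i => smooth_pd hU sy i
  have sξ := fun i => smooth_pd hU S.smooth_gaussMap i
  have sΛ : ContDiffOn ℝ ∞ (fun u => lam (X u) ^ 2 * conf X u) U := (sl.pow 2).mul S.smooth_conf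
  have lθ := fun i => isLift_param hU (smooth_lor sy (sL i))
  have lΛ := isLift_param hU sΛ
  have lP := isLift_param hU (sl.mul S.smooth_hopfP)
  have lQ := isLift_param hU (sl.mul S.smooth_hopfQ)
  have lσ := fun i j => isLift_param hU (smooth_lor (sY i) (sL j))
  have lτ := fun i j => isLift_param hU (smooth_lor (sY i) (sY j))
  have lk := fun i j => isLift_param hU (smooth_lor (sY i) (sξ j)).neg
  have hO := isOpen_param hU
  have two := IsLift.const (W := param ⁻¹' U) 2
  have lσ₀₀ := two.mul hO (lσ 0 0)
  have lσ₁₁ := two.mul hO (lσ 1 1)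
  have lσ₀₁ := (lσ 0 1).add hO (lσ 1 0)
  have posΛ : ∀ v ∈ param ⁻¹' U, 0 < lam (X (param v)) ^ 2 * conf X (param v) := fun v hv => by
    have := S.conf_pos hv
    have := S.lam_pos hlam hv
    positivity
  have hG := fun w (hw : w ∈ param ⁻¹' U) => S.assocMetric_eq hlam hy sy hw
  have hh := fun w (hw : w ∈ param ⁻¹' U) => S.assocSecond_eq hlam hy sy hw
  have sG := slice_smooth_metric (lθ 0) (lθ 1) lΛ lσ₀₀ lσ₀₁ lσ₁₁ (lτ 0 0) (lτ 0 1) (lτ 1 1) hG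
  have sh := slice_smooth_second lP lQ (lk 0 0) (lk 0 1) (lk 1 0) (lk 1 1) hh
  -- Nondegeneracy is known only at ρ = 0, α > 0. The inverse metric has to be smooth in a full
  -- neighbourhood, hence the restriction to an open set where the determinant does not vanish.
  let W : Set (Fin 4 → ℝ) := (param ⁻¹' U ∩ {w | 0 < w 0}) ∩
    (fun w => (assocMetric lam X ys w).det) ⁻¹' {0}ᶜ
  have hO1 : IsOpen (param ⁻¹' U ∩ {w | 0 < w 0}) :=
    hO.inter (isOpen_lt continuous_const (continuous_apply 0))
  have hW : IsOpen W := ((smooth_det sG).continuousOn.mono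
    Set.inter_subset_left).isOpen_inter_preimage hO1 isOpen_compl_singleton
  have hWU : W ⊆ param ⁻¹' U := fun w hw => hw.1.1
  have hpos : ∀ w ∈ W, 0 < w 0 := fun w hw => hw.1.2
  have hv : ![α, 0, u 0, u 1] ∈ W := by
    refine ⟨⟨?_, hα⟩, (S.det_assocMetric hlam hy sy hu hα).ne⟩
    rwa [Set.mem_preimage, param_vec]
  have lift_mono : ∀ {φ}, IsLift (param ⁻¹' U) φ → IsLift W φ := fun h =>
    ⟨h.smooth.mono hWU, fun v hv => h.pd_zero v (hWU hv), fun v hv => h.pd_one v (hWU hv)⟩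
  have sG' := fun a b => (sG a b).mono hWU
  have sh' := fun a b => (sh a b).mono hWU
  have hd : ∀ w ∈ W, (assocMetric lam X ys w).det ≠ 0 := fun w hw => hw.2
  have hinv := fun v (hv : v ∈ W) (h1 : v 1 = 0) => slice_inv posΛ hG (hpos v hv) h1 (hWU hv)
  have hdet := fun v (hv : v ∈ W) (h1 : v 1 = 0) => slice_det hG h1 (hWU hv)
  have dG := fun v (hv : v ∈ W) (h1 : v 1 = 0) => slice_pd_metric hO (lθ 0) (lθ 1) lΛ lσ₀₀ lσ₀₁
    lσ₁₁ (lτ 0 0) (lτ 0 1) (lτ 1 1) hG h1 (hWU hv)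
  have dh := fun v (hv : v ∈ W) (h1 : v 1 = 0) => slice_pd_second hO lP lQ (lk 0 0) (lk 0 1)
    (lk 1 0) (lk 1 1) hh h1 (hWU hv)
  have hh0 : ∀ v ∈ W, v 1 = 0 → assocSecond lam X n ys v = !![0, 0, 0, 0; 0, 0, 0, 0;
      0, 0, v 0 * (lam (X (param v)) * hopfP X n (param v)),
        v 0 * (lam (X (param v)) * hopfQ X n (param v));
      0, 0, v 0 * (lam (X (param v)) * hopfQ X n (param v)),
        -(v 0 * (lam (X (param v)) * hopfP X n (param v)))] := fun v hv h1 => by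
    rw [hh v (hWU hv), h1]; simp
  have posΛ' := fun v hv => posΛ v (hWU hv)
  -- This function plays the role of Φ in `slice_laplace`; `dual_identity` identifies it with the
  -- ρ-derivative of the mean curvature.
  have sW : ContDiffOn ℝ ∞ (fun u => (lam (X u) ^ 3)⁻¹ * willmoreCurv X n u) U :=
    ((sl.pow 3).inv fun u hu => pow_ne_zero 3 (S.lam_pos hlam hu).ne').mul S.smooth_willmoreCurv
  have key := slice_laplace hW posΛ' hpos sG' hd hdet hinv dG
    (smooth_traceForm sG' sh' hd) (lift_mono (isLift_param hU sW)) (lift_mono lΛ)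
    (fun v hv h1 => slice_traceForm hinv hh0 hv h1)
    (fun v hv h1 => by
      rw [slice_pd_traceForm hW posΛ' hpos sG' sh' hd hinv hh0 dG dh hv h1,
        ← S.dual_identity hlam hy sy (hWU hv)]) hv rfl
  rw [S.scriptH_eq hlam hu]
  simp only [param_vec] at key
  exact key

end IsothermalSurface

/-! ### One-parameter families of maps and integrals -/

section Families

variable {k : ℕ} {V : Type*} [NormedAddCommGroup V] [NormedSpace ℝ V]
  {I : Set ℝ} {U : Set (Fin k → ℝ)} {G : ℝ → (Fin k → ℝ) → V}

/-- The derivative of a family of maps with respect to the parameter. -/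
def vel (G : ℝ → (Fin k → ℝ) → V) (t : ℝ) (u : Fin k → ℝ) : V := deriv (fun s => G s u) t

theorem vel_eq_fderiv {t : ℝ} {u : Fin k → ℝ}
    (h : DifferentiableAt ℝ (fun p : ℝ × (Fin k → ℝ) => G p.1 p.2) (t, u)) :
    HasDerivAt (fun s => G s u)
      (fderiv ℝ (fun p : ℝ × (Fin k → ℝ) => G p.1 p.2) (t, u) (1, 0)) t :=
  HasFDerivAt.comp_hasDerivAt (l := fun p : ℝ × (Fin k → ℝ) => G p.1 p.2) (f := fun s => (s, u))
    t h.hasFDerivAt ((hasDerivAt_id t).prodMk (hasDerivAt_const t u))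

theorem pd_eq_fderiv {t : ℝ} {u : Fin k → ℝ} (i : Fin k)
    (h : DifferentiableAt ℝ (fun p : ℝ × (Fin k → ℝ) => G p.1 p.2) (t, u)) :
    pd i (G t) u
      = fderiv ℝ (fun p : ℝ × (Fin k → ℝ) => G p.1 p.2) (t, u) (0, Pi.single i 1) := by
  have : HasFDerivAt (G t) _ u :=
    h.hasFDerivAt.comp u ((hasFDerivAt_const t u).prodMk (hasFDerivAt_id u))
  simp [pd, this.fderiv]

variable (hI : IsOpen I) (hU : IsOpen U)
  (hG : ContDiffOn ℝ ∞ (fun p : ℝ × (Fin k → ℝ) => G p.1 p.2) (I ×ˢ U))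
include hI hU hG

theorem hasDerivAt_vel {t : ℝ} {u : Fin k → ℝ} (ht : t ∈ I) (hu : u ∈ U) :
    HasDerivAt (fun s => G s u) (vel G t u) t := by
  have := vel_eq_fderiv (diffAt (hI.prod hU) hG (Set.mk_mem_prod ht hu))
  rwa [vel, this.deriv]

theorem family_smooth_vel :
    ContDiffOn ℝ ∞ (fun p : ℝ × (Fin k → ℝ) => vel G p.1 p.2) (I ×ˢ U) :=
  ((hG.fderiv_of_isOpen (m := ∞) (hI.prod hU) (by simp)).clm_apply
    (contDiffOn_const (c := ((1, 0) : ℝ × (Fin k → ℝ))))).congr fun p hp =>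
    (vel_eq_fderiv (diffAt (hI.prod hU) hG hp)).deriv

theorem family_smooth_pd (i : Fin k) :
    ContDiffOn ℝ ∞ (fun p : ℝ × (Fin k → ℝ) => pd i (G p.1) p.2) (I ×ˢ U) :=
  ((hG.fderiv_of_isOpen (m := ∞) (hI.prod hU) (by simp)).clm_apply
    (contDiffOn_const (c := ((0, Pi.single i 1) : ℝ × (Fin k → ℝ))))).congr fun p hp =>
    pd_eq_fderiv i (diffAt (hI.prod hU) hG hp)

omit hI hU in
theorem family_smooth_slice {t : ℝ} (ht : t ∈ I) : ContDiffOn ℝ ∞ (G t) U :=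
  hG.comp (contDiffOn_const.prodMk contDiffOn_id) fun _ hu => Set.mk_mem_prod ht hu

/-- Derivatives with respect to the parameter and the coordinates commute. -/
theorem vel_pd (i : Fin k) {t : ℝ} {u : Fin k → ℝ} (ht : t ∈ I) (hu : u ∈ U) :
    vel (fun s => pd i (G s)) t u = pd i (vel G t) u := by
  have hO := hI.prod hU
  have hp := Set.mk_mem_prod ht hu
  set Φ := fun p : ℝ × (Fin k → ℝ) => G p.1 p.2
  have hd : DifferentiableAt ℝ (fderiv ℝ Φ) (t, u) :=
    diffAt hO (hG.fderiv_of_isOpen (m := ∞) hO (by simp)) hp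
  have key : ∀ (a b : ℝ × (Fin k → ℝ)) (f : ℝ × (Fin k → ℝ) → V),
      (∀ q ∈ I ×ˢ U, f q = fderiv ℝ Φ q b) →
      fderiv ℝ f (t, u) a = fderiv ℝ (fderiv ℝ Φ) (t, u) a b := by
    intro a b f hf
    have he : f =ᶠ[𝓝 (t, u)] fun q => fderiv ℝ Φ q b :=
      Filter.eventually_of_mem (hO.mem_nhds hp) hf
    rw [he.fderiv_eq, fderiv_clm_apply hd (by fun_prop)]
    simp
  have hs : IsSymmSndFDerivAt ℝ Φ (t, u) :=
    (hG.contDiffAt (hO.mem_nhds hp)).isSymmSndFDerivAt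
      (by simpa using (WithTop.coe_le_coe.2 le_top : ((2 : ℕ∞) : WithTop ℕ∞) ≤ ∞))
  have e1 := (vel_eq_fderiv (G := fun s => pd i (G s))
    (diffAt hO (family_smooth_pd hI hU hG i) hp)).deriv
  have e2 := pd_eq_fderiv (G := vel G) i (diffAt hO (family_smooth_vel hI hU hG) hp)
  rw [vel, e1, e2, key _ (0, Pi.single i 1) _ fun q hq => pd_eq_fderiv i (diffAt hO hG hq),
    key _ (1, 0) (fun p => vel G p.1 p.2) fun q hq => (vel_eq_fderiv (diffAt hO hG hq)).deriv]
  exact hs _ _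

/-- Differentiation under the integral over a compact set. -/
theorem hasDerivAt_setIntegral [CompleteSpace V] {K : Set (Fin k → ℝ)} (hK : IsCompact K)
    (hKU : K ⊆ U) {t : ℝ} (ht : t ∈ I) :
    HasDerivAt (fun s => ∫ u in K, G s u) (∫ u in K, vel G t u) t := by
  -- The product of a closed interval inside `I` with `K` is compact, so the velocity is bounded
  -- there by a constant, which dominates on the finite-measure set `K`.
  obtain ⟨r, hr, hrI⟩ := Metric.nhds_basis_closedBall.mem_iff.1 (hI.mem_nhds ht)
  have hcv := (family_smooth_vel hI hU hG).continuousOn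
  obtain ⟨C, hC⟩ := ((isCompact_closedBall t r).prod hK).exists_bound_of_continuousOn
    (hcv.mono (Set.prod_mono hrI hKU))
  have hmeas : ∀ s ∈ I, IntegrableOn (G s) K := fun s hs =>
    ((family_smooth_slice hG hs).continuousOn.mono hKU).integrableOn_compact hK
  have hmv : IntegrableOn (vel G t) K :=
    ((family_smooth_slice (family_smooth_vel hI hU hG) ht).continuousOn.mono
      hKU).integrableOn_compact hK
  refine (hasDerivAt_integral_of_dominated_loc_of_deriv_le (F' := vel G) (bound := fun _ => C)
    (Metric.closedBall_mem_nhds t hr) ?_ (hmeas t ht) hmv.aestronglyMeasurable ?_ ?_ ?_).2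
  · exact Filter.eventually_of_mem (hI.mem_nhds ht) fun s hs => (hmeas s hs).aestronglyMeasurable
  · exact (ae_restrict_iff' hK.measurableSet).2 (.of_forall fun u hu s hs =>
      hC (s, u) (Set.mk_mem_prod hs hu))
  · exact integrableOn_const hK.measure_lt_top.ne
  · exact (ae_restrict_iff' hK.measurableSet).2 (.of_forall fun u hu s hs =>
      hasDerivAt_vel hI hU hG (hrI hs) (hKU hu))

end Families

/-- The integral of a partial derivative of a compactly supported function vanishes. -/
theorem setIntegral_pd_eq_zero {k : ℕ} {U K : Set (Fin k → ℝ)} (hU : IsOpen U)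
    (hK : IsCompact K) (hKU : K ⊆ U) {f : (Fin k → ℝ) → ℝ} (hf : ContDiffOn ℝ ∞ f U)
    (h0 : ∀ u ∈ U \ K, f u = 0) (i : Fin k) : ∫ u in K, pd i f u = 0 := by
  classical
  -- Extension by zero: `g` equals `f` on `U` and 0 on the complement of `K`, two open sets that
  -- cover the space, so it is smooth with compact support.
  set g := K.indicator f
  have hgU : ∀ u ∈ U, g u = f u := fun u hu => by
    by_cases h : u ∈ K
    · exact Set.indicator_of_mem h f
    · rw [h0 u ⟨hu, h⟩]; exact Set.indicator_of_notMem h f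
  have hg0 : ∀ u ∈ Kᶜ, g u = (fun _ => (0 : ℝ)) u := fun u hu => Set.indicator_of_notMem hu f
  have hg : ContDiff ℝ ∞ g := contDiff_iff_contDiffAt.2 fun u => by
    by_cases h : u ∈ K
    · exact (hf.contDiffAt (hU.mem_nhds (hKU h))).congr_of_eventuallyEq
        (Filter.eventually_of_mem (hU.mem_nhds (hKU h)) hgU)
    · exact contDiffAt_const.congr_of_eventuallyEq
        (Filter.eventually_of_mem (hK.isClosed.isOpen_compl.mem_nhds h) hg0)
  have hgc : HasCompactSupport g := HasCompactSupport.intro hK hg0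
  have hpd : K.indicator (pd i f) = pd i g := by
    ext u
    by_cases h : u ∈ K
    · rw [Set.indicator_of_mem h, pd_congr_on hU hgU i (hKU h)]
    · rw [Set.indicator_of_notMem h, pd_congr_on hK.isClosed.isOpen_compl hg0 i h, pd_const]
  rw [← integral_indicator hK.measurableSet, hpd]
  have hcd : Continuous (pd i g) :=
    (hg.continuous_fderiv (by simp)).clm_apply continuous_const
  have hcs : HasCompactSupport (pd i g) := by
    refine HasCompactSupport.intro hK fun u hu => ?_
    rw [← hpd, Set.indicator_of_notMem hu]
  -- Integration by parts against the constant function 1.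
  have := integral_mul_fderiv_eq_neg_fderiv_mul_of_integrable (μ := volume)
    (f := fun _ : Fin k → ℝ => (1 : ℝ)) (g := g) (v := Pi.single i 1) (by simp)
    (by simpa using! hcd.integrable_of_hasCompactSupport hcs)
    (by simpa using hg.continuous.integrable_of_hasCompactSupport hgc)
    (by simp) (fun x _ => hg.differentiable (by simp) x)
  simpa [pd] using this

/-! ### The boundary flux and its divergence. -/

/-- The 1-form whose divergence is the boundary term in the first variation of the Willmore
energy. -/
def flux (X n W : (Fin 2 → ℝ) → E4) (i : Fin 2) (u : Fin 2 → ℝ) : ℝ :=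
  meanCurv X n u * inner ℝ (pd i W u) (n u) - pd i (meanCurv X n) u * inner ℝ (W u) (n u)
    + meanCurv X n u * inner ℝ (W u) (pd i n u)
    + (1 + meanCurv X n u ^ 2) * inner ℝ (W u) (pd i X u)

namespace IsothermalSurface

variable {X n : (Fin 2 → ℝ) → E4} {U : Set (Fin 2 → ℝ)} (S : IsothermalSurface X n U)
  {u : Fin 2 → ℝ}

include S

theorem inner_X_pdpdN (hu : u ∈ U) (i j : Fin 2) :
    (inner ℝ (X u) (pd i (pd j n) u) : ℝ) = sff X n i j u := by
  have := inner_pd_of_eq S.isOpen S.smoothX (S.smooth_pdN j) (φ := fun _ => 0)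
    (fun w hw => S.inner_X_pdN hw j) i hu
  rw [pd_const, inner_pdX_pdN] at this
  linarith

theorem inner_n_pdpdN (hu : u ∈ U) (i j : Fin 2) : (inner ℝ (n u) (pd i (pd j n) u) : ℝ) =
    -((sff X n 0 i u * sff X n 0 j u + sff X n 1 i u * sff X n 1 j u) / conf X u) := by
  have := inner_pd_of_eq S.isOpen S.smoothN (S.smooth_pdN j) (φ := fun _ => 0)
    (fun w hw => S.inner_n_pdN hw j) i hu
  rw [pd_const, S.inner_pdN_pdN hu] at this
  linarith

theorem inner_pdX_pdpdN (hu : u ∈ U) (k i j : Fin 2) :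
    (inner ℝ (pd k X u) (pd i (pd j n) u) : ℝ) =
      -pd i (sff X n k j) u - inner ℝ (pd i (pd k X) u) (pd j n u) := by
  have := inner_pd_of_eq S.isOpen (S.smooth_pdX k) (S.smooth_pdN j)
    (φ := fun w => -sff X n k j w) (fun w _ => inner_pdX_pdN k j) i hu
  rw [pd_neg] at this
  linarith

/-- Tangentially, Δn is minus the divergence of the second fundamental form, which the Codazzi
equations turn into a multiple of dH. -/
theorem inner_pdX_laplN (hu : u ∈ U) (k : Fin 2) :
    (inner ℝ (pd k X u) (pd 0 (pd 0 n) u + pd 1 (pd 1 n) u) : ℝ) =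
      -2 * conf X u * pd k (meanCurv X n) u := by
  have hc := (S.conf_pos hu).ne'
  have c0 := S.codazzi0 hu
  have c1 := S.codazzi1 hu
  rw [inner_add_right, S.inner_pdX_pdpdN hu, S.inner_pdX_pdpdN hu,
    S.parseval hu _ (pd 0 n u), S.parseval hu _ (pd 1 n u)]
  simp only [S.inner_X_pdN hu, S.inner_n_pdN hu, inner_pdX_pdN, S.inner_pdX_pdpdX hu]
  fin_cases k
  · simp only [Fin.zero_eta, S.pd_sff_00 hu, S.sff_00 hu, S.sff_11 hu, S.sff_10 hu, sff_01]
    change _ - _ + (-pd 1 (hopfQ X n) u - _) = _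
    simp
    field_simp
    linear_combination (-2 * conf X u) * c0
  · simp only [Fin.mk_one, S.pd_sff_11 hu, S.sff_00 hu, S.sff_11 hu, S.sff_10 hu, sff_01]
    rw [pd_congr_on S.isOpen (fun w hw => S.sff_10 hw) 0 hu]
    simp
    field_simp
    linear_combination (-2 * conf X u) * c1

theorem inner_laplN (hu : u ∈ U) (w : E4) :
    (inner ℝ w (pd 0 (pd 0 n) u + pd 1 (pd 1 n) u) : ℝ) =
      2 * conf X u * meanCurv X n u * inner ℝ w (X u)
      - (2 * (hopfP X n u ^ 2 + hopfQ X n u ^ 2) / conf X u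
          + 2 * conf X u * meanCurv X n u ^ 2) * inner ℝ w (n u)
      - 2 * (pd 0 (meanCurv X n) u * inner ℝ w (pd 0 X u)
          + pd 1 (meanCurv X n) u * inner ℝ w (pd 1 X u)) := by
  have hc := (S.conf_pos hu).ne'
  rw [S.parseval hu, S.inner_pdX_laplN hu, S.inner_pdX_laplN hu, inner_add_right, inner_add_right,
    S.inner_X_pdpdN hu, S.inner_X_pdpdN hu, S.inner_n_pdpdN hu, S.inner_n_pdpdN hu,
    S.sff_00 hu, S.sff_11 hu, S.sff_10 hu, sff_01, real_inner_comm w, real_inner_comm w,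
    real_inner_comm w, real_inner_comm w]
  field_simp
  ring

/-- In isothermal coordinates the tangential part of ΔX vanishes. -/
theorem inner_laplX (hu : u ∈ U) (w : E4) :
    (inner ℝ w (pd 0 (pd 0 X) u + pd 1 (pd 1 X) u) : ℝ) =
      2 * conf X u * meanCurv X n u * inner ℝ w (n u) - 2 * conf X u * inner ℝ w (X u) := by
  have hc := (S.conf_pos hu).ne'
  rw [S.parseval hu]
  simp only [inner_add_right, S.inner_X_pdpdX hu, S.inner_pdpdX_n hu, S.inner_pdX_pdpdX hu,
    S.sff_00 hu, S.sff_11 hu, real_inner_comm w]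
  simp
  ring

variable {W : (Fin 2 → ℝ) → E4}

theorem smooth_flux (hW : ContDiffOn ℝ ∞ W U) (i : Fin 2) : ContDiffOn ℝ ∞ (flux X n W i) U :=
  (((S.smooth_mean.mul ((smooth_pd S.isOpen hW i).inner ℝ S.smoothN)).sub
    ((smooth_pd S.isOpen S.smooth_mean i).mul (hW.inner ℝ S.smoothN))).add
    (S.smooth_mean.mul (hW.inner ℝ (S.smooth_pdN i)))).add
    ((contDiffOn_const.add (S.smooth_mean.pow 2)).mul (hW.inner ℝ (S.smooth_pdX i)))

theorem pd_flux (hW : ContDiffOn ℝ ∞ W U) (hu : u ∈ U) (i : Fin 2) : pd i (flux X n W i) u =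
    meanCurv X n u * inner ℝ (pd i (pd i W) u) (n u)
    + 2 * meanCurv X n u * inner ℝ (pd i W u) (pd i n u)
    - pd i (pd i (meanCurv X n)) u * inner ℝ (W u) (n u)
    + meanCurv X n u * inner ℝ (W u) (pd i (pd i n) u)
    + 2 * meanCurv X n u * pd i (meanCurv X n) u * inner ℝ (W u) (pd i X u)
    + (1 + meanCurv X n u ^ 2) * (inner ℝ (pd i W u) (pd i X u)
      + inner ℝ (W u) (pd i (pd i X) u)) := by
  have dH := diffAt S.isOpen S.smooth_mean hu
  have dH' := diffAt S.isOpen (smooth_pd S.isOpen S.smooth_mean i) hu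
  have dW := diffAt S.isOpen hW hu
  have dW' := diffAt S.isOpen (smooth_pd S.isOpen hW i) hu
  have dn := diffAt S.isOpen S.smoothN hu
  have dn' := diffAt S.isOpen (S.smooth_pdN i) hu
  have dX' := diffAt S.isOpen (S.smooth_pdX i) hu
  have i1 := dW'.inner ℝ dn
  have i2 := dW.inner ℝ dn
  have i3 := dW.inner ℝ dn'
  have i4 := dW.inner ℝ dX'
  have m1 := dH.fun_mul i1
  have m2 := dH'.fun_mul i2
  have m3 := dH.fun_mul i3
  have k := (differentiableAt_const (1 : ℝ)).fun_add (dH.fun_pow 2)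
  unfold flux
  rw [pd_add i ((m1.fun_sub m2).fun_add m3) (k.fun_mul i4), pd_add i (m1.fun_sub m2) m3,
    pd_sub i m1 m2, pd_mul i dH i1, pd_mul i dH' i2, pd_mul i dH i3, pd_mul i k i4,
    pd_add i (differentiableAt_const _) (dH.fun_pow 2), pd_const, pd_pow i 2 dH,
    pd_inner i dW' dn, pd_inner i dW dn, pd_inner i dW dn', pd_inner i dW dX']
  push_cast
  ring

/-- The divergence of the flux. -/
theorem div_flux (hW : ContDiffOn ℝ ∞ W U) (hu : u ∈ U) (hX : (inner ℝ (W u) (X u) : ℝ) = 0) :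
    pd 0 (flux X n W 0) u + pd 1 (flux X n W 1) u =
    meanCurv X n u * (inner ℝ (pd 0 (pd 0 W) u) (n u) + inner ℝ (pd 1 (pd 1 W) u) (n u))
    + 2 * meanCurv X n u * (inner ℝ (pd 0 W u) (pd 0 n u) + inner ℝ (pd 1 W u) (pd 1 n u))
    + (1 + meanCurv X n u ^ 2)
        * (inner ℝ (pd 0 W u) (pd 0 X u) + inner ℝ (pd 1 W u) (pd 1 X u))
    + 2 * conf X u * meanCurv X n u * inner ℝ (W u) (n u)
    - conf X u * willmoreCurv X n u * inner ℝ (W u) (n u) := by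
  have hc := (S.conf_pos hu).ne'
  have h1 := S.inner_laplX hu (W u)
  have h2 := S.inner_laplN hu (W u)
  rw [hX, inner_add_right] at h1 h2
  rw [S.pd_flux hW hu, S.pd_flux hW hu, S.willmoreCurv_eq hu]
  field_simp
  field_simp at h2
  -- The Laplacians of X and n paired with W supply all terms without derivatives of W.
  linear_combination (conf X u * (1 + meanCurv X n u ^ 2)) * h1 + meanCurv X n u * h2

end IsothermalSurface

/-! ### The derivative of the energy density -/

/-- No conformality is assumed: the surfaces of a variation need not stay isothermal. -/
theorem meanOf_eq (g h : TensorField 2) (u : Fin 2 → ℝ) : meanOf g h u =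
    (g u 1 1 * h u 0 0 - g u 0 1 * h u 0 1 - g u 1 0 * h u 1 0 + g u 0 0 * h u 1 1)
      / (2 * (g u 0 0 * g u 1 1 - g u 0 1 * g u 1 0)) := by
  simp only [meanOf, traceForm, Fin.sum_univ_two, Matrix.inv_def, Matrix.adjugate_fin_two,
    Matrix.det_fin_two, Ring.inverse_eq_inv']
  simp
  rw [div_eq_mul_inv, mul_inv]
  ring

/-- The energy density of a surface as a function of its fundamental forms. -/
theorem hasDerivAt_energyDensity {a b c p q r s : ℝ → ℝ} {a' b' c' p' q' r' s' e H : ℝ}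
    (ha : HasDerivAt a a' 0) (hb : HasDerivAt b b' 0) (hc : HasDerivAt c c' 0)
    (hp : HasDerivAt p p' 0) (hq : HasDerivAt q q' 0) (hr : HasDerivAt r r' 0)
    (hs : HasDerivAt s s' 0) (he : 0 < e) (ha0 : a 0 = e) (hb0 : b 0 = 0) (hc0 : c 0 = e)
    (hH : p 0 + s 0 = 2 * e * H) :
    HasDerivAt (fun t => (1 + ((c t * p t - b t * q t - b t * r t + a t * s t)
        / (2 * (a t * c t - b t * b t))) ^ 2) * √(a t * c t - b t * b t))
      (H * ((c' * p 0 + a' * s 0 - b' * (q 0 + r 0)) / e + p' + s') - 2 * H ^ 2 * (a' + c')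
        + (1 + H ^ 2) * (a' + c') / 2) 0 := by
  have hd := (ha.fun_mul hc).fun_sub (hb.fun_mul hb)
  have hA := (((hc.fun_mul hp).fun_sub (hb.fun_mul hq)).fun_sub (hb.fun_mul hr)).fun_add
    (ha.fun_mul hs)
  have hd0 : a 0 * c 0 - b 0 * b 0 = e ^ 2 := by rw [ha0, hb0, hc0]; ring
  have hne : a 0 * c 0 - b 0 * b 0 ≠ 0 := by rw [hd0]; positivity
  have hm := hA.fun_div (hd.const_mul 2) (mul_ne_zero two_ne_zero hne)
  have hL := ((hm.fun_pow 2).const_add 1).fun_mul (hd.sqrt hne)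
  refine hL.congr_deriv ?_
  have hs0 : s 0 = 2 * e * H - p 0 := by linarith
  simp only [hd0, Real.sqrt_sq he.le]
  simp only [ha0, hb0, hc0, hs0, Nat.reduceSub, pow_one, Nat.cast_ofNat]
  field_simp
  ring

/-! ### The first variation of the Willmore energy -/

/-- Strict Cauchy–Schwarz for independent a and b: the nonzero vector −⟨a,b⟩a + ⟨a,a⟩b has squared
norm ⟨a,a⟩ times the Gram determinant. -/
theorem det_firstForm_pos {X : (Fin 2 → ℝ) → E4} {u : Fin 2 → ℝ}
    (h : Function.Injective (fderiv ℝ X u)) : 0 < (firstForm X u).det := by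
  set a := pd 0 X u with ha
  set b := pd 1 X u with hb
  have hlin : ∀ x y : ℝ, fderiv ℝ X u ![x, y] = x • a + y • b := by
    intro x y
    have : (![x, y] : Fin 2 → ℝ) = x • Pi.single 0 1 + y • Pi.single 1 1 := by
      ext i; fin_cases i <;> simp
    rw [this, map_add, map_smul, map_smul]; rfl
  have ha0 : a ≠ 0 := by
    intro h0
    have h1 := hlin 1 0
    rw [h0] at h1
    have := congrFun (h (by simpa using h1 : fderiv ℝ X u ![1, 0] = fderiv ℝ X u 0)) 0
    simp at this
  have haa : 0 < (inner ℝ a a : ℝ) := real_inner_self_pos.2 ha0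
  have hv : (-(inner ℝ a b : ℝ)) • a + (inner ℝ a a : ℝ) • b ≠ 0 := by
    intro h0
    have h1 := hlin (-(inner ℝ a b : ℝ)) (inner ℝ a a)
    rw [h0, ← map_zero (fderiv ℝ X u)] at h1
    have := congrFun (h h1) 1
    simp only [Matrix.cons_val, Pi.zero_apply] at this
    exact haa.ne' this
  have hp := real_inner_self_pos.2 hv
  simp only [inner_add_left, inner_add_right, real_inner_smul_left, real_inner_smul_right,
    real_inner_comm a b] at hp
  have hd : (firstForm X u).det = inner ℝ a a * inner ℝ b b - inner ℝ a b * inner ℝ a b := by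
    simp [Matrix.det_fin_two, firstForm, ← ha, ← hb, real_inner_comm a b,
      -inner_self_eq_norm_sq_to_K]
  rw [hd]
  refine pos_of_mul_pos_right (a := (inner ℝ a a : ℝ)) ?_ haa.le
  rw [real_inner_comm b a]
  rw [real_inner_comm b a] at hp
  linarith

/-- The integrand of the Willmore energy. -/
def energyDensity (X n : (Fin 2 → ℝ) → E4) (u : Fin 2 → ℝ) : ℝ :=
  (1 + meanCurv X n u ^ 2) * √(firstForm X u).det

theorem energyDensity_eq (X n : (Fin 2 → ℝ) → E4) (u : Fin 2 → ℝ) : energyDensity X n u =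
    (1 + ((inner ℝ (pd 1 X u) (pd 1 X u) * sff X n 0 0 u
      - inner ℝ (pd 0 X u) (pd 1 X u) * sff X n 0 1 u
      - inner ℝ (pd 0 X u) (pd 1 X u) * sff X n 1 0 u
      + inner ℝ (pd 0 X u) (pd 0 X u) * sff X n 1 1 u)
      / (2 * (inner ℝ (pd 0 X u) (pd 0 X u) * inner ℝ (pd 1 X u) (pd 1 X u)
        - inner ℝ (pd 0 X u) (pd 1 X u) * inner ℝ (pd 0 X u) (pd 1 X u)))) ^ 2)
    * √(inner ℝ (pd 0 X u) (pd 0 X u) * inner ℝ (pd 1 X u) (pd 1 X u)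
        - inner ℝ (pd 0 X u) (pd 1 X u) * inner ℝ (pd 0 X u) (pd 1 X u)) := by
  rw [energyDensity, meanCurv, meanOf_eq, Matrix.det_fin_two]
  simp only [firstForm, secondForm, Matrix.of_apply, sff, real_inner_comm (pd 0 X u) (pd 1 X u)]

section

variable {X : (Fin 2 → ℝ) → E4} {U K : Set (Fin 2 → ℝ)} {ε : ℝ}
  {F N : ℝ → (Fin 2 → ℝ) → E4} (hU : IsOpen U) (hV : IsVariation X U K ε F N)
include hU hV

theorem IsVariation.smooth_energyDensity :
    ContDiffOn ℝ ∞ (fun p : ℝ × (Fin 2 → ℝ) => energyDensity (F p.1) (N p.1) p.2)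
      (Set.Ioo (-ε) ε ×ˢ U) := by
  have hX := family_smooth_pd isOpen_Ioo hU hV.smooth
  have hN := family_smooth_pd isOpen_Ioo hU hV.smooth_normal
  have g := fun i j => (hX i).inner ℝ (hX j)
  have s := fun i j => ((hX i).inner ℝ (hN j)).neg
  have hd := ((g 0 0).mul (g 1 1)).sub ((g 0 1).mul (g 0 1))
  have hpos : ∀ p ∈ Set.Ioo (-ε) ε ×ˢ U,
      (inner ℝ (pd 0 (F p.1) p.2) (pd 0 (F p.1) p.2) : ℝ)
        * inner ℝ (pd 1 (F p.1) p.2) (pd 1 (F p.1) p.2)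
        - inner ℝ (pd 0 (F p.1) p.2) (pd 1 (F p.1) p.2)
          * inner ℝ (pd 0 (F p.1) p.2) (pd 1 (F p.1) p.2) ≠ 0 := by
    intro p hp
    have := det_firstForm_pos ((hV.immersion p.1 hp.1).2 p.2 hp.2).2
    simp only [Matrix.det_fin_two, firstForm, Matrix.of_apply,
      real_inner_comm (pd 0 (F p.1) p.2) (pd 1 (F p.1) p.2)] at this
    exact this.ne'
  refine (ContDiffOn.mul (contDiffOn_const.add (ContDiffOn.pow (ContDiffOn.div
    (((((g 1 1).mul (s 0 0)).sub ((g 0 1).mul (s 0 1))).sub ((g 0 1).mul (s 1 0))).add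
      ((g 0 0).mul (s 1 1))) (contDiffOn_const.mul hd)
      fun p hp => mul_ne_zero two_ne_zero (hpos p hp)) 2))
    (hd.sqrt hpos)).congr fun p _ => energyDensity_eq _ _ _

theorem IsVariation.isothermalSurface (hε : 0 < ε) (hiso : IsIsothermal X U) :
    IsothermalSurface (F 0) (N 0) U := by
  have h0 : (0 : ℝ) ∈ Set.Ioo (-ε) ε := ⟨by linarith, hε⟩
  refine ⟨hU, hV.immersion 0 h0, fun u hu => ?_, hV.normal 0 h0⟩
  have := hiso u hu
  simp only [firstForm, Matrix.of_apply] at this ⊢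
  rwa [pd_congr_on hU hV.start 0 hu, pd_congr_on hU hV.start 1 hu]

omit hU in
theorem IsVariation.vel_eq_zero (hε : 0 < ε) {u : Fin 2 → ℝ} (hu : u ∈ U \ K) :
    vel F 0 u = 0 := by
  have : (fun s => F s u) =ᶠ[𝓝 0] fun _ => X u :=
    Filter.eventually_of_mem (Ioo_mem_nhds (by linarith) hε) fun t ht => hV.support t ht u hu
  rw [vel, this.deriv_eq, deriv_const]

/-- The velocity M of the normal is eliminated by differentiating the relations between N, F and F_i
in t: ⟨M, n⟩ = 0, ⟨M, X⟩ = −⟨W, n⟩ and ⟨M, X_i⟩ = −⟨W_i, n⟩. One more derivative in u yields ⟨M_i,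
X_i⟩ + ⟨M, X_ii⟩, and `inner_laplX` evaluates ⟨M, ΔX⟩. The expression in W that remains is matched
by `div_flux`. -/
theorem IsVariation.vel_energyDensity (hε : 0 < ε) (hiso : IsIsothermal X U)
    {u : Fin 2 → ℝ} (hu : u ∈ U) :
    vel (fun t => energyDensity (F t) (N t)) 0 u =
      conf (F 0) u * willmoreCurv (F 0) (N 0) u * inner ℝ (vel F 0 u) (N 0 u)
      + (pd 0 (flux (F 0) (N 0) (vel F 0) 0) u + pd 1 (flux (F 0) (N 0) (vel F 0) 1) u) := by
  have S := hV.isothermalSurface hU hε hiso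
  have h0 : (0 : ℝ) ∈ Set.Ioo (-ε) ε := ⟨by linarith, hε⟩
  have hI : IsOpen (Set.Ioo (-ε) ε) := isOpen_Ioo
  have hc := S.conf_pos hu
  have sW := family_smooth_slice (family_smooth_vel hI hU hV.smooth) h0
  have sM := family_smooth_slice (family_smooth_vel hI hU hV.smooth_normal) h0
  have dF : ∀ w ∈ U, HasDerivAt (fun t => F t w) (vel F 0 w) 0 := fun w hw =>
    hasDerivAt_vel hI hU hV.smooth h0 hw
  have dN : ∀ w ∈ U, HasDerivAt (fun t => N t w) (vel N 0 w) 0 := fun w hw =>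
    hasDerivAt_vel hI hU hV.smooth_normal h0 hw
  have dFi : ∀ i, ∀ w ∈ U, HasDerivAt (fun t => pd i (F t) w) (pd i (vel F 0) w) 0 := by
    intro i w hw
    rw [← vel_pd hI hU hV.smooth i h0 hw]
    exact hasDerivAt_vel (G := fun t => pd i (F t)) hI hU
      (family_smooth_pd hI hU hV.smooth i) h0 hw
  have dNi : ∀ i, ∀ w ∈ U, HasDerivAt (fun t => pd i (N t) w) (pd i (vel N 0) w) 0 := by
    intro i w hw
    rw [← vel_pd hI hU hV.smooth_normal i h0 hw]
    exact hasDerivAt_vel (G := fun t => pd i (N t)) hI hU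
      (family_smooth_pd hI hU hV.smooth_normal i) h0 hw
  have hz : ∀ {f : ℝ → ℝ} {f' c : ℝ}, (∀ t ∈ Set.Ioo (-ε) ε, f t = c) → HasDerivAt f f' 0 →
      f' = 0 := fun {f f' c} hf hd =>
    -- A quantity constant for |t| < ε has derivative 0; this is applied to each constraint on F and
    -- N.
    hd.unique ((hasDerivAt_const (0 : ℝ) c).congr_of_eventuallyEq
      (Filter.eventually_of_mem (hI.mem_nhds h0) hf))
  have eWX : (inner ℝ (vel F 0 u) (F 0 u) : ℝ) = 0 := by
    have := hz (c := 1) (fun t ht => by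
      rw [real_inner_self_eq_norm_sq, ((hV.immersion t ht).2 u hu).1]; norm_num)
      ((dF u hu).inner ℝ (dF u hu))
    rw [real_inner_comm] at this
    linarith
  have eMn : (inner ℝ (vel N 0 u) (N 0 u) : ℝ) = 0 := by
    have := hz (c := 1) (fun t ht => by
      rw [real_inner_self_eq_norm_sq, ((hV.normal t ht).2 u hu).1]; norm_num)
      ((dN u hu).inner ℝ (dN u hu))
    rw [real_inner_comm] at this
    linarith
  have eMX : (inner ℝ (vel N 0 u) (F 0 u) : ℝ) = -inner ℝ (vel F 0 u) (N 0 u) := by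
    have := hz (fun t ht => ((hV.normal t ht).2 u hu).2.1) ((dN u hu).inner ℝ (dF u hu))
    rw [real_inner_comm] at this
    linarith
  have eMXi : ∀ i, ∀ w ∈ U, (inner ℝ (vel N 0 w) (pd i (F 0) w) : ℝ)
      = -inner ℝ (pd i (vel F 0) w) (N 0 w) := by
    intro i w hw
    have := hz (fun t ht => ((hV.normal t ht).2 w hw).2.2 i) ((dN w hw).inner ℝ (dFi i w hw))
    rw [real_inner_comm] at this
    linarith
  have eMXii : ∀ i, (inner ℝ (pd i (vel N 0) u) (pd i (F 0) u) : ℝ)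
      + inner ℝ (vel N 0 u) (pd i (pd i (F 0)) u)
      = -(inner ℝ (pd i (pd i (vel F 0)) u) (N 0 u) + inner ℝ (pd i (vel F 0) u) (pd i (N 0) u)) := by
    intro i
    rw [inner_pd_of_eq hU sM (S.smooth_pdX i) (eMXi i) i hu, pd_neg,
      pd_inner i (diffAt hU (smooth_pd hU sW i) hu) (diffAt hU S.smoothN hu)]
  have hg := fun i j => (dFi i u hu).inner ℝ (dFi j u hu)
  have hs := fun i j => ((dFi i u hu).inner ℝ (dNi j u hu)).fun_neg
  have hH : sff (F 0) (N 0) 0 0 u + sff (F 0) (N 0) 1 1 u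
      = 2 * conf (F 0) u * meanCurv (F 0) (N 0) u := by
    rw [S.sff_00 hu, S.sff_11 hu]; ring
  have key := hasDerivAt_energyDensity (hg 0 0) (hg 0 1) (hg 1 1) (hs 0 0) (hs 0 1) (hs 1 0)
    (hs 1 1) hc rfl (by simpa using S.inner_pdX hu 0 1) (by simpa using S.inner_pdX hu 1 1) hH
  refine Eq.trans (congrArg (fun f => deriv f 0) (funext fun t => energyDensity_eq _ _ _))
    (key.deriv.trans ?_)
  rw [S.div_flux sW hu eWX]
  have lX := S.inner_laplX hu (vel N 0 u)
  rw [eMn, eMX, inner_add_right] at lX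
  have e0 := eMXii 0
  have e1 := eMXii 1
  have w0 : ∀ v : E4, (inner ℝ v (pd 0 (N 0) u) : ℝ) * conf (F 0) u =
      -((conf (F 0) u * meanCurv (F 0) (N 0) u + hopfP (F 0) (N 0) u) * inner ℝ v (pd 0 (F 0) u)
        + hopfQ (F 0) (N 0) u * inner ℝ v (pd 1 (F 0) u)) := by
    intro v
    rw [S.weingarten hu, S.sff_00 hu, S.sff_10 hu, real_inner_smul_right, inner_add_right,
      real_inner_smul_right, real_inner_smul_right]
    field_simp
  have w1 : ∀ v : E4, (inner ℝ v (pd 1 (N 0) u) : ℝ) * conf (F 0) u =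
      -(hopfQ (F 0) (N 0) u * inner ℝ v (pd 0 (F 0) u)
        + (conf (F 0) u * meanCurv (F 0) (N 0) u - hopfP (F 0) (N 0) u)
          * inner ℝ v (pd 1 (F 0) u)) := by
    intro v
    rw [S.weingarten hu, S.sff_11 hu, IsothermalSurface.sff_01, real_inner_smul_right, inner_add_right,
      real_inner_smul_right, real_inner_smul_right]
    field_simp
  have w0' := w0 (pd 0 (vel F 0) u)
  have w1' := w1 (pd 1 (vel F 0) u)
  have s00 := S.sff_00 hu
  have s11 := S.sff_11 hu
  have s01 := IsothermalSurface.sff_01 (X := F 0) (n := N 0) (u := u)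
  have s10 := S.sff_10 hu
  simp only [sff] at s00 s11 s01 s10
  rw [s00, s11, s01, s10]
  simp only [real_inner_comm (pd _ (vel F 0) u) (pd _ (F 0) u),
    real_inner_comm (pd _ (vel N 0) u) (pd _ (F 0) u)]
  field_simp
  linear_combination (-2 * meanCurv (F 0) (N 0) u * conf (F 0) u) * (e0 + e1)
    + (2 * meanCurv (F 0) (N 0) u * conf (F 0) u) * lX - 4 * meanCurv (F 0) (N 0) u * (w0' + w1')

/-- The flux is built from the velocity, which vanishes on the open set U \ K, so its divergence
integrates to zero. -/
theorem IsVariation.hasDerivAt_willmoreEnergy (hK : IsCompact K) (hKU : K ⊆ U) (hε : 0 < ε)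
    (hiso : IsIsothermal X U) :
    HasDerivAt (fun t => willmoreEnergy (F t) (N t) K)
      (∫ u in K, conf (F 0) u * willmoreCurv (F 0) (N 0) u * inner ℝ (vel F 0 u) (N 0 u)) 0 := by
  have S := hV.isothermalSurface hU hε hiso
  have h0 : (0 : ℝ) ∈ Set.Ioo (-ε) ε := ⟨by linarith, hε⟩
  have sW := family_smooth_slice (family_smooth_vel isOpen_Ioo hU hV.smooth) h0
  have h := hasDerivAt_setIntegral (G := fun t => energyDensity (F t) (N t)) isOpen_Ioo hU (hV.smooth_energyDensity hU) hK hKU h0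
  refine h.congr_deriv ?_
  have hf := S.smooth_flux sW
  have hfi : ∀ i, IntegrableOn (pd i (flux (F 0) (N 0) (vel F 0) i)) K := fun i =>
    ((smooth_pd hU (hf i) i).continuousOn.mono hKU).integrableOn_compact hK
  have hfz : ∀ i, ∫ u in K, pd i (flux (F 0) (N 0) (vel F 0) i) u = 0 := fun i =>
    setIntegral_pd_eq_zero hU hK hKU (hf i) (fun u hu => by
      have hO : IsOpen (U \ K) := hU.sdiff hK.isClosed
      have hz : ∀ w ∈ U \ K, vel F 0 w = 0 := fun w hw => hV.vel_eq_zero hε hw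
      simp [flux, hz u hu, pd_congr_on hO hz i hu]) i
  have hv : IntegrableOn (vel (fun t => energyDensity (F t) (N t)) 0) K :=
    ((family_smooth_slice (family_smooth_vel (G := fun t => energyDensity (F t) (N t))
      isOpen_Ioo hU (hV.smooth_energyDensity hU))
      h0).continuousOn.mono hKU).integrableOn_compact hK
  have e : ∀ u ∈ K, conf (F 0) u * willmoreCurv (F 0) (N 0) u * inner ℝ (vel F 0 u) (N 0 u) =
      vel (fun t => energyDensity (F t) (N t)) 0 u
      - (pd 0 (flux (F 0) (N 0) (vel F 0) 0) u + pd 1 (flux (F 0) (N 0) (vel F 0) 1) u) :=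
    fun u hu => by rw [hV.vel_energyDensity hU hε hiso (hKU hu)]; ring
  have hsum : ∫ u in K, (pd 0 (flux (F 0) (N 0) (vel F 0) 0) u
      + pd 1 (flux (F 0) (N 0) (vel F 0) 1) u) = 0 := by
    rw [integral_add (hfi 0) (hfi 1), hfz, hfz, add_zero]
  rw [setIntegral_congr_fun hK.measurableSet e,
    integral_sub hv (g := fun u => pd 0 (flux (F 0) (N 0) (vel F 0) 0) u
      + pd 1 (flux (F 0) (N 0) (vel F 0) 1) u) ((hfi 0).add (hfi 1)), hsum, sub_zero]

end

/-! ### Dependence of the Euler–Lagrange expression on the normal -/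

namespace IsothermalSurface

variable {X n X' n' : (Fin 2 → ℝ) → E4} {U V : Set (Fin 2 → ℝ)}

theorem mono (S : IsothermalSurface X n U) (hV : IsOpen V) (hVU : V ⊆ U) :
    IsothermalSurface X n V :=
  ⟨hV, ⟨S.smoothX.mono hVU, fun u hu => S.immersion.2 u (hVU hu)⟩,
    fun u hu => S.isothermal u (hVU hu),
    ⟨S.smoothN.mono hVU, fun u hu => S.normal.2 u (hVU hu)⟩⟩

/-- H is odd in the normal and |II°|² is even. -/
theorem willmoreCurv_of_eq_smul (S : IsothermalSurface X n U) (S' : IsothermalSurface X' n' U)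
    (hX : ∀ u ∈ U, X' u = X u) {c : ℝ} (hc : c ^ 2 = 1) (hn : ∀ u ∈ U, n' u = c • n u)
    {u : Fin 2 → ℝ} (hu : u ∈ U) : willmoreCurv X' n' u = c * willmoreCurv X n u := by
  have hU := S.isOpen
  have hconf : ∀ w ∈ U, conf X' w = conf X w := fun w hw => by
    rw [conf, conf, pd_congr_on hU hX 0 hw]
  have hsff : ∀ i j, ∀ w ∈ U, sff X' n' i j w = c * sff X n i j w := fun i j w hw => by
    rw [sff, sff, pd_congr_on hU hX i hw, pd_congr_on hU hn j hw,
      pd_smul j (differentiableAt_const c) (diffAt hU S.smoothN hw)]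
    simp [real_inner_smul_right]
  have hm : ∀ w ∈ U, meanCurv X' n' w = c * meanCurv X n w := fun w hw => by
    rw [S.meanCurv_eq hw, S'.meanCurv_eq hw, hconf w hw, hsff _ _ w hw, hsff _ _ w hw]; ring
  have hpd : ∀ i, ∀ w ∈ U, pd i (meanCurv X' n') w = c * pd i (meanCurv X n) w :=
    fun i w hw => by
      rw [pd_congr_on hU hm i hw, pd_mul i (differentiableAt_const c) (diffAt hU S.smooth_mean hw)]
      simp
  have hpdpd : ∀ i, pd i (pd i (meanCurv X' n')) u = c * pd i (pd i (meanCurv X n)) u :=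
    fun i => by
      rw [pd_congr_on hU (hpd i) i hu, pd_mul i (differentiableAt_const c)
        (diffAt hU (smooth_pd hU S.smooth_mean i) hu)]
      simp
  rw [S.willmoreCurv_eq hu, S'.willmoreCurv_eq hu, hpdpd, hpdpd, hconf u hu, hm u hu]
  simp only [hopfP, hopfQ, hsff _ _ u hu]
  linear_combination (2 * ((((sff X n 0 0 u - sff X n 1 1 u) / 2) ^ 2 + sff X n 0 1 u ^ 2)
    / conf X u ^ 2) * c * meanCurv X n u) * hc

/-- The vanishing of the Euler–Lagrange expression does not depend on the choice of the unit
normal. -/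
theorem willmoreCurv_eq_zero (S : IsothermalSurface X n U) (S' : IsothermalSurface X' n' U)
    (hX : ∀ u ∈ U, X' u = X u) (h : ∀ u ∈ U, willmoreCurv X n u = 0) :
    ∀ u ∈ U, willmoreCurv X' n' u = 0 := by
  intro u hu
  set σ := fun w => (inner ℝ (n w) (n' w) : ℝ) with hσ
  have hn : ∀ w ∈ U, n' w = σ w • n w := fun w hw => by
    refine S.ext_inner hw ?_ ?_ fun i => ?_
    · rw [real_inner_smul_right, real_inner_comm (n w) (X w), S.inner_nX hw, ← hX w hw,
        real_inner_comm, S'.inner_nX hw, mul_zero]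
    · rw [real_inner_smul_right, S.inner_nn hw, mul_one]
    · rw [real_inner_smul_right, real_inner_comm (n w), S.inner_n_pdX hw,
        ← pd_congr_on S.isOpen hX i hw, real_inner_comm, S'.inner_n_pdX hw, mul_zero]
  have hsq : ∀ w ∈ U, σ w ^ 2 = 1 := fun w hw => by
    have h1 := S'.inner_nn hw
    rw [hn w hw, real_inner_smul_left, real_inner_smul_right, S.inner_nn hw] at h1
    linarith
  -- σ is continuous with values ±1. On the open set where it has the same sign as at u the two
  -- normals differ by a constant sign; `U` itself may be disconnected.
  have hcont : ContinuousOn (fun w => σ w * σ u) U :=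
    (S.smoothN.inner ℝ S'.smoothN).continuousOn.mul continuousOn_const
  have hV := hcont.isOpen_inter_preimage S.isOpen (isOpen_Ioi (a := (0 : ℝ)))
  have hVU : U ∩ (fun w => σ w * σ u) ⁻¹' Set.Ioi 0 ⊆ U := Set.inter_subset_left
  have huV : u ∈ U ∩ (fun w => σ w * σ u) ⁻¹' Set.Ioi 0 := by
    refine ⟨hu, ?_⟩
    simp only [Set.mem_preimage, Set.mem_Ioi]
    nlinarith [hsq u hu]
  rw [(S.mono hV hVU).willmoreCurv_of_eq_smul (S'.mono hV hVU) (fun w hw => hX w hw.1)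
    (hsq u hu) (fun w hw => ?_) huV, h u hu, mul_zero]
  rw [hn w hw.1]
  congr 1
  have h1 := hsq w hw.1
  have h2 := hsq u hu
  have h3 : 0 < σ w * σ u := hw.2
  rcases mul_self_eq_one_iff.1 (pow_two (σ w) ▸ h1) with h | h <;>
    rcases mul_self_eq_one_iff.1 (pow_two (σ u) ▸ h2) with h' | h' <;> rw [h, h'] at h3 ⊢ <;> norm_num at h3

theorem isWillmore (S : IsothermalSurface X n U) (h : ∀ u ∈ U, willmoreCurv X n u = 0) :
    IsWillmore X U := by
  intro K ε F N hK hKU hε hV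
  have h0 := S.willmoreCurv_eq_zero (hV.isothermalSurface S.isOpen hε S.isothermal) hV.start h
  have hd := hV.hasDerivAt_willmoreEnergy S.isOpen hK hKU hε S.isothermal
  refine hd.congr_deriv ?_
  rw [setIntegral_congr_fun (g := fun _ => (0 : ℝ)) hK.measurableSet fun u hu => ?_]
  · simp
  · simp [h0 u (hKU hu)]

end IsothermalSurface

/-! ### Normal variations -/

section NormalVariation

variable (X n : (Fin 2 → ℝ) → E4) (φ : (Fin 2 → ℝ) → ℝ)

/-- The variation that moves the point `X u` along the great circle in the direction `n u` by the
angle `t * φ u`. -/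
def normalVar (t : ℝ) (u : Fin 2 → ℝ) : E4 :=
  Real.cos (t * φ u) • X u + Real.sin (t * φ u) • n u

/-- The direction of the great circle at the displaced point. -/
def normalVarDir (t : ℝ) (u : Fin 2 → ℝ) : E4 :=
  -Real.sin (t * φ u) • X u + Real.cos (t * φ u) • n u

/-- The coordinate fields of the parallel surface through the displaced point. -/
def normalVarFrame (i : Fin 2) (t : ℝ) (u : Fin 2 → ℝ) : E4 :=
  Real.cos (t * φ u) • pd i X u + Real.sin (t * φ u) • pd i n u

/-- The metric coefficients of the parallel surface. -/
def normalVarGram (i j : Fin 2) (t : ℝ) (u : Fin 2 → ℝ) : ℝ :=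
  inner ℝ (normalVarFrame X n φ i t u) (normalVarFrame X n φ j t u)

/-- The Gram determinant of the parallel surface. -/
def normalVarDet (t : ℝ) (u : Fin 2 → ℝ) : ℝ :=
  normalVarGram X n φ 0 0 t u * normalVarGram X n φ 1 1 t u - normalVarGram X n φ 0 1 t u ^ 2

/-- A normal vector of the displaced surface. -/
def normalVarVec (t : ℝ) (u : Fin 2 → ℝ) : E4 :=
  normalVarDet X n φ t u • normalVarDir X n φ t u
    - (t * (pd 0 φ u * normalVarGram X n φ 1 1 t u - pd 1 φ u * normalVarGram X n φ 0 1 t u))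
      • normalVarFrame X n φ 0 t u
    - (t * (pd 1 φ u * normalVarGram X n φ 0 0 t u - pd 0 φ u * normalVarGram X n φ 0 1 t u))
      • normalVarFrame X n φ 1 t u

/-- The unit normal of the displaced surface. -/
def normalVarNormal (t : ℝ) (u : Fin 2 → ℝ) : E4 :=
  ‖normalVarVec X n φ t u‖⁻¹ • normalVarVec X n φ t u

end NormalVariation

namespace IsothermalSurface

variable {X n : (Fin 2 → ℝ) → E4} {U : Set (Fin 2 → ℝ)} (S : IsothermalSurface X n U)
  {φ : (Fin 2 → ℝ) → ℝ} {u : Fin 2 → ℝ}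
include S

theorem inner_normalVar (hu : u ∈ U) (t : ℝ) :
    (inner ℝ (normalVar X n φ t u) (normalVar X n φ t u) : ℝ) = 1 ∧
    (inner ℝ (normalVarDir X n φ t u) (normalVarDir X n φ t u) : ℝ) = 1 ∧
    (inner ℝ (normalVarDir X n φ t u) (normalVar X n φ t u) : ℝ) = 0 ∧
    (∀ i, (inner ℝ (normalVarFrame X n φ i t u) (normalVar X n φ t u) : ℝ) = 0) ∧
    ∀ i, (inner ℝ (normalVarFrame X n φ i t u) (normalVarDir X n φ t u) : ℝ) = 0 := by
  have e1 := S.inner_XX hu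
  have e2 := S.inner_nn hu
  have e3 := S.inner_nX hu
  have e3' : (inner ℝ (X u) (n u) : ℝ) = 0 := by rw [real_inner_comm, e3]
  have e4 : ∀ i, (inner ℝ (pd i X u) (n u) : ℝ) = 0 := fun i => by
    rw [real_inner_comm, S.inner_n_pdX hu]
  have e5 : ∀ i, (inner ℝ (pd i X u) (X u) : ℝ) = 0 := fun i => by
    rw [real_inner_comm, S.inner_X_pdX hu]
  have e6 : ∀ i, (inner ℝ (pd i n u) (n u) : ℝ) = 0 := fun i => by
    rw [real_inner_comm, S.inner_n_pdN hu]
  have e7 : ∀ i, (inner ℝ (pd i n u) (X u) : ℝ) = 0 := fun i => by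
    rw [real_inner_comm, S.inner_X_pdN hu]
  have hcs := Real.cos_sq_add_sin_sq (t * φ u)
  simp only [normalVar, normalVarDir, normalVarFrame, inner_add_left, inner_add_right,
    real_inner_smul_left, real_inner_smul_right, e1, e2, e3, e3', e4, e5, e6, e7]
  refine ⟨?_, ?_, ?_, fun i => ?_, fun i => ?_⟩ <;> linarith

variable (hφ : ContDiff ℝ ∞ φ)
include hφ

theorem pd_normalVar (hu : u ∈ U) (i : Fin 2) (t : ℝ) : pd i (normalVar X n φ t) u =
    normalVarFrame X n φ i t u + (t * pd i φ u) • normalVarDir X n φ t u := by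
  have dφ : DifferentiableAt ℝ (fun w => t * φ w) u :=
    (hφ.differentiable (by simp) u).const_mul t
  have hc : pd i (fun w => Real.cos (t * φ w)) u = -(Real.sin (t * φ u) * (t * pd i φ u)) := by
    simp [pd, fderiv_cos dφ, fderiv_const_mul (hφ.differentiable (by simp) u)]
  have hs : pd i (fun w => Real.sin (t * φ w)) u = Real.cos (t * φ u) * (t * pd i φ u) := by
    simp [pd, fderiv_sin dφ, fderiv_const_mul (hφ.differentiable (by simp) u)]
  have dX := diffAt S.isOpen S.smoothX hu
  have dn := diffAt S.isOpen S.smoothN hu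
  unfold normalVar
  rw [pd_add i (dφ.cos.fun_smul dX) (dφ.sin.fun_smul dn), pd_smul i dφ.cos dX,
    pd_smul i dφ.sin dn, hc, hs, normalVarFrame, normalVarDir]
  module

theorem smooth_normalVar :
    ContDiffOn ℝ ∞ (fun p : ℝ × (Fin 2 → ℝ) => normalVar X n φ p.1 p.2) (Set.univ ×ˢ U) ∧
    ContDiffOn ℝ ∞ (fun p : ℝ × (Fin 2 → ℝ) => normalVarDet X n φ p.1 p.2) (Set.univ ×ˢ U) ∧
    ContDiffOn ℝ ∞ (fun p : ℝ × (Fin 2 → ℝ) => normalVarVec X n φ p.1 p.2)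
      (Set.univ ×ˢ U) := by
  have hsnd : ∀ {V : Type} [NormedAddCommGroup V] [NormedSpace ℝ V] {f : (Fin 2 → ℝ) → V},
      ContDiffOn ℝ ∞ f U →
      ContDiffOn ℝ ∞ (fun p : ℝ × (Fin 2 → ℝ) => f p.2) (Set.univ ×ˢ U) :=
    fun hf => hf.comp contDiffOn_snd fun p hp => hp.2
  have hfst : ContDiffOn ℝ ∞ (fun p : ℝ × (Fin 2 → ℝ) => p.1) (Set.univ ×ˢ U) := contDiffOn_fst
  have hθ : ContDiffOn ℝ ∞ (fun p : ℝ × (Fin 2 → ℝ) => p.1 * φ p.2) (Set.univ ×ˢ U) :=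
    hfst.mul (hsnd hφ.contDiffOn)
  have hc := hθ.cos
  have hs := hθ.sin
  have hX := hsnd S.smoothX
  have hn := hsnd S.smoothN
  have hY : ∀ i, ContDiffOn ℝ ∞ (fun p : ℝ × (Fin 2 → ℝ) => normalVarFrame X n φ i p.1 p.2)
      (Set.univ ×ˢ U) := fun i =>
    (hc.smul (hsnd (S.smooth_pdX i))).add (hs.smul (hsnd (S.smooth_pdN i)))
  have hg : ∀ i j, ContDiffOn ℝ ∞ (fun p : ℝ × (Fin 2 → ℝ) => normalVarGram X n φ i j p.1 p.2)
      (Set.univ ×ˢ U) := fun i j => (hY i).inner ℝ (hY j)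
  have hd : ContDiffOn ℝ ∞ (fun p : ℝ × (Fin 2 → ℝ) => normalVarDet X n φ p.1 p.2)
      (Set.univ ×ˢ U) := ((hg 0 0).mul (hg 1 1)).sub ((hg 0 1).pow 2)
  have hp : ∀ i, ContDiffOn ℝ ∞ (fun p : ℝ × (Fin 2 → ℝ) => pd i φ p.2) (Set.univ ×ˢ U) :=
    fun i => hsnd (smooth_pd S.isOpen hφ.contDiffOn i)
  refine ⟨(hc.smul hX).add (hs.smul hn), hd, ?_⟩
  exact ((hd.smul ((hs.neg.smul hX).add (hc.smul hn))).sub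
    ((hfst.mul (((hp 0).mul (hg 1 1)).sub ((hp 1).mul (hg 0 1)))).smul (hY 0))).sub
    ((hfst.mul (((hp 1).mul (hg 0 0)).sub ((hp 0).mul (hg 0 1)))).smul (hY 1))

omit hφ in
theorem normalVarDet_of_eq_zero (hu : u ∈ U) {t : ℝ} (h : t * φ u = 0) :
    normalVarDet X n φ t u = conf X u ^ 2 := by
  simp [normalVarDet, normalVarGram, normalVarFrame, h, S.inner_pdX hu,
    -inner_self_eq_norm_sq_to_K]
  ring

omit hφ in
theorem inner_normalVarVec (hu : u ∈ U) (t : ℝ) :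
    (inner ℝ (normalVarVec X n φ t u) (normalVarDir X n φ t u) : ℝ) = normalVarDet X n φ t u := by
  obtain ⟨-, e2, -, -, e5⟩ := S.inner_normalVar (φ := φ) hu t
  simp [normalVarVec, inner_sub_left, real_inner_smul_left, e5, e2, -inner_self_eq_norm_sq_to_K]

/-- A vector in the kernel of the differential has zero product with the frame of the parallel
surface. That is a linear system with the Gram matrix, solved by Cramer's rule. -/
theorem isImmersion_normalVar {t : ℝ} (h : ∀ u ∈ U, normalVarDet X n φ t u ≠ 0) :
    IsImmersion (normalVar X n φ t) U := by
  refine ⟨family_smooth_slice (S.smooth_normalVar hφ).1 (Set.mem_univ t), fun u hu => ⟨?_, ?_⟩⟩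
  · have := (S.inner_normalVar (φ := φ) hu t).1
    rw [real_inner_self_eq_norm_sq] at this
    exact (pow_eq_one_iff_of_nonneg (norm_nonneg _) two_ne_zero).1 this
  · obtain ⟨-, -, -, -, e5⟩ := S.inner_normalVar (φ := φ) hu t
    refine (injective_iff_map_eq_zero _).2 fun v hv => ?_
    have hv' : v 0 • pd 0 (normalVar X n φ t) u + v 1 • pd 1 (normalVar X n φ t) u = 0 := by
      have : v = v 0 • Pi.single 0 1 + v 1 • Pi.single 1 1 := by
        ext i; fin_cases i <;> simp
      rw [this, map_add, map_smul, map_smul] at hv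
      exact hv
    have hk : ∀ k, v 0 * normalVarGram X n φ k 0 t u + v 1 * normalVarGram X n φ k 1 t u = 0 := by
      intro k
      have := congrArg (fun w => (inner ℝ (normalVarFrame X n φ k t u) w : ℝ)) hv'
      simpa [S.pd_normalVar hφ hu, inner_add_right, real_inner_smul_right, e5,
        normalVarGram, -inner_self_eq_norm_sq_to_K] using this
    have h0 := hk 0
    have h1 := hk 1
    have hs : normalVarGram X n φ 1 0 t u = normalVarGram X n φ 0 1 t u := real_inner_comm _ _
    rw [hs] at h1
    have hd := h u hu
    have z0 : v 0 * normalVarDet X n φ t u = 0 := by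
      rw [normalVarDet]
      linear_combination normalVarGram X n φ 1 1 t u * h0 - normalVarGram X n φ 0 1 t u * h1
    have z1 : v 1 * normalVarDet X n φ t u = 0 := by
      rw [normalVarDet]
      linear_combination normalVarGram X n φ 0 0 t u * h1 - normalVarGram X n φ 0 1 t u * h0
    ext i
    fin_cases i
    · exact (mul_eq_zero.1 z0).resolve_right hd
    · exact (mul_eq_zero.1 z1).resolve_right hd

omit hφ in
theorem normalVarVec_ne_zero (hu : u ∈ U) {t : ℝ} (h : normalVarDet X n φ t u ≠ 0) :
    normalVarVec X n φ t u ≠ 0 := fun h0 => h <| by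
  rw [← S.inner_normalVarVec hu, h0, inner_zero_left]

theorem smooth_normalVarNormal {I : Set ℝ}
    (h : ∀ t ∈ I, ∀ u ∈ U, normalVarDet X n φ t u ≠ 0) :
    ContDiffOn ℝ ∞ (fun p : ℝ × (Fin 2 → ℝ) => normalVarNormal X n φ p.1 p.2) (I ×ˢ U) := by
  have hv := (S.smooth_normalVar hφ).2.2.mono (Set.prod_mono_left (Set.subset_univ I))
  have h0 : ∀ p ∈ I ×ˢ U, normalVarVec X n φ p.1 p.2 ≠ 0 := fun p hp =>
    S.normalVarVec_ne_zero hp.2 (h p.1 hp.1 p.2 hp.2)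
  exact ((hv.norm ℝ h0).inv fun p hp => norm_ne_zero_iff.2 (h0 p hp)).smul hv

/-- The coordinate fields are the frame plus tφ_i times the great-circle direction. The cofactors in
`normalVarVec` make its products with them cancel. -/
theorem isUnitNormal_normalVar {t : ℝ} (h : ∀ u ∈ U, normalVarDet X n φ t u ≠ 0) :
    IsUnitNormal (normalVar X n φ t) (normalVarNormal X n φ t) U := by
  refine ⟨family_smooth_slice (S.smooth_normalVarNormal hφ (I := {t}) fun s hs => ?_)
    (Set.mem_singleton t), fun u hu => ⟨?_, ?_, fun i => ?_⟩⟩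
  · rw [Set.mem_singleton_iff.1 hs]; exact h
  · exact norm_smul_inv_norm (S.normalVarVec_ne_zero hu (h u hu))
  · obtain ⟨-, -, e3, e4, -⟩ := S.inner_normalVar (φ := φ) hu t
    simp [normalVarNormal, normalVarVec, inner_sub_left, real_inner_smul_left, e3, e4]
  · obtain ⟨-, e2, -, -, e5⟩ := S.inner_normalVar (φ := φ) hu t
    have e5' : ∀ i, (inner ℝ (normalVarDir X n φ t u) (normalVarFrame X n φ i t u) : ℝ) = 0 :=
      fun i => by rw [real_inner_comm, e5]
    rw [normalVarNormal, S.pd_normalVar hφ hu, real_inner_smul_left]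
    refine mul_eq_zero_of_right _ ?_
    have hg : ∀ k l, (inner ℝ (normalVarFrame X n φ k t u) (normalVarFrame X n φ l t u) : ℝ)
      = normalVarGram X n φ k l t u := fun k l => rfl
    have hs : normalVarGram X n φ 1 0 t u = normalVarGram X n φ 0 1 t u := real_inner_comm _ _
    simp only [normalVarVec, inner_sub_left, inner_add_right, real_inner_smul_left,
      real_inner_smul_right, e2, e5, e5', hg, normalVarDet]
    fin_cases i <;> simp only [Fin.zero_eta, Fin.mk_one, hs] <;> ring

/-- A normal variation with small parameter is a variation of the surface. -/
theorem exists_isVariation_normalVar (hc : HasCompactSupport φ) (hsupp : tsupport φ ⊆ U) :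
    ∃ ε > 0, IsVariation X U (tsupport φ) ε (normalVar X n φ) (normalVarNormal X n φ) := by
  have hopen : IsOpen ((Set.univ ×ˢ U) ∩
      (fun p : ℝ × (Fin 2 → ℝ) => normalVarDet X n φ p.1 p.2) ⁻¹' {0}ᶜ) :=
    (S.smooth_normalVar hφ).2.1.continuousOn.isOpen_inter_preimage (isOpen_univ.prod S.isOpen)
      isOpen_compl_singleton
  have hz : ∀ u ∈ U, ∀ t : ℝ, t * φ u = 0 → normalVarDet X n φ t u ≠ 0 := fun u hu t h => by
    rw [S.normalVarDet_of_eq_zero hu h]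
    exact (pow_pos (S.conf_pos hu) 2).ne'
  -- The Gram determinant is nonzero on {0} × supp φ; the tube lemma extends this to |t| < ε
  -- uniformly over the compact support. Off the support it is E² for every t.
  obtain ⟨A, B, hA, -, h0A, hKB, hAB⟩ := generalized_tube_lemma (isCompact_singleton (x := (0 : ℝ)))
    hc hopen (by
      rintro ⟨t, u⟩ ⟨ht, hu⟩
      obtain rfl : t = 0 := ht
      exact ⟨⟨Set.mem_univ _, hsupp hu⟩, hz u (hsupp hu) 0 (zero_mul _)⟩)
  obtain ⟨ε, hε, hεA⟩ := Metric.isOpen_iff.1 hA 0 (h0A rfl)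
  rw [Real.ball_eq_Ioo, zero_sub, zero_add] at hεA
  have hdet : ∀ t ∈ Set.Ioo (-ε) ε, ∀ u ∈ U, normalVarDet X n φ t u ≠ 0 := fun t ht u hu => by
    by_cases hK : u ∈ tsupport φ
    · exact (hAB (Set.mk_mem_prod (hεA ht) (hKB hK))).2
    · exact hz u hu t (by rw [image_eq_zero_of_notMem_tsupport hK, mul_zero])
  refine ⟨ε, hε, (S.smooth_normalVar hφ).1.mono (Set.prod_mono_left (Set.subset_univ _)),
    S.smooth_normalVarNormal hφ hdet, fun t ht => S.isImmersion_normalVar hφ (hdet t ht),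
    fun t ht => S.isUnitNormal_normalVar hφ (hdet t ht), fun u _ => by simp [normalVar],
    fun t _ u hu => ?_⟩
  simp [normalVar, image_eq_zero_of_notMem_tsupport hu.2]

omit hφ in
theorem normalVarNormal_zero (hu : u ∈ U) : normalVarNormal X n φ 0 u = n u := by
  have hd : 0 < normalVarDet X n φ 0 u := by
    rw [S.normalVarDet_of_eq_zero hu (zero_mul _)]; exact pow_pos (S.conf_pos hu) 2
  have hv : normalVarVec X n φ 0 u = normalVarDet X n φ 0 u • n u := by
    simp [normalVarVec, normalVarDir]
  rw [normalVarNormal, hv, norm_smul, (S.normal.2 u hu).1, mul_one, Real.norm_of_nonneg hd.le,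
    smul_smul, inv_mul_cancel₀ hd.ne', one_smul]

omit S hφ in
theorem vel_normalVar (u : Fin 2 → ℝ) : vel (normalVar X n φ) 0 u = φ u • n u := by
  have h := (hasDerivAt_id (0 : ℝ)).mul_const (φ u)
  have := ((h.cos).smul_const (X u)).fun_add ((h.sin).smul_const (n u))
  simpa [vel, normalVar] using this.deriv

omit hφ in
-- Moving along the normal with speed φ gives ∫ φ E (ΔH + |II°|²H) = 0 for every test function φ
-- supported in U, so the continuous factor of φ vanishes.
theorem willmoreCurv_eq_zero_of_isWillmore (h : IsWillmore X U) :
    ∀ u ∈ U, willmoreCurv X n u = 0 := by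
  set f := fun u => conf X u * willmoreCurv X n u with hf
  have hfc : ContinuousOn f U := (S.smooth_conf.mul S.smooth_willmoreCurv).continuousOn
  have hint : ∀ φ : (Fin 2 → ℝ) → ℝ, ContDiff ℝ ∞ φ → HasCompactSupport φ → tsupport φ ⊆ U →
      ∫ u, φ u • f u = 0 := by
    intro φ hφ hc hs
    obtain ⟨ε, hε, hV⟩ := S.exists_isVariation_normalVar hφ hc hs
    have h1 := h _ ε _ _ hc hs hε hV
    have h2 := (hV.hasDerivAt_willmoreEnergy S.isOpen hc hs hε S.isothermal).unique h1
    have S' := hV.isothermalSurface S.isOpen hε S.isothermal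
    rw [← setIntegral_eq_integral_of_forall_compl_eq_zero (s := tsupport φ)
      fun u hu => by rw [image_eq_zero_of_notMem_tsupport hu, zero_smul], ← h2]
    refine setIntegral_congr_fun hc.measurableSet fun u hu => ?_
    have huU := hs hu
    have hX : ∀ w ∈ U, normalVar X n φ 0 w = X w := hV.start
    have hw := S.willmoreCurv_of_eq_smul S' hX (c := 1) (by norm_num)
      (fun w hw => by rw [one_smul, S.normalVarNormal_zero hw]) huU
    simp only [hf]
    rw [hw, vel_normalVar, S.normalVarNormal_zero huU, real_inner_smul_left, S.inner_nn huU,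
      conf, conf, pd_congr_on S.isOpen hX 0 huU, smul_eq_mul]
    ring
  have hae := S.isOpen.ae_eq_zero_of_integral_contDiff_smul_eq_zero
    (hfc.locallyIntegrableOn S.isOpen.measurableSet) hint
  have heq : Set.EqOn f 0 U := Measure.eqOn_open_of_ae_eq (μ := volume)
    ((ae_restrict_iff' S.isOpen.measurableSet).2 hae) S.isOpen hfc continuousOn_const
  intro u hu
  exact (mul_eq_zero.1 (heq hu)).resolve_left (S.conf_pos hu).ne'

end IsothermalSurface

end ConformalSurface

end

theorem mainTheorem6 (U : Set (Fin 2 → ℝ)) (hU : IsOpen U)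
    (X n : (Fin 2 → ℝ) → ConformalSurface.E4)
    (hX : ConformalSurface.IsImmersion X U)
    (hiso : ConformalSurface.IsIsothermal X U)
    (hn : ConformalSurface.IsUnitNormal X n U)
    (lam : ConformalSurface.E4 → ℝ) (hlam : ConformalSurface.IsConformalFactor lam) :
    -- the associate surface and the Laplacian of its mean curvature at `ρ = 0`
    (ConformalSurface.UmbilicFree X n U →
      ∃ ys : (Fin 2 → ℝ) → ConformalSurface.Mink,
        ConformalSurface.IsDual lam X n U ys ∧ ContDiffOn ℝ ∞ ys U ∧
        (∀ ys', ConformalSurface.IsDual lam X n U ys' → Set.EqOn ys' ys U) ∧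
        (∀ u ∈ U, ∀ α ρ : ℝ,
          ConformalSurface.lor (ConformalSurface.normalField X n ![α, ρ, u 0, u 1])
            (ConformalSurface.normalField X n ![α, ρ, u 0, u 1]) = 1 ∧
          ∀ a, ConformalSurface.lor
            (ConformalSurface.pd a (ConformalSurface.associate lam X ys) ![α, ρ, u 0, u 1])
            (ConformalSurface.normalField X n ![α, ρ, u 0, u 1]) = 0) ∧
        ∀ u ∈ U, ∀ α : ℝ, 0 < α →
          (ConformalSurface.assocMetric lam X ys ![α, 0, u 0, u 1]).det < 0 ∧
          ConformalSurface.laplace (ConformalSurface.assocMetric lam X ys)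
              (ConformalSurface.assocMean lam X n ys) ![α, 0, u 0, u 1]
            = 2 * (α ^ 3)⁻¹ * ConformalSurface.scriptH lam X n u) ∧
    -- comparison with the round metric
    (∀ u ∈ U, ConformalSurface.scriptH lam X n u
      = (lam (X u) ^ 3)⁻¹ * ConformalSurface.willmoreCurv X n u) ∧
    -- conformal invariance of order 3
    (∀ mu : ConformalSurface.E4 → ℝ, ConformalSurface.IsConformalFactor mu →
      ∀ u ∈ U, ConformalSurface.scriptH (fun p => mu p * lam p) X n u
        = (mu (X u) ^ 3)⁻¹ * ConformalSurface.scriptH lam X n u) ∧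
    -- independence of the isothermal coordinates
    (∀ (V : Set (Fin 2 → ℝ)) (ψ : (Fin 2 → ℝ) → (Fin 2 → ℝ)), IsOpen V →
      ContDiffOn ℝ ∞ ψ V → Set.MapsTo ψ V U →
      ConformalSurface.IsImmersion (X ∘ ψ) V → ConformalSurface.IsIsothermal (X ∘ ψ) V →
      ∀ v ∈ V, ConformalSurface.scriptH lam (X ∘ ψ) (n ∘ ψ) v
        = ConformalSurface.scriptH lam X n (ψ v)) ∧
    -- vanishing exactly for Willmore surfaces
    ((∀ u ∈ U, ConformalSurface.scriptH lam X n u = 0) ↔ ConformalSurface.IsWillmore X U) := by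
  have S : ConformalSurface.IsothermalSurface X n U := ⟨hU, hX, hiso, hn⟩
  have hH : ∀ u ∈ U, ConformalSurface.scriptH lam X n u
      = (lam (X u) ^ 3)⁻¹ * ConformalSurface.willmoreCurv X n u := fun u hu => S.scriptH_eq hlam hu
  refine ⟨fun hf => ?_, hH, fun mu hmu u hu => ?_, fun V ψ hV hψ hm hi hc v hv => ?_,
    fun h => ?_, fun h u hu => ?_⟩
  · have hy := S.isDual_dualVec hlam hf
    have sy := S.smooth_dualVec hlam hf
    refine ⟨ConformalSurface.dualVec lam X n, hy, sy, fun ys' h' => S.isDual_unique hlam hf hy h',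
      fun u hu α ρ => ⟨?_, fun a => ?_⟩,
      fun u hu α hα => ⟨S.det_assocMetric hlam hy sy hu hα, S.laplace_assocMean hlam hy sy hu hα⟩⟩
    · have := S.lor_gaussMap_self hu
      rwa [← ConformalSurface.param_vec α ρ u] at this
    · exact S.lor_associate_normalField hlam hy sy (by rwa [ConformalSurface.param_vec]) a
  -- Both sides are multiples of the same round expression, with factors (μλ)⁻³ and μ⁻³ · λ⁻³.
  · rw [S.scriptH_eq (hmu.mul hlam) hu, hH u hu]
    ring
  · rw [(S.comp hV hψ hm hi hc).scriptH_eq hlam hv, S.willmoreCurv_comp hV hψ hm hi hc hv,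
      hH _ (hm hv)]
    rfl
  · refine S.isWillmore fun u hu => ?_
    have h0 := h u hu
    rw [hH u hu] at h0
    exact (mul_eq_zero.1 h0).resolve_left (inv_ne_zero (pow_ne_zero 3 (S.lam_pos hlam hu).ne'))
  · rw [hH u hu, S.willmoreCurv_eq_zero_of_isWillmore h u hu, mul_zero]
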